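/- Let $X$ and $Y$ be complex manifolds (finite-dimensional, Hausdorff, second countable). Write $\mathcal A^{p,q}$ for smooth $(p,q)$-forms and $H^{p,q}(X)$, $H^{p,q}(X;\operatorname{End}E)$ for Dolbeault cohomology, i.e. $\bar\partial$-closed forms in $\mathcal A^{p,q}(X)$, respectively $\mathcal A^{p,q}(X;\operatorname{End} E)$, modulo $\bar\partial$-exact ones; products, pullbacks along holomorphic maps and traces on these groups are induced by those of forms. A Higgs bundle $(E,\theta)$ is a holomorphic vector bundle $(E,\bar\partial_E)$ with a form $\theta\in\mathcal A^{1,0}(X;\operatorname{End}E)$ such that $[\bar\partial_E,\theta]=0$ and $\theta\wedge\theta=0$. The Atiyah class $\operatorname{At}E\in H^{1,1}(X;\operatorname{End}E)$ is the class of the $(1,1)$-part of the curvature of any smooth connection $\nabla$ on $E$ whose $(0,1)$-part is $\bar\partial_E$. For $k\ge 0$ put $$\operatorname{at}_k(E)=\frac1{k!}\Big(\frac{i}{2\pi}\Big)^k\operatorname{tr}\big((\operatorname{At}E)^k\big)\in H^{k,k}(X),\qquad \operatorname{ah}_k(E,\theta)=\frac1{k!}\Big(\frac{i}{2\pi}\Big)^k\operatorname{tr}\big((\operatorname{At}E)^k\theta\big)\in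 H^{k+1,k}(X).$$ The products and pullbacks of Dolbeault classes and the classes $\operatorname{At}E$, $\operatorname{at}_k(E)$, $\operatorname{ah}_k(E,\theta)$ are well defined: every $E$ has a connection $\nabla$ with $(0,1)$-part $\bar\partial_E$, and for every such $\nabla$ the forms $(\nabla^2)_{(1,1)}$, $\frac1{k!}(\frac{i}{2\pi})^k\operatorname{tr}((\nabla^2)_{(1,1)}^k)$ and $\frac1{k!}(\frac{i}{2\pi})^k\operatorname{tr}((\nabla^2)_{(1,1)}^k\,\theta)$ are $\bar\partial$-closed representatives of them. Moreover, for all $k\ge 0$: 1. If $f:X\to Y$ is holomorphic and $(E,\theta)$ is a Higgs bundle on $Y$, then $(f^*E,f^*\theta)$ is a Higgs bundle on $X$ and $\operatorname{ah}_k(f^*E,f^*\theta)=f^*\operatorname{ah}_k(E,\theta)$. 2. If $0\to(E',\theta')\to(E,\theta)\to(E'',\theta'')\to0$ is a short exact sequence of Higgs bundles on $X$, then $\operatorname{ah}_k(E,\theta)=\operatorname{ah}_k(E',\theta')+\operatorname{ah}_k(E'',\theta'')$. 3. If $(E',\theta')$ and $(E'',\theta'')$ are Higgs bundles on $X$, then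 $(E'\otimes E'',\ \theta'\otimes\mathbb 1_{E''}+\mathbb 1_{E'}\otimes\theta'')$ is a Higgs bundle and $$\operatorname{ah}_k(E'\otimes E'',\,\theta'\otimes\mathbb 1_{E''}+\mathbb 1_{E'}\otimes\theta'')=\sum_{j=0}^k\big(\operatorname{ah}_j(E',\theta')\operatorname{at}_{k-j}(E'')+\operatorname{at}_j(E')\operatorname{ah}_{k-j}(E'',\theta'')\big).$$ -/

import Mathlib

open scoped Manifold ContDiff

universe u₁ u₂ u₃

namespace HiggsClasses

noncomputable section

/-! ### Alternating forms on a complex vector space -/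

section Pointwise

variable {V : Type*} [NormedAddCommGroup V] [NormedSpace ℂ V]

/-- Continuous alternating real-multilinear maps `V^k → F` for complex normed spaces `V` and `F`. -/
abbrev AltG (V F : Type*) [NormedAddCommGroup V] [NormedSpace ℂ V]
    [NormedAddCommGroup F] [NormedSpace ℂ F] (k : ℕ) : Type _ := V [⋀^Fin k]→L[ℝ] F

/-- Complex-valued alternating real-multilinear `k`-forms on `V`. (The detour through a general
target only pins down the real structure of `ℂ`.) -/
abbrev Alt (V : Type*) [NormedAddCommGroup V] [NormedSpace ℂ V] (k : ℕ) : Type _ := AltG V ℂ k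

/-- The multilinear map `(v₁, …, v_{m+n}) ↦ a(v₁, …, v_m) b(v_{m+1}, …, v_{m+n})`. -/
def mulForms {m n N : ℕ} (h : m + n = N) (a : Alt V m) (b : Alt V n) :
    ContinuousMultilinearMap ℝ (fun _ : Fin N => V) ℂ where
  toMultilinearMap :=
    ((LinearMap.mul' ℝ ℂ).compMultilinearMap
      (MultilinearMap.domCoprod (a.toAlternatingMap : MultilinearMap ℝ (fun _ : Fin m => V) ℂ)
        (b.toAlternatingMap : MultilinearMap ℝ (fun _ : Fin n => V) ℂ))).domDomCongr
      (finSumFinEquiv.trans (finCongr h))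
  cont := by
    change Continuous fun v : Fin N → V =>
      a (fun i => v (finCongr h (finSumFinEquiv (Sum.inl i)))) *
        b (fun i => v (finCongr h (finSumFinEquiv (Sum.inr i))))
    fun_prop

/-- The wedge product `a ∧ b = (1 / (m! n!)) ∑_σ sign(σ) σ(a ⊗ b)`, i.e. the sum over all
`(m, n)`-shuffles. -/
def wedge {m n N : ℕ} (h : m + n = N) (a : Alt V m) (b : Alt V n) :
    Alt V N :=
  ((m.factorial * n.factorial : ℕ) : ℂ)⁻¹ •
    ContinuousMultilinearMap.alternatization (mulForms h a b)

/-- `a` is of bidegree `(p, q)` (used for forms of degree `p + q`):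
multiplying all arguments by `c ∈ ℂ` multiplies the value by `c ^ p * conj c ^ q`. -/
def IsType (p q : ℕ) {N : ℕ} (a : Alt V N) : Prop :=
  ∀ (c : ℂ) (v : Fin N → V), a (fun i => c • v i) = c ^ p * (starRingEnd ℂ c) ^ q * a v

theorem IsType.add {p q N : ℕ} {a b : Alt V N} (ha : IsType p q a) (hb : IsType p q b) :
    IsType p q (a + b) := fun c v => by
  simp [ha c v, hb c v, mul_add]

theorem IsType.const_smul {p q N : ℕ} {a : Alt V N} (z : ℂ) (ha : IsType p q a) :
    IsType p q (z • a) := fun c v => by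
  simp [ha c v]; ring

theorem IsType.zero {p q N : ℕ} : IsType p q (0 : Alt V N) := fun c v => by simp

/-- Multiplication by `i` as a real-linear map. -/
def mulI : V →L[ℝ] V := (Complex.I • ContinuousLinearMap.id ℂ V).restrictScalars ℝ

/-- The bidegree `(1, 1)` part of a `2`-form: multiplication of both arguments by `i` acts as `-1`
on the parts of bidegree `(2, 0)` and `(0, 2)`, and as `1` on the part of bidegree `(1, 1)`. -/
def part11 (a : Alt V (1 + 1)) : Alt V (1 + 1) :=
  (1 / 2 : ℂ) • (a + a.compContinuousLinearMap mulI)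

/-- The conjugate-linear part `v ↦ (L v + i L(i v)) / 2` of a real-linear map `L`. -/
def antilinPart {k : ℕ} (L : V →L[ℝ] (Alt V k)) : V →L[ℝ] (Alt V k) :=
  (1 / 2 : ℂ) • (L + Complex.I • L.comp mulI)

end Pointwise

/-! ### Differential forms on complex manifolds and Dolbeault cohomology -/

section Forms

variable (V : Type*) [NormedAddCommGroup V] [NormedSpace ℂ V]
  (X : Type*) [TopologicalSpace X] [ChartedSpace V X]

/-- Complex-valued `k`-forms on `X` (no regularity). The value at `x` is an alternating form on
`TangentSpace 𝓘(ℂ, V) x`, which is by definition a copy of `V`, identified with the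
tangent space through the preferred chart at `x`. -/
abbrev Form (k : ℕ) : Type _ := X → Alt V k

variable {V X}

/-- The complex derivative of a map at `x`, as a real-linear map between the tangent spaces. -/
def realDeriv {V W X Y : Type*} [NormedAddCommGroup V] [NormedSpace ℂ V]
    [NormedAddCommGroup W] [NormedSpace ℂ W] [TopologicalSpace X] [ChartedSpace V X]
    [TopologicalSpace Y] [ChartedSpace W Y] (f : X → Y) (x : X) : V →L[ℝ] W :=
  let D : V →L[ℂ] W := mfderiv 𝓘(ℂ, V) 𝓘(ℂ, W) f x
  D.restrictScalars ℝ

/-- The form `φ` written in the preferred chart at `x₀`, i.e. its pullback under the inverse of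
the chart. It is meaningful on the target of the chart. -/
def coordRep (x₀ : X) {k : ℕ} (φ : Form V X k) : V → Alt V k := fun y =>
  (φ ((chartAt V x₀).symm y)).compContinuousLinearMap (realDeriv (chartAt V x₀).symm y)

/-- `φ` is `C^∞` (in the real sense) at `x`. -/
def SmoothAt {k : ℕ} (φ : Form V X k) (x : X) : Prop :=
  ContDiffAt ℝ ∞ (coordRep x φ) (chartAt V x x)

/-- Exterior derivative. -/
def extD {k : ℕ} (φ : Form V X k) : Form V X (k + 1) := fun x =>
  extDeriv (coordRep x φ) (chartAt V x x)

/-- The operator `∂̄`: in holomorphic coordinates the coefficients are differentiated in the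
antiholomorphic directions only. -/
def dbar {k : ℕ} (φ : Form V X k) : Form V X (k + 1) := fun x =>
  ContinuousAlternatingMap.alternatizeUncurryFin
    (antilinPart (fderiv ℝ (coordRep x φ) (chartAt V x x)))

/-- A function as a `0`-form. -/
def ofFun (g : X → ℂ) : Form V X 0 := fun x =>
  ContinuousAlternatingMap.constOfIsEmpty ℝ V (Fin 0) (g x)

/-- Pullback of forms along a map, through its complex derivative. -/
def pullbackForm {W : Type*} [NormedAddCommGroup W] [NormedSpace ℂ W]
    {Y : Type*} [TopologicalSpace Y] [ChartedSpace W Y]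
    (f : X → Y) {k : ℕ} (φ : Form W Y k) : Form V X k := fun x =>
  (φ (f x)).compContinuousLinearMap (realDeriv f x)

theorem coordRep_add (x₀ : X) {k : ℕ} (φ η : Form V X k) :
    coordRep x₀ (φ + η) = coordRep x₀ φ + coordRep x₀ η := rfl

theorem coordRep_smul (x₀ : X) {k : ℕ} (c : ℂ) (φ : Form V X k) :
    coordRep x₀ (c • φ) = c • coordRep x₀ φ := rfl

theorem coordRep_zero (x₀ : X) {k : ℕ} :
    coordRep x₀ (0 : Form V X k) = fun _ => 0 := rfl

theorem SmoothAt.add {k : ℕ} {φ η : Form V X k} {x : X} (h₁ : SmoothAt φ x) (h₂ : SmoothAt η x) :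
    SmoothAt (φ + η) x := ContDiffAt.add h₁ h₂

theorem SmoothAt.const_smul {k : ℕ} {φ : Form V X k} {x : X} (c : ℂ) (h : SmoothAt φ x) :
    SmoothAt (c • φ) x := ContDiffAt.const_smul c h

theorem SmoothAt.zero {k : ℕ} (x : X) : SmoothAt (0 : Form V X k) x :=
  (contDiffAt_const : ContDiffAt ℝ ∞ (fun _ : V => (0 : Alt V k)) _)

theorem SmoothAt.differentiableAt {k : ℕ} {φ : Form V X k} {x : X} (h : SmoothAt φ x) :
    DifferentiableAt ℝ (coordRep x φ) (chartAt V x x) :=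
  ContDiffAt.differentiableAt h (by simp)

theorem dbar_add {k : ℕ} {φ η : Form V X k} {x : X} (h₁ : SmoothAt φ x) (h₂ : SmoothAt η x) :
    dbar (φ + η) x = dbar φ x + dbar η x := by
  have : fderiv ℝ (coordRep x (φ + η)) (chartAt V x x) =
      fderiv ℝ (coordRep x φ) (chartAt V x x) + fderiv ℝ (coordRep x η) (chartAt V x x) := by
    rw [coordRep_add]
    exact fderiv_add h₁.differentiableAt h₂.differentiableAt
  unfold dbar
  rw [this, ← ContinuousAlternatingMap.alternatizeUncurryFin_add]
  congr 1
  ext v w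
  simp [antilinPart]
  ring

theorem dbar_smul {k : ℕ} {φ : Form V X k} {x : X} (c : ℂ) (h : SmoothAt φ x) :
    dbar (c • φ) x = c • dbar φ x := by
  have : fderiv ℝ (coordRep x (c • φ)) (chartAt V x x) =
      c • fderiv ℝ (coordRep x φ) (chartAt V x x) := by
    rw [coordRep_smul]
    exact fderiv_const_smul h.differentiableAt c
  unfold dbar
  rw [this]
  ext v
  simp only [ContinuousAlternatingMap.alternatizeUncurryFin_apply,
    ContinuousAlternatingMap.smul_apply, antilinPart, Finset.smul_sum]
  refine Finset.sum_congr rfl fun i _ => ?_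
  simp
  ring

theorem dbar_zero {k : ℕ} (x : X) : dbar (0 : Form V X k) x = 0 := by
  have := dbar_smul (0 : ℂ) (SmoothAt.zero (V := V) (k := k) x)
  simpa using this

variable (V X)

/-- `𝒜^{p,q}(X)`: the smooth forms of bidegree `(p, q)`. -/
def smoothForms (p q : ℕ) : Submodule ℂ (Form V X (p + q)) where
  carrier := {φ | (∀ x, SmoothAt φ x) ∧ ∀ x, IsType p q (φ x)}
  add_mem' h₁ h₂ := ⟨fun x => (h₁.1 x).add (h₂.1 x), fun x => (h₁.2 x).add (h₂.2 x)⟩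
  zero_mem' := ⟨SmoothAt.zero, fun _ => IsType.zero⟩
  smul_mem' a _ h := ⟨fun x => (h.1 x).const_smul a, fun x => (h.2 x).const_smul a⟩

/-- The `∂̄`-closed forms in `𝒜^{p,q}(X)`. -/
def cocycles (p q : ℕ) : Submodule ℂ (Form V X (p + q)) where
  carrier := {φ | φ ∈ smoothForms V X p q ∧ ∀ x, dbar φ x = 0}
  add_mem' h₁ h₂ := ⟨Submodule.add_mem _ h₁.1 h₂.1, fun x => by
    rw [dbar_add (h₁.1.1 x) (h₂.1.1 x), h₁.2 x, h₂.2 x, add_zero]⟩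
  zero_mem' := ⟨Submodule.zero_mem _, dbar_zero⟩
  smul_mem' a φ h := ⟨Submodule.smul_mem _ a h.1, fun x => by
    rw [dbar_smul a (h.1.1 x), h.2 x, smul_zero]⟩

/-- The `∂̄`-exact forms of bidegree `(p, q)`: the forms `∂̄η` with `η ∈ 𝒜^{p,q-1}(X)`. -/
def coboundaries (p : ℕ) : (q : ℕ) → Submodule ℂ (Form V X (p + q))
  | 0 => ⊥
  | q + 1 =>
    { carrier := {φ | ∃ η ∈ smoothForms V X p q, ∀ x, φ x = dbar η x}
      add_mem' := by
        rintro _ _ ⟨η₁, h₁, e₁⟩ ⟨η₂, h₂, e₂⟩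
        exact ⟨η₁ + η₂, Submodule.add_mem _ h₁ h₂, fun x => by
          rw [dbar_add (h₁.1 x) (h₂.1 x), ← e₁, ← e₂]; rfl⟩
      zero_mem' := ⟨0, Submodule.zero_mem _, fun x => (dbar_zero x).symm⟩
      smul_mem' := by
        rintro a _ ⟨η, h, e⟩
        exact ⟨a • η, Submodule.smul_mem _ a h, fun x => by
          rw [dbar_smul a (h.1 x), ← e]; rfl⟩ }

/-- The Dolbeault cohomology group `H^{p,q}(X)`. -/
abbrev Dolbeault (p q : ℕ) : Type _ :=
  ↥(cocycles V X p q) ⧸ (coboundaries V X p q).comap (cocycles V X p q).subtype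

variable {V X}

/-- `φ` is a `∂̄`-closed form of bidegree `(p, q)` with Dolbeault class `c`. -/
def Represents {p q : ℕ} (φ : Form V X (p + q)) (c : Dolbeault V X p q) : Prop :=
  ∃ h : φ ∈ cocycles V X p q, Submodule.Quotient.mk ⟨φ, h⟩ = c

/-- The product `H^{p,q}(X) × H^{p',q'}(X) → H^{p+p',q+q'}(X)`: the class that is represented by
`α ∧ β` for all representatives `α` and `β` of the two factors. -/
def cup {p q p' q' P Q : ℕ} (hP : p + p' = P) (hQ : q + q' = Q)
    (a : Dolbeault V X p q) (b : Dolbeault V X p' q') : Dolbeault V X P Q :=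
  Classical.epsilon fun c => ∀ (α : Form V X (p + q)) (β : Form V X (p' + q')),
    Represents α a → Represents β b →
      Represents (p := P) (q := Q) (fun x => wedge (by omega) (α x) (β x)) c

/-- The pullback `f^* : H^{p,q}(Y) → H^{p,q}(X)` along a holomorphic map `f : X → Y`: the class that
is represented by `f^* φ` for all representatives `φ` of the given class. -/
def pullbackClass {W : Type*} [NormedAddCommGroup W] [NormedSpace ℂ W]
    {Y : Type*} [TopologicalSpace Y] [ChartedSpace W Y]
    (f : X → Y) {p q : ℕ} (c : Dolbeault W Y p q) : Dolbeault V X p q :=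
  Classical.epsilon fun c' => ∀ φ : Form W Y (p + q),
    Represents φ c → Represents (pullbackForm f φ) c'

end Forms

/-! ### Holomorphic vector bundles -/

section Bundles

/-- A holomorphic vector bundle on the complex manifold `X`, with fibre `ℂ^n`, given by
holomorphic transition functions (a Mathlib `VectorBundleCore`). The fibre over `x` is `ℂ^n`,
read in the frame with index `core.indexAt x`. -/
structure HolBundle (V : Type u₁) [NormedAddCommGroup V] [NormedSpace ℂ V]
    (X : Type u₂) [TopologicalSpace X] [ChartedSpace V X] where
  /-- The index set of the local frames. -/
  ι : Type u₃
  /-- The index set of the members of a frame. -/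
  n : Type
  [fintype_n : Fintype n]
  [decEq_n : DecidableEq n]
  core : VectorBundleCore ℂ X (n → ℂ) ι
  holomorphic : core.IsContMDiff 𝓘(ℂ, V) ω

attribute [instance] HolBundle.fintype_n HolBundle.decEq_n

variable {V : Type*} [NormedAddCommGroup V] [NormedSpace ℂ V]
  {X : Type*} [TopologicalSpace X] [ChartedSpace V X]

namespace HolBundle

variable (E : HolBundle V X)

/-- The transition matrix from coordinates in frame `i` to coordinates in frame `j`. -/
def trans (i j : E.ι) (x : X) : Matrix E.n E.n ℂ :=
  LinearMap.toMatrix' (E.core.coordChange i j x : (E.n → ℂ) →ₗ[ℂ] (E.n → ℂ))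

end HolBundle

/-- The vector bundle core with fibre `ℂ^n` defined by a continuous cocycle of matrices. -/
def coreOfMatrix {ι n : Type*} [Fintype n] [DecidableEq n] (U : ι → Set X)
    (hU : ∀ i, IsOpen (U i)) (idx : X → ι) (hidx : ∀ x, x ∈ U (idx x))
    (g : ι → ι → X → Matrix n n ℂ) (g_self : ∀ i, ∀ x ∈ U i, g i i x = 1)
    (g_cont : ∀ i j a b, ContinuousOn (fun x => g i j x a b) (U i ∩ U j))
    (g_comp : ∀ i j k, ∀ x ∈ U i ∩ U j ∩ U k, g j k x * g i j x = g i k x) :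
    VectorBundleCore ℂ X (n → ℂ) ι where
  baseSet := U
  isOpen_baseSet := hU
  indexAt := idx
  mem_baseSet_at := hidx
  coordChange i j x := LinearMap.toContinuousLinearMap (Matrix.toLin' (g i j x))
  coordChange_self i x hx v := by simp [g_self i x hx]
  continuousOn_coordChange i j := by
    have h : ContinuousOn (g i j) (U i ∩ U j) :=
      continuousOn_pi.2 fun a => continuousOn_pi.2 fun b => g_cont i j a b
    have L : Continuous ((Matrix.toLin' (R := ℂ) (m := n) (n := n)).trans
        LinearMap.toContinuousLinearMap).toLinearMap :=
      LinearMap.continuous_of_finiteDimensional _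
    exact L.comp_continuousOn h
  coordChange_comp i j k x hx v := by
    simp [← g_comp i j k x hx, Matrix.mulVec_mulVec]

/-- If the matrix entries are holomorphic, then so is the bundle. -/
theorem coreOfMatrix_isContMDiff {ι n : Type*} [Fintype n] [DecidableEq n] (U : ι → Set X)
    (hU : ∀ i, IsOpen (U i)) (idx : X → ι) (hidx : ∀ x, x ∈ U (idx x))
    (g : ι → ι → X → Matrix n n ℂ) (g_self : ∀ i, ∀ x ∈ U i, g i i x = 1)
    (g_cont : ∀ i j a b, ContinuousOn (fun x => g i j x a b) (U i ∩ U j))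
    (g_comp : ∀ i j k, ∀ x ∈ U i ∩ U j ∩ U k, g j k x * g i j x = g i k x)
    (g_hol : ∀ i j a b, ContMDiffOn 𝓘(ℂ, V) 𝓘(ℂ, ℂ) ω (fun x => g i j x a b) (U i ∩ U j)) :
    (coreOfMatrix U hU idx hidx g g_self g_cont g_comp).IsContMDiff 𝓘(ℂ, V) ω := by
  refine ⟨fun i j => ?_⟩
  have h : ContMDiffOn 𝓘(ℂ, V) 𝓘(ℂ, n → n → ℂ) ω (fun x a b => g i j x a b) (U i ∩ U j) :=
    contMDiffOn_pi_space.2 fun a => contMDiffOn_pi_space.2 fun b => g_hol i j a b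
  let L : (n → n → ℂ) →L[ℂ] ((n → ℂ) →L[ℂ] (n → ℂ)) :=
    LinearMap.toContinuousLinearMap ((Matrix.toLin' (R := ℂ) (m := n) (n := n)).trans
        LinearMap.toContinuousLinearMap).toLinearMap
  exact L.contMDiff.comp_contMDiffOn h

namespace HolBundle

theorem trans_self (E : HolBundle V X) (i : E.ι) (x : X) (hx : x ∈ E.core.baseSet i) :
    E.trans i i x = 1 := by
  have : (E.core.coordChange i i x : (E.n → ℂ) →ₗ[ℂ] (E.n → ℂ)) = LinearMap.id :=
    LinearMap.ext fun v => E.core.coordChange_self i x hx v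
  rw [trans, this, LinearMap.toMatrix'_id]

theorem trans_comp (E : HolBundle V X) (i j k : E.ι) (x : X)
    (hx : x ∈ E.core.baseSet i ∩ E.core.baseSet j ∩ E.core.baseSet k) :
    E.trans j k x * E.trans i j x = E.trans i k x := by
  rw [trans, trans, trans, ← LinearMap.toMatrix'_comp]
  congr 1
  exact LinearMap.ext fun v => E.core.coordChange_comp i j k x hx v

theorem trans_holomorphic (E : HolBundle V X) (i j : E.ι) (a b : E.n) :
    ContMDiffOn 𝓘(ℂ, V) 𝓘(ℂ, ℂ) ω (fun x => E.trans i j x a b)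
      (E.core.baseSet i ∩ E.core.baseSet j) := by
  have := E.holomorphic
  have h := E.core.contMDiffOn_coordChange 𝓘(ℂ, V) (n := ω) i j
  let L : ((E.n → ℂ) →L[ℂ] (E.n → ℂ)) →L[ℂ] ℂ :=
    (ContinuousLinearMap.proj a).comp (ContinuousLinearMap.apply ℂ (E.n → ℂ) (Pi.single b 1))
  refine (L.contMDiff.comp_contMDiffOn h).congr fun x _ => ?_
  simp [trans, L, LinearMap.toMatrix'_apply]

/-- The pullback bundle `f^* E` along a holomorphic map; its transition functions are
`g_{ij} ∘ f` and its fibre over `x` is the fibre of `E` over `f x`. -/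
def pullback {W : Type*} [NormedAddCommGroup W] [NormedSpace ℂ W]
    {Y : Type*} [TopologicalSpace Y] [ChartedSpace W Y] (E : HolBundle W Y)
    (f : X → Y) (hf : ContMDiff 𝓘(ℂ, V) 𝓘(ℂ, W) ω f) : HolBundle V X where
  ι := E.ι
  n := E.n
  core :=
    { baseSet := fun i => f ⁻¹' E.core.baseSet i
      isOpen_baseSet := fun i => (E.core.isOpen_baseSet i).preimage hf.continuous
      indexAt := fun x => E.core.indexAt (f x)
      mem_baseSet_at := fun x => E.core.mem_baseSet_at (f x)
      coordChange := fun i j x => E.core.coordChange i j (f x)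
      coordChange_self := fun i x hx => E.core.coordChange_self i (f x) hx
      continuousOn_coordChange := fun i j =>
        (E.core.continuousOn_coordChange i j).comp hf.continuous.continuousOn fun _ hx => hx
      coordChange_comp := fun i j k x hx => E.core.coordChange_comp i j k (f x) hx }
  holomorphic := by
    have := E.holomorphic
    exact ⟨fun i j => (E.core.contMDiffOn_coordChange 𝓘(ℂ, W) (n := ω) i j).comp
      hf.contMDiffOn fun _ hx => hx⟩

/-- The tensor product bundle `E' ⊗ E''`: frames are the tensor products of frames, and the
transition matrices are the Kronecker products. -/
def tensor (E' : HolBundle V X) (E'' : HolBundle V X) : HolBundle V X :=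
  let U : E'.ι × E''.ι → Set X := fun i => E'.core.baseSet i.1 ∩ E''.core.baseSet i.2
  let g : E'.ι × E''.ι → E'.ι × E''.ι → X → Matrix (E'.n × E''.n) (E'.n × E''.n) ℂ :=
    fun i j x => Matrix.kronecker (E'.trans i.1 j.1 x) (E''.trans i.2 j.2 x)
  have g_hol : ∀ i j a b, ContMDiffOn 𝓘(ℂ, V) 𝓘(ℂ, ℂ) ω (fun x => g i j x a b) (U i ∩ U j) :=
    fun i j a b => ((E'.trans_holomorphic i.1 j.1 a.1 b.1).mono
        fun _ hx => ⟨hx.1.1, hx.2.1⟩).mul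
      ((E''.trans_holomorphic i.2 j.2 a.2 b.2).mono fun _ hx => ⟨hx.1.2, hx.2.2⟩)
  have hU : ∀ i, IsOpen (U i) := fun i =>
    (E'.core.isOpen_baseSet i.1).inter (E''.core.isOpen_baseSet i.2)
  have g_self : ∀ i, ∀ x ∈ U i, g i i x = 1 := fun i x hx => by
    simp only [g]
    rw [trans_self _ _ _ hx.1, trans_self _ _ _ hx.2]
    exact Matrix.one_kronecker_one
  have g_comp : ∀ i j k, ∀ x ∈ U i ∩ U j ∩ U k, g j k x * g i j x = g i k x :=
    fun i j k x hx => by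
      simp only [g, Matrix.kronecker]
      rw [← Matrix.mul_kronecker_mul,
        E'.trans_comp i.1 j.1 k.1 x ⟨⟨hx.1.1.1, hx.1.2.1⟩, hx.2.1⟩,
        E''.trans_comp i.2 j.2 k.2 x ⟨⟨hx.1.1.2, hx.1.2.2⟩, hx.2.2⟩]
  { ι := E'.ι × E''.ι
    n := E'.n × E''.n
    core := coreOfMatrix U hU (fun x => (E'.core.indexAt x, E''.core.indexAt x))
      (fun x => ⟨E'.core.mem_baseSet_at x, E''.core.mem_baseSet_at x⟩) g g_self
      (fun i j a b => (g_hol i j a b).continuousOn) g_comp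
    holomorphic := coreOfMatrix_isContMDiff _ _ _ _ _ _ _ _ g_hol }

end HolBundle

/-- A holomorphic homomorphism `E' → E`: linear maps between the fibres whose matrices in local
frames have holomorphic entries. -/
structure HolHom (E' E : HolBundle V X) where
  map : X → (E'.n → ℂ) →ₗ[ℂ] (E.n → ℂ)
  holomorphic : ∀ (i' : E'.ι) (i : E.ι) (a : E.n) (b : E'.n),
    ContMDiffOn 𝓘(ℂ, V) 𝓘(ℂ, ℂ) ω
      (fun x => (E.trans (E.core.indexAt x) i x * LinearMap.toMatrix' (map x) *
        E'.trans i' (E'.core.indexAt x) x) a b)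
      (E'.core.baseSet i' ∩ E.core.baseSet i)

/-- `0 → E' → E → E'' → 0` is a short exact sequence of holomorphic vector bundles. -/
def IsShortExact {E' E E'' : HolBundle V X} (S : HolHom E' E) (P : HolHom E E'') : Prop :=
  ∀ x, Function.Injective (S.map x) ∧ LinearMap.range (S.map x) = LinearMap.ker (P.map x) ∧
    Function.Surjective (P.map x)

end Bundles

/-! ### Forms with values in `End E` -/

section EndForms

variable {V : Type*} [NormedAddCommGroup V] [NormedSpace ℂ V]
  {X : Type*} [TopologicalSpace X] [ChartedSpace V X]

/-- `k`-forms with values in `End E`. The value at `x` is an `End (E_x)`-valued form, i.e. a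
matrix of forms, since `E_x = ℂ^n`. -/
abbrev EndForm (E : HolBundle V X) (k : ℕ) : Type _ := X → Matrix E.n E.n (Alt V k)

/-- The matrix of the `End E`-valued form `α` in the local frame `i`. -/
def localRep (E : HolBundle V X) (i : E.ι) {k : ℕ} (α : EndForm E k) (a b : E.n) : Form V X k :=
  fun x => ∑ c, ∑ d,
    (E.trans (E.core.indexAt x) i x a c * E.trans i (E.core.indexAt x) x d b) • α x c d

/-- Smoothness of an `End E`-valued form: smoothness of its matrix entries in the local frames. -/
def EndSmooth (E : HolBundle V X) {k : ℕ} (α : EndForm E k) : Prop :=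
  ∀ (i : E.ι) (a b : E.n), ∀ x ∈ E.core.baseSet i, SmoothAt (localRep E i α a b) x

/-- The operator `∂̄` on `End E`-valued forms: in a holomorphic frame it is applied to the matrix
entries. -/
def endDbar (E : HolBundle V X) {k : ℕ} (α : EndForm E k) : EndForm E (k + 1) := fun x a b =>
  dbar (localRep E (E.core.indexAt x) α a b) x

/-- The product of `End E`-valued forms: wedge product of forms and composition of
endomorphisms. -/
def endMul {E : HolBundle V X} {m n N : ℕ} (h : m + n = N) (α : EndForm E m) (β : EndForm E n) :
    EndForm E N := fun x a b => ∑ c, wedge h (α x a c) (β x c b)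

/-- The identity of `E` as an `End E`-valued `0`-form. -/
def endOne (E : HolBundle V X) : EndForm E 0 := fun _ a b =>
  if a = b then ContinuousAlternatingMap.constOfIsEmpty ℝ V (Fin 0) 1 else 0

/-- The trace of an `End E`-valued form. -/
def endTr {E : HolBundle V X} {k : ℕ} (α : EndForm E k) : Form V X k := fun x => ∑ a, α x a a

theorem localRep_add (E : HolBundle V X) (i : E.ι) {k : ℕ} (α β : EndForm E k) (a b : E.n) :
    localRep E i (α + β) a b = localRep E i α a b + localRep E i β a b := by
  funext x
  simp [localRep, Finset.sum_add_distrib]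

theorem localRep_smul (E : HolBundle V X) (i : E.ι) {k : ℕ} (z : ℂ) (α : EndForm E k) (a b : E.n) :
    localRep E i (z • α) a b = z • localRep E i α a b := by
  funext x
  simp only [localRep, Pi.smul_apply, Matrix.smul_apply, Finset.smul_sum]
  refine Finset.sum_congr rfl fun c _ => Finset.sum_congr rfl fun d _ => smul_comm _ _ _

theorem localRep_zero (E : HolBundle V X) (i : E.ι) {k : ℕ} (a b : E.n) :
    localRep E i (0 : EndForm E k) a b = 0 := by
  funext x
  simp [localRep]

/-- `𝒜^{p,q}(X; End E)`: the smooth `End E`-valued forms of bidegree `(p, q)`. -/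
def endSmoothForms (E : HolBundle V X) (p q : ℕ) : Submodule ℂ (EndForm E (p + q)) where
  carrier := {α | EndSmooth E α ∧ ∀ x a b, IsType p q (α x a b)}
  add_mem' h₁ h₂ := ⟨fun i a b x hx => by
      rw [localRep_add]; exact (h₁.1 i a b x hx).add (h₂.1 i a b x hx),
    fun x a b => (h₁.2 x a b).add (h₂.2 x a b)⟩
  zero_mem' := ⟨fun i a b x _ => by rw [localRep_zero]; exact SmoothAt.zero x,
    fun _ _ _ => IsType.zero⟩
  smul_mem' z α h := ⟨fun i a b x hx => by
      rw [localRep_smul]; exact (h.1 i a b x hx).const_smul z,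
    fun x a b => (h.2 x a b).const_smul z⟩

theorem endDbar_add (E : HolBundle V X) {k : ℕ} {α β : EndForm E k}
    (h₁ : EndSmooth E α) (h₂ : EndSmooth E β) :
    endDbar E (α + β) = endDbar E α + endDbar E β := by
  funext x a b
  simp only [endDbar, localRep_add]
  exact dbar_add (h₁ _ a b x (E.core.mem_baseSet_at x)) (h₂ _ a b x (E.core.mem_baseSet_at x))

theorem endDbar_smul (E : HolBundle V X) {k : ℕ} {α : EndForm E k} (z : ℂ) (h : EndSmooth E α) :
    endDbar E (z • α) = z • endDbar E α := by
  funext x a b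
  simp only [endDbar, localRep_smul]
  exact dbar_smul z (h _ a b x (E.core.mem_baseSet_at x))

theorem endDbar_zero (E : HolBundle V X) {k : ℕ} : endDbar E (0 : EndForm E k) = 0 := by
  funext x a b
  simp only [endDbar, localRep_zero]
  exact dbar_zero x

/-- The `∂̄`-closed forms in `𝒜^{p,q}(X; End E)`. -/
def endCocycles (E : HolBundle V X) (p q : ℕ) : Submodule ℂ (EndForm E (p + q)) where
  carrier := {α | α ∈ endSmoothForms E p q ∧ endDbar E α = 0}
  add_mem' h₁ h₂ := ⟨Submodule.add_mem _ h₁.1 h₂.1, by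
    rw [endDbar_add E h₁.1.1 h₂.1.1, h₁.2, h₂.2, add_zero]⟩
  zero_mem' := ⟨Submodule.zero_mem _, endDbar_zero E⟩
  smul_mem' z α h := ⟨Submodule.smul_mem _ z h.1, by
    rw [endDbar_smul E z h.1.1, h.2, smul_zero]⟩

/-- The `∂̄`-exact `End E`-valued forms of bidegree `(p, q)`. -/
def endCoboundaries (E : HolBundle V X) (p : ℕ) : (q : ℕ) → Submodule ℂ (EndForm E (p + q))
  | 0 => ⊥
  | q + 1 =>
    { carrier := {α | ∃ η ∈ endSmoothForms E p q, α = endDbar E η}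
      add_mem' := by
        rintro _ _ ⟨η₁, h₁, rfl⟩ ⟨η₂, h₂, rfl⟩
        exact ⟨η₁ + η₂, Submodule.add_mem _ h₁ h₂, (endDbar_add E h₁.1 h₂.1).symm⟩
      zero_mem' := ⟨0, Submodule.zero_mem _, (endDbar_zero E).symm⟩
      smul_mem' := by
        rintro z _ ⟨η, h, rfl⟩
        exact ⟨z • η, Submodule.smul_mem _ z h, (endDbar_smul E z h.1).symm⟩ }

/-- The Dolbeault cohomology group `H^{p,q}(X; End E)`. -/
abbrev EndDolbeault (E : HolBundle V X) (p q : ℕ) : Type _ :=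
  ↥(endCocycles E p q) ⧸ (endCoboundaries E p q).comap (endCocycles E p q).subtype

/-- `α` is a `∂̄`-closed `End E`-valued form of bidegree `(p, q)` with Dolbeault class `c`. -/
def EndRepresents {E : HolBundle V X} {p q : ℕ} (α : EndForm E (p + q)) (c : EndDolbeault E p q) :
    Prop :=
  ∃ h : α ∈ endCocycles E p q, Submodule.Quotient.mk ⟨α, h⟩ = c

/-- The class of a `∂̄`-closed `End E`-valued form. -/
def endClass {E : HolBundle V X} {p q : ℕ} (α : EndForm E (p + q)) : EndDolbeault E p q :=
  Classical.epsilon fun c => EndRepresents α c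

/-- The product `H^{p,q}(X; End E) × H^{p',q'}(X; End E) → H^{p+p',q+q'}(X; End E)`: the class that
is represented by `α ∧ β` for all representatives `α` and `β` of the two factors. -/
def endCup {E : HolBundle V X} {p q p' q' P Q : ℕ} (hP : p + p' = P) (hQ : q + q' = Q)
    (a : EndDolbeault E p q) (b : EndDolbeault E p' q') : EndDolbeault E P Q :=
  Classical.epsilon fun c => ∀ (α : EndForm E (p + q)) (β : EndForm E (p' + q')),
    EndRepresents α a → EndRepresents β b →
      EndRepresents (p := P) (q := Q) (endMul (by omega) α β) c

/-- The powers in `⨁ H^{k,k}(X; End E)` of a class in `H^{1,1}(X; End E)`. -/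
def endPow {E : HolBundle V X} (a : EndDolbeault E 1 1) : (k : ℕ) → EndDolbeault E k k
  | 0 => endClass (p := 0) (q := 0) (endOne E)
  | k + 1 => endCup rfl rfl (endPow a k) a

/-- The trace `H^{p,q}(X; End E) → H^{p,q}(X)`: the class that is represented by `tr α` for all
representatives `α` of the given class. -/
def trClass {E : HolBundle V X} {p q : ℕ} (a : EndDolbeault E p q) : Dolbeault V X p q :=
  Classical.epsilon fun c => ∀ α : EndForm E (p + q), EndRepresents α a → Represents (endTr α) c

/-! ### Connections and Atiyah classes -/

/-- A smooth connection on `E`: it is `d + A_i` in the local frame `i`, where `A_i` is a smooth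
matrix of `1`-forms and `A_j g_{ij} = g_{ij} A_i - d g_{ij}` on overlaps. -/
structure Connection (E : HolBundle V X) where
  form : E.ι → E.n → E.n → Form V X 1
  smooth : ∀ i a b, ∀ x ∈ E.core.baseSet i, SmoothAt (form i a b) x
  gauge : ∀ i j, ∀ x ∈ E.core.baseSet i ∩ E.core.baseSet j, ∀ a b,
    ∑ c, E.trans i j x c b • form j a c x =
      ∑ c, E.trans i j x a c • form i c b x - extD (ofFun fun y => E.trans i j y a b) x

namespace Connection

variable {E : HolBundle V X}

/-- The `(0, 1)` part of the connection is `∂̄_E`: in the holomorphic frames of `E`, the connection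
forms are of bidegree `(1, 0)`. -/
def IsCompatible (D : Connection E) : Prop :=
  ∀ i, ∀ x ∈ E.core.baseSet i, ∀ a b, IsType 1 0 (D.form i a b x)

/-- The curvature, given in the local frame `i` by `d A_i + A_i ∧ A_i`. -/
def curvature (D : Connection E) : EndForm E (1 + 1) := fun x a b =>
  extD (D.form (E.core.indexAt x) a b) x +
    ∑ c, wedge rfl (D.form (E.core.indexAt x) a c x) (D.form (E.core.indexAt x) c b x)

/-- The bidegree `(1, 1)` part of the curvature. -/
def curvature11 (D : Connection E) : EndForm E (1 + 1) := fun x a b => part11 (D.curvature x a b)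

/-- The powers of the bidegree `(1, 1)` part of the curvature. -/
def curvaturePow (D : Connection E) : (k : ℕ) → EndForm E (k + k)
  | 0 => endOne E
  | k + 1 => endMul (by omega) (D.curvaturePow k) D.curvature11

end Connection

/-- The Atiyah class `At E ∈ H^{1,1}(X; End E)`: the class that is represented by the bidegree
`(1, 1)` part of the curvature of every connection whose `(0, 1)` part is `∂̄_E`. -/
def atiyah (E : HolBundle V X) : EndDolbeault E 1 1 :=
  Classical.epsilon fun c => ∀ D : Connection E, D.IsCompatible → EndRepresents D.curvature11 c

/-- The constant `(1 / k!) (i / 2π)^k`. -/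
def coeff (k : ℕ) : ℂ := 1 / (k.factorial : ℂ) * (Complex.I / (2 * Real.pi)) ^ k

/-- The scalar Atiyah class `at_k(E) = (1 / k!) (i / 2π)^k tr((At E)^k) ∈ H^{k,k}(X)`. -/
def atClass (k : ℕ) (E : HolBundle V X) : Dolbeault V X k k :=
  coeff k • trClass (endPow (atiyah E) k)

/-! ### Higgs bundles -/

/-- `θ` is a Higgs field on `E`: a smooth `End E`-valued `(1, 0)`-form with
`[∂̄_E, θ] = 0` and `θ ∧ θ = 0`. -/
def IsHiggsField (E : HolBundle V X) (θ : EndForm E (1 + 0)) : Prop :=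
  θ ∈ endSmoothForms E 1 0 ∧ endDbar E θ = 0 ∧ endMul (N := 2) rfl θ θ = 0

/-- `ah_k(E, θ) = (1 / k!) (i / 2π)^k tr((At E)^k θ) ∈ H^{k+1,k}(X)`. -/
def ahClass (k : ℕ) (E : HolBundle V X) (θ : EndForm E (1 + 0)) : Dolbeault V X (k + 1) k :=
  coeff k • trClass (endCup rfl rfl (endPow (atiyah E) k) (endClass θ))

/-- The pullback `f^* θ`, an `End (f^* E)`-valued form. -/
def pullbackEnd {W : Type*} [NormedAddCommGroup W] [NormedSpace ℂ W]
    {Y : Type*} [TopologicalSpace Y] [ChartedSpace W Y] {E : HolBundle W Y}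
    (f : X → Y) (hf : ContMDiff 𝓘(ℂ, V) 𝓘(ℂ, W) ω f) {k : ℕ} (θ : EndForm E k) :
    EndForm (E.pullback f hf) k :=
  fun x a b => pullbackForm f (fun y => θ y a b) x

/-- The Higgs field `θ' ⊗ 1 + 1 ⊗ θ''` on `E' ⊗ E''`. -/
def tensorHiggs {E' E'' : HolBundle V X} {k : ℕ} (θ' : EndForm E' k) (θ'' : EndForm E'' k) :
    EndForm (E'.tensor E'') k :=
  fun x (a b : E'.n × E''.n) =>
    (if a.2 = b.2 then θ' x a.1 b.1 else 0) + (if a.1 = b.1 then θ'' x a.2 b.2 else 0)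

/-- The bundle homomorphism intertwines the Higgs fields. -/
def IsHiggsHom {E' E : HolBundle V X} (S : HolHom E' E) (θ' : EndForm E' (1 + 0))
    (θ : EndForm E (1 + 0)) : Prop :=
  ∀ x a b, ∑ c, LinearMap.toMatrix' (S.map x) a c • θ' x c b =
    ∑ c, LinearMap.toMatrix' (S.map x) c b • θ x a c

end EndForms

end

end HiggsClasses

open HiggsClasses

/-! Everything rests on one computation. In a holomorphic frame a compatible connection is `d + A`
with `A` of type (1,0), so `A ∧ A` and the part `∂A` of `dA` have type (2,0), and the (1,1)-part of
the curvature is `∂̄A` (`Connection.curvature11_apply`). Applying `∂̄` to the gauge law kills its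
inhomogeneous term, because `∂̄ dg = 0` for holomorphic `g`; hence the forms `∂̄A` glue to an `End
E`-valued form, which is closed by `∂̄² = 0`. Two compatible connections differ by an `End E`-valued
(1,0)-form `η`, and their curvatures differ by `∂̄η`, so the class does not depend on the
connection. The Leibniz rule for `∂̄` and its compatibility with traces and holomorphic pullbacks
make all operations descend to cohomology. Compatible connections exist because they can be averaged
with a partition of unity.

Each of the three assertions then becomes an identity of forms for well chosen connections.

Naturality: the pullback of a compatible connection is compatible, and its curvature is the pulled
back curvature (`ahClass_pullback`).

Exact sequences: given connections on the two ends, the middle bundle has a compatible connection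
for which both maps are parallel (`exists_parallel`). Near a point it is written down with
holomorphic one-sided inverses of the two maps; being such a connection is an affine condition, so
the local solutions can be averaged. Parallel maps intertwine the curvatures, and Higgs
homomorphisms intertwine the Higgs fields. Hence at every point the endomorphism whose trace is
taken is block triangular, and its trace is the sum of the traces of the two blocks
(`ahClass_shortExact`). No global splitting is involved.

Tensor products: the curvature of `D' ⊗ 1 + 1 ⊗ D''` is `F' ⊗ 1 + 1 ⊗ F''`. Forms of even degree are
central, so the binomial theorem applies, and the trace of a Kronecker product is the product of the
traces. The factor `1 / k!` absorbs the binomial coefficients (`ahClass_tensor`).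

Two devices carry the bookkeeping. Forms of all degrees are embedded in one graded associative
algebra `FormAlg`, so that matrices of forms multiply as matrices over a ring and equalities between
degrees play no role. Matrices of 1-forms are evaluated at a tangent vector, so that gauge laws
become identities of complex matrices. Analytically, the key fact is that `∂̄` commutes with
pullback along holomorphic maps (`dbarV_pullback`): this makes the chartwise definition of `dbar`,
which uses a different chart at each point, coherent. -/

namespace HiggsClasses

noncomputable section

set_option linter.unusedSectionVars false

/-! ### Algebra of the wedge product -/

section WedgeAlgebra

open Equiv

variable {V : Type*} [NormedAddCommGroup V] [NormedSpace ℂ V]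

/-- The alternating sum of a function of `N` vectors over all permutations of its arguments. -/
def altSum {N : ℕ} (f : (Fin N → V) → ℂ) (v : Fin N → V) : ℂ :=
  ∑ σ : Perm (Fin N), ((Perm.sign σ : ℤ) : ℂ) * f (v ∘ σ)

theorem altSum_comp_perm {N : ℕ} (f : (Fin N → V) → ℂ) (τ : Perm (Fin N)) (v : Fin N → V) :
    altSum (fun w => f (w ∘ τ)) v = ((Perm.sign τ : ℤ) : ℂ) * altSum f v := by
  unfold altSum
  rw [Finset.mul_sum]
  refine Fintype.sum_equiv (Equiv.mulRight τ) _ _ fun σ => ?_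
  have h : ((Perm.sign τ : ℤ) : ℂ) * ((Perm.sign τ : ℤ) : ℂ) = 1 := by
    rw [← Int.cast_mul, ← Units.val_mul, Int.units_mul_self]; simp
  simp only [Equiv.coe_mulRight, Perm.sign_mul, Units.val_mul, Int.cast_mul, Perm.coe_mul,
    Function.comp_assoc]
  linear_combination (-(((Perm.sign σ : ℤ) : ℂ) * f (v ∘ σ ∘ τ))) * h

theorem altSum_const_mul {N : ℕ} (c : ℂ) (f : (Fin N → V) → ℂ) (v : Fin N → V) :
    altSum (fun w => c * f w) v = c * altSum f v := by
  unfold altSum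
  rw [Finset.mul_sum]
  exact Finset.sum_congr rfl fun σ _ => by ring

theorem altSum_sum {N : ℕ} {ι : Type*} (s : Finset ι) (f : ι → (Fin N → V) → ℂ) (v : Fin N → V) :
    altSum (fun w => ∑ i ∈ s, f i w) v = ∑ i ∈ s, altSum (f i) v := by
  unfold altSum
  rw [Finset.sum_comm]
  exact Finset.sum_congr rfl fun σ _ => Finset.mul_sum _ _ _

/-- After reindexing the outer sum by `e σ`, the sign of `e σ` cancels the sign of `σ`, so each of
the `m!` inner permutations contributes the same full alternating sum. This is the source of all
factorials in the wedge algebra. -/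
theorem altSum_nested {m N : ℕ} (e : Perm (Fin m) → Perm (Fin N))
    (he : ∀ σ, Perm.sign (e σ) = Perm.sign σ) (G : (Fin N → V) → ℂ) (v : Fin N → V) :
    altSum (fun w => ∑ σ : Perm (Fin m), ((Perm.sign σ : ℤ) : ℂ) * G (w ∘ e σ)) v =
      m.factorial * altSum G v := by
  rw [altSum_sum]
  have : ∀ σ : Perm (Fin m), altSum (fun w => ((Perm.sign σ : ℤ) : ℂ) * G (w ∘ e σ)) v =
      altSum G v := fun σ => by
    rw [altSum_const_mul, altSum_comp_perm, he, ← mul_assoc, ← Int.cast_mul, ← Units.val_mul,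
      Int.units_mul_self]
    simp
  simp [this, Fintype.card_perm]

theorem altSum_alt {N : ℕ} (a : Alt V N) (v : Fin N → V) :
    altSum (fun w => a w) v = N.factorial * a v := by
  unfold altSum
  have : ∀ σ : Perm (Fin N), ((Perm.sign σ : ℤ) : ℂ) * a (v ∘ σ) = a v := fun σ => by
    have h := a.toAlternatingMap.map_perm v σ
    change a (v ∘ σ) = _ at h
    rw [h]
    change _ * (Perm.sign σ • a v) = a v
    rcases Int.units_eq_one_or (Perm.sign σ) with h | h <;> simp [h]
  simp [this, Fintype.card_perm]

/-- The tensor product of two forms, as a function. -/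
def mulFun {m n N : ℕ} (h : m + n = N) (f : (Fin m → V) → ℂ) (g : (Fin n → V) → ℂ)
    (v : Fin N → V) : ℂ :=
  f (fun i => v (Fin.cast h (Fin.castAdd n i))) * g (fun i => v (Fin.cast h (Fin.natAdd m i)))

theorem wedge_apply {m n N : ℕ} (h : m + n = N) (a : Alt V m) (b : Alt V n) (v : Fin N → V) :
    wedge h a b v = ((m.factorial * n.factorial : ℕ) : ℂ)⁻¹ * altSum (mulFun h a b) v := by
  rw [wedge, ContinuousAlternatingMap.smul_apply, smul_eq_mul,
    ContinuousMultilinearMap.alternatization_apply_apply]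
  congr 1
  refine Finset.sum_congr rfl fun σ _ => ?_
  rw [Units.smul_def, zsmul_eq_mul]
  rfl

/-- A permutation of the first block extends by the identity on the second block with the same sign,
so the inner alternation is absorbed by the outer one. -/
theorem altSum_mulFun_altSum_left {m n N : ℕ} (h : m + n = N) (f : (Fin m → V) → ℂ)
    (g : (Fin n → V) → ℂ) (v : Fin N → V) :
    altSum (mulFun h (altSum f) g) v = m.factorial * altSum (mulFun h f g) v := by
  let E : Fin m ⊕ Fin n ≃ Fin N := finSumFinEquiv.trans (finCongr h)
  rw [← altSum_nested (fun σ => E.permCongr (Perm.sumCongr σ 1)) (fun σ => by simp)]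
  congr 1
  funext w
  simp only [mulFun, altSum, Finset.sum_mul]
  refine Finset.sum_congr rfl fun σ _ => ?_
  rw [mul_assoc]
  congr 3
  · funext i
    have : E.symm (Fin.cast h (Fin.castAdd n i)) = Sum.inl i := by
      rw [Equiv.symm_apply_eq]; rfl
    simp [Equiv.permCongr_apply, this]
    rfl
  · funext i
    have : E.symm (Fin.cast h (Fin.natAdd m i)) = Sum.inr i := by
      rw [Equiv.symm_apply_eq]; rfl
    simp [Equiv.permCongr_apply, this]
    rfl

theorem altSum_mulFun_altSum_right {m n N : ℕ} (h : m + n = N) (f : (Fin m → V) → ℂ)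
    (g : (Fin n → V) → ℂ) (v : Fin N → V) :
    altSum (mulFun h f (altSum g)) v = n.factorial * altSum (mulFun h f g) v := by
  let E : Fin m ⊕ Fin n ≃ Fin N := finSumFinEquiv.trans (finCongr h)
  rw [← altSum_nested (fun σ => E.permCongr (Perm.sumCongr 1 σ)) (fun σ => by simp)]
  congr 1
  funext w
  simp only [mulFun, altSum, Finset.mul_sum]
  refine Finset.sum_congr rfl fun σ _ => ?_
  rw [mul_left_comm]
  congr 3
  · funext i
    have : E.symm (Fin.cast h (Fin.castAdd n i)) = Sum.inl i := by
      rw [Equiv.symm_apply_eq]; rfl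
    simp [Equiv.permCongr_apply, this]
    rfl
  · funext i
    have : E.symm (Fin.cast h (Fin.natAdd m i)) = Sum.inr i := by
      rw [Equiv.symm_apply_eq]; rfl
    simp [Equiv.permCongr_apply, this]
    rfl

theorem mulFun_const_mul_left {m n N : ℕ} (h : m + n = N) (c : ℂ) (f : (Fin m → V) → ℂ)
    (g : (Fin n → V) → ℂ) :
    mulFun h (fun v => c * f v) g = fun v => c * mulFun h f g v := by
  funext v; simp [mulFun, mul_assoc]

theorem mulFun_const_mul_right {m n N : ℕ} (h : m + n = N) (c : ℂ) (f : (Fin m → V) → ℂ)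
    (g : (Fin n → V) → ℂ) :
    mulFun h f (fun v => c * g v) = fun v => c * mulFun h f g v := by
  funext v; simp [mulFun, mul_left_comm]

/-- Both sides are `1 / (m! n! p!)` times the alternation of `a ⊗ b ⊗ c`: the factorial of the
intermediate degree, produced by the nested alternation, cancels the one in the normalisation of the
outer product. -/
theorem wedge_assoc {m n p mn np N : ℕ} (h₁ : m + n = mn) (h₂ : mn + p = N) (h₃ : n + p = np)
    (h₄ : m + np = N) (a : Alt V m) (b : Alt V n) (c : Alt V p) :
    wedge h₂ (wedge h₁ a b) c = wedge h₄ a (wedge h₃ b c) := by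
  ext v
  have e₁ : (wedge h₁ a b : (Fin mn → V) → ℂ) =
      fun v => ((m.factorial * n.factorial : ℕ) : ℂ)⁻¹ * altSum (mulFun h₁ a b) v :=
    funext (wedge_apply h₁ a b)
  have e₂ : (wedge h₃ b c : (Fin np → V) → ℂ) =
      fun v => ((n.factorial * p.factorial : ℕ) : ℂ)⁻¹ * altSum (mulFun h₃ b c) v :=
    funext (wedge_apply h₃ b c)
  rw [wedge_apply, wedge_apply, e₁, e₂, mulFun_const_mul_left, mulFun_const_mul_right,
    altSum_const_mul, altSum_const_mul, altSum_mulFun_altSum_left, altSum_mulFun_altSum_right]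
  have : mulFun h₂ (mulFun h₁ (a : (Fin m → V) → ℂ) b) c = mulFun h₄ a (mulFun h₃ b c) := by
    subst h₁ h₃ h₂
    funext w
    simp only [mulFun, mul_assoc]
    congr 1
    congr 1
    congr 1
    funext i
    congr 1
    ext
    simp [add_assoc]
  rw [this]
  have f1 := Nat.factorial_ne_zero m
  have f2 := Nat.factorial_ne_zero n
  have f3 := Nat.factorial_ne_zero p
  have f4 := Nat.factorial_ne_zero mn
  have f5 := Nat.factorial_ne_zero np
  push_cast
  field_simp

theorem finRotate_pow_val {N : ℕ} (k : ℕ) (i : Fin N) :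
    ((finRotate N ^ k) i : ℕ) = (i + k) % N := by
  cases N with
  | zero => exact i.elim0
  | succ N =>
    induction k with
    | zero => simp [Nat.mod_eq_of_lt i.2]
    | succ k ih =>
      rw [pow_succ', Perm.mul_apply, finRotate_apply, Fin.val_add, ih]
      simp [← add_assoc]

/-- Exchanging the two blocks of arguments is the `n`-th power of the cyclic rotation, whose sign is
`(-1) ^ ((N - 1) * n)`. -/
theorem wedge_comm {m n N : ℕ} (h : m + n = N) (h' : n + m = N) (a : Alt V m) (b : Alt V n) :
    wedge h' b a = (-1 : ℂ) ^ (m * n) • wedge h a b := by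
  ext v
  rw [ContinuousAlternatingMap.smul_apply, wedge_apply, wedge_apply]
  have key : mulFun h' (b : (Fin n → V) → ℂ) a =
      fun w => mulFun h (a : (Fin m → V) → ℂ) b (w ∘ (finRotate N ^ n : Perm (Fin N))) := by
    funext w
    simp only [mulFun]
    rw [mul_comm]
    congr 2
    · funext i
      simp only [Function.comp]
      congr 1
      ext
      rw [finRotate_pow_val, Nat.mod_eq_of_lt] <;> simp <;> omega
    · funext i
      simp only [Function.comp]
      congr 1
      ext
      rw [finRotate_pow_val]
      have : m + (i : ℕ) + n = i + N := by omega
      simp only [Fin.val_cast, Fin.val_castAdd, Fin.val_natAdd, this, Nat.add_mod_right]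
      rw [Nat.mod_eq_of_lt]; omega
  rw [key, altSum_comp_perm, map_pow, sign_finRotate, ← pow_mul]
  -- The exponents differ by the even number `(n - 1) * n`. The case `n = 0` is separate because the
  -- subtractions are truncated.
  have : ((-1 : ℂ)) ^ ((N - 1) * n) = (-1) ^ (m * n) := by
    rcases Nat.eq_zero_or_pos n with rfl | hn
    · simp
    · have : (N - 1) * n = m * n + (n - 1) * n := by
        rw [← add_mul]; congr 1; omega
      rw [this, pow_add]
      have : Even ((n - 1) * n) := by
        obtain ⟨k, rfl⟩ : ∃ k, n = k + 1 := ⟨n - 1, by omega⟩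
        simpa using Nat.even_mul_succ_self k
      rw [this.neg_one_pow, mul_one]
  push_cast
  rw [this, smul_eq_mul, mul_comm (n.factorial : ℂ)]
  ring

section Linear

variable {m n N : ℕ} (h : m + n = N)

theorem wedge_add_left (a a' : Alt V m) (b : Alt V n) :
    wedge h (a + a') b = wedge h a b + wedge h a' b := by
  ext v
  simp only [ContinuousAlternatingMap.add_apply, wedge_apply, altSum, mulFun, ← mul_add,
    ← Finset.sum_add_distrib, ← add_mul]

theorem wedge_add_right (a : Alt V m) (b b' : Alt V n) :
    wedge h a (b + b') = wedge h a b + wedge h a b' := by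
  ext v
  simp only [ContinuousAlternatingMap.add_apply, wedge_apply, altSum, mulFun, ← mul_add,
    ← Finset.sum_add_distrib]

theorem wedge_smul_left (c : ℂ) (a : Alt V m) (b : Alt V n) :
    wedge h (c • a) b = c • wedge h a b := by
  ext v
  have : mulFun h ((c • a : Alt V m) : (Fin m → V) → ℂ) b = fun v => c * mulFun h a b v :=
    mulFun_const_mul_left h c a b
  rw [ContinuousAlternatingMap.smul_apply, wedge_apply, wedge_apply, this, altSum_const_mul,
    smul_eq_mul, mul_left_comm]

theorem wedge_smul_right (c : ℂ) (a : Alt V m) (b : Alt V n) :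
    wedge h a (c • b) = c • wedge h a b := by
  ext v
  have : mulFun h a ((c • b : Alt V n) : (Fin n → V) → ℂ) = fun v => c * mulFun h a b v :=
    mulFun_const_mul_right h c a b
  rw [ContinuousAlternatingMap.smul_apply, wedge_apply, wedge_apply, this, altSum_const_mul,
    smul_eq_mul, mul_left_comm]

theorem wedge_zero_left (b : Alt V n) : wedge h (0 : Alt V m) b = 0 := by
  simpa using wedge_smul_left h 0 0 b

theorem wedge_zero_right (a : Alt V m) : wedge h a (0 : Alt V n) = 0 := by
  simpa using wedge_smul_right h 0 a 0

theorem wedge_comp {W : Type*} [NormedAddCommGroup W] [NormedSpace ℂ W] (L : W →L[ℝ] V)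
    (a : Alt V m) (b : Alt V n) :
    (wedge h a b).compContinuousLinearMap L =
      wedge h (a.compContinuousLinearMap L) (b.compContinuousLinearMap L) := by
  ext v
  rw [ContinuousAlternatingMap.compContinuousLinearMap_apply, wedge_apply, wedge_apply]
  rfl

theorem IsType.wedge {p q p' q' : ℕ} {a : Alt V m} {b : Alt V n} (ha : IsType p q a)
    (hb : IsType p' q' b) : IsType (p + p') (q + q') (wedge h a b) := fun c v => by
  rw [wedge_apply, wedge_apply, mul_left_comm]
  congr 1
  rw [← altSum_const_mul]
  refine Finset.sum_congr rfl fun σ _ => ?_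
  congr 1
  simp only [mulFun, Function.comp]
  rw [ha c, hb c]
  ring

end Linear

theorem IsType.comp {W : Type*} [NormedAddCommGroup W] [NormedSpace ℂ W] {N p q : ℕ}
    {a : Alt V N} (ha : IsType p q a) (L : W →L[ℂ] V) :
    IsType p q (a.compContinuousLinearMap (L.restrictScalars ℝ)) := fun c v => by
  have : (fun i => L (c • v i)) = fun i => c • L (v i) := by simp
  change a (fun i => L (c • v i)) = _ * a (fun i => L (v i))
  rw [this, ha]

theorem wedge_const_left {n : ℕ} (h : 0 + n = n) (c : ℂ) (b : Alt V n) :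
    wedge h (ContinuousAlternatingMap.constOfIsEmpty ℝ V (Fin 0) c) b = c • b := by
  ext v
  rw [wedge_apply]
  have : mulFun h (ContinuousAlternatingMap.constOfIsEmpty ℝ V (Fin 0) c :
      (Fin 0 → V) → ℂ) (b : (Fin n → V) → ℂ) = fun v => c * b v := by
    funext v
    simp only [mulFun, ContinuousAlternatingMap.constOfIsEmpty_apply]
    congr 2
    funext i; congr 1; ext; simp
  rw [this, altSum_const_mul, altSum_alt]
  have f1 := Nat.factorial_ne_zero n
  simp only [ContinuousAlternatingMap.smul_apply, smul_eq_mul]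
  push_cast
  field_simp
  simp

theorem wedge_const_right {n : ℕ} (h : n + 0 = n) (c : ℂ) (b : Alt V n) :
    wedge h b (ContinuousAlternatingMap.constOfIsEmpty ℝ V (Fin 0) c) = c • b := by
  rw [wedge_comm (by omega : 0 + n = n) h, wedge_const_left]
  simp

-- The operator `alternatizeUncurryFin` sums only over the slot that receives the direction of
-- differentiation. Its full alternation is `(n + 1)!` times itself, and also `n + 1` copies of the
-- left-hand side, one for each cycle moving a slot to the front; cancelling `n + 1` leaves `n!`.
open ContinuousAlternatingMap in
theorem altSum_uncurry {n : ℕ} (L : V →L[ℝ] Alt V n) (v : Fin (n + 1) → V) :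
    altSum (fun w : Fin (n + 1) → V => L (w 0) (Fin.tail w)) v =
      n.factorial * alternatizeUncurryFin L v := by
  have h₁ := altSum_alt (alternatizeUncurryFin L) v
  have h₂ : ∀ w : Fin (n + 1) → V, alternatizeUncurryFin L w = ∑ p : Fin (n + 1),
      (-1 : ℂ) ^ (p : ℕ) * (fun w : Fin (n + 1) → V => L (w 0) (Fin.tail w))
        (w ∘ (Fin.cycleRange p).symm) := fun w => by
    rw [alternatizeUncurryFin_apply]
    refine Finset.sum_congr rfl fun p _ => ?_
    have e : Fin.tail (w ∘ (Fin.cycleRange p).symm) = p.removeNth w := by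
      funext j
      simp [Fin.tail, Fin.removeNth, Fin.cycleRange_symm_succ]
    simp only [e, Function.comp, Fin.cycleRange_symm_zero]
    simp
  simp only [h₂] at h₁
  rw [altSum_sum] at h₁
  have h₃ : ∀ p : Fin (n + 1), altSum (fun w : Fin (n + 1) → V => (-1 : ℂ) ^ (p : ℕ) *
      (fun w : Fin (n + 1) → V => L (w 0) (Fin.tail w)) (w ∘ (Fin.cycleRange p).symm)) v =
      altSum (fun w : Fin (n + 1) → V => L (w 0) (Fin.tail w)) v := fun p => by
    rw [altSum_const_mul, altSum_comp_perm (fun w : Fin (n + 1) → V => L (w 0) (Fin.tail w))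
      (Fin.cycleRange p).symm, ← Perm.inv_def, Perm.sign_inv, Fin.sign_cycleRange, ← mul_assoc]
    push_cast
    rw [← mul_pow]
    simp
  rw [Finset.sum_congr rfl fun p _ => h₃ p, ← h₂] at h₁
  have f1 : ((n : ℂ) + 1) ≠ 0 := by exact_mod_cast Nat.succ_ne_zero n
  simp only [Finset.sum_const, Finset.card_univ, Fintype.card_fin, nsmul_eq_mul,
    Nat.factorial_succ] at h₁
  push_cast at h₁
  exact mul_left_cancel₀ f1 (by rw [h₁]; ring)

/-- The permutations of the tail are those fixing the index `0`, and they keep their sign in the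
larger group. -/
theorem altSum_tail_altSum {n : ℕ} (f : V → (Fin n → V) → ℂ) (v : Fin (n + 1) → V) :
    altSum (fun w : Fin (n + 1) → V => altSum (f (w 0)) (Fin.tail w)) v =
      n.factorial * altSum (fun w : Fin (n + 1) → V => f (w 0) (Fin.tail w)) v := by
  rw [← altSum_nested (fun σ => Perm.decomposeFin.symm (0, σ)) (fun σ => by simp)]
  rfl

-- The algebraic half of the Leibniz rule, with the derivative falling on the left factor: up to
-- factorials both sides are the alternation of `L (w 0) ⊗ b`, with `w 0` as first argument.
open ContinuousAlternatingMap in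
theorem alternatizeUncurryFin_wedge_left {m n N : ℕ} (h : m + n = N) (h' : m + 1 + n = N + 1)
    (L : V →L[ℝ] Alt V m) (b : Alt V n) (M : V →L[ℝ] Alt V N) (hM : ∀ v, M v = wedge h (L v) b) :
    alternatizeUncurryFin M = wedge h' (alternatizeUncurryFin L) b := by
  ext v
  have f0 : (N.factorial : ℂ) ≠ 0 := by exact_mod_cast Nat.factorial_ne_zero N
  have f1 : (m.factorial : ℂ) ≠ 0 := by exact_mod_cast Nat.factorial_ne_zero m
  have f2 : (n.factorial : ℂ) ≠ 0 := by exact_mod_cast Nat.factorial_ne_zero n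
  have f3 : ((m : ℂ) + 1) ≠ 0 := by exact_mod_cast Nat.succ_ne_zero m
  apply mul_left_cancel₀ f0
  rw [← altSum_uncurry]
  simp only [hM, wedge_apply]
  rw [altSum_const_mul, altSum_tail_altSum (fun u => mulFun h (L u) b)]
  have e : (alternatizeUncurryFin L : (Fin (m + 1) → V) → ℂ) = fun v =>
      (m.factorial : ℂ)⁻¹ * altSum (fun w : Fin (m + 1) → V => L (w 0) (Fin.tail w)) v := by
    funext w
    rw [altSum_uncurry]; field_simp
  rw [e, mulFun_const_mul_left, altSum_const_mul, altSum_mulFun_altSum_left]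
  have e' : (mulFun h' (fun w : Fin (m + 1) → V => L (w 0) (Fin.tail w)) b) =
      fun w : Fin (N + 1) → V => mulFun h (L (w 0)) b (Fin.tail w) := by
    funext w
    simp only [mulFun, Fin.tail]
    congr 2
    funext i
    congr 1
    ext
    simp; omega
  rw [e']
  simp only [Nat.factorial_succ]
  push_cast
  field_simp

-- Deduced from the left version by graded commutativity before and after. The signs `(-1) ^ (m *
-- n)` and `(-1) ^ (m * (n + 1))` combine to `(-1) ^ m`.
open ContinuousAlternatingMap in
theorem alternatizeUncurryFin_wedge_right {m n N : ℕ} (h : m + n = N) (h' : m + (n + 1) = N + 1)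
    (L : V →L[ℝ] Alt V n) (a : Alt V m) (M : V →L[ℝ] Alt V N) (hM : ∀ v, M v = wedge h a (L v)) :
    alternatizeUncurryFin M = (-1 : ℂ) ^ m • wedge h' a (alternatizeUncurryFin L) := by
  have h₁ : n + m = N := by omega
  have h₂ : n + 1 + m = N + 1 := by omega
  have hM' : ∀ v, ((-1 : ℂ) ^ (m * n) • M) v = wedge h₁ (L v) a := fun v => by
    rw [wedge_comm h h₁, _root_.smul_apply, hM]
  have := alternatizeUncurryFin_wedge_left h₁ h₂ L a _ hM'
  rw [alternatizeUncurryFin_smul, wedge_comm h' h₂] at this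
  have s : (-1 : ℂ) ^ (m * n) * (-1 : ℂ) ^ (m * n) = 1 := by rw [← mul_pow]; simp
  have := congrArg (fun x => (-1 : ℂ) ^ (m * n) • x) this
  simp only [smul_smul, s, one_smul] at this
  rw [this]
  congr 1
  rw [mul_add, pow_add, ← mul_assoc, s]; simp

end WedgeAlgebra

/-! ### The algebra of forms -/

section FormAlgebra

variable (V : Type*) [NormedAddCommGroup V] [NormedSpace ℂ V]

/-- The algebra of complex-valued alternating forms on `V`. -/
abbrev FormAlg : Type _ := DirectSum ℕ fun k => Alt V k

variable {V}

/-- Associativity and unit laws of the wedge product hold only after identifying degrees such as `0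
+ n` and `n`. In the graded monoid these identifications become plain equalities. -/
theorem gradedMk_wedge {m n N : ℕ} (h : m + n = N) (a : Alt V m) (b : Alt V n) :
    GradedMonoid.mk (A := fun k => Alt V k) N (wedge h a b) =
      GradedMonoid.mk (m + n) (wedge rfl a b) := by
  subst h; rfl

instance : GradedMonoid.GOne (fun k => Alt V k) :=
  ⟨ContinuousAlternatingMap.constOfIsEmpty ℝ V (Fin 0) 1⟩

instance : GradedMonoid.GMul (fun k => Alt V k) := ⟨fun a b => wedge rfl a b⟩

/-- With this ring structure, matrices of forms of different degrees can be multiplied, raised to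
powers and conjugated with the usual matrix lemmas. -/
instance : DirectSum.GRing (fun k => Alt V k) where
  one_mul a := (gradedMk_wedge (zero_add a.1) _ _).symm.trans
    (congrArg (GradedMonoid.mk a.1) ((wedge_const_left _ 1 a.2).trans (one_smul _ _)))
  mul_one a := (gradedMk_wedge (add_zero a.1) _ _).symm.trans
    (congrArg (GradedMonoid.mk a.1) ((wedge_const_right _ 1 a.2).trans (one_smul _ _)))
  mul_assoc a b c := by
    refine Eq.trans (b := GradedMonoid.mk _ (wedge rfl (wedge rfl a.2 b.2) c.2)) rfl ?_
    rw [wedge_assoc (h₄ := (add_assoc a.1 b.1 c.1).symm) (h₃ := rfl)]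
    exact gradedMk_wedge _ _ _
  mul_zero a := wedge_zero_right rfl a
  zero_mul b := wedge_zero_left rfl b
  mul_add a b c := wedge_add_right rfl a b c
  add_mul a b c := wedge_add_left rfl a b c
  natCast n := ContinuousAlternatingMap.constOfIsEmpty ℝ V (Fin 0) n
  natCast_zero := by ext; simp
  natCast_succ n := by ext; simp; rfl
  intCast n := ContinuousAlternatingMap.constOfIsEmpty ℝ V (Fin 0) n
  intCast_ofNat n := by ext; simp
  intCast_negSucc_ofNat n := by ext; simp

instance : DirectSum.GAlgebra ℂ (fun k => Alt V k) where
  toFun := ⟨⟨fun c => ContinuousAlternatingMap.constOfIsEmpty ℝ V (Fin 0) c, rfl⟩,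
    fun a b => rfl⟩
  map_one := rfl
  map_mul r s := by
    refine Eq.trans ?_ (gradedMk_wedge (zero_add 0) _ _)
    exact congrArg (GradedMonoid.mk 0) ((wedge_const_left _ r (ContinuousAlternatingMap.constOfIsEmpty ℝ V (Fin 0) s)).trans rfl).symm
  commutes r x := by
    refine (gradedMk_wedge (zero_add x.1) _ _).symm.trans
      (Eq.trans ?_ (gradedMk_wedge (add_zero x.1) _ _))
    congr 1
    exact (wedge_const_left _ _ _).trans (wedge_const_right _ _ _).symm
  smul_def r x := by
    refine Eq.trans ?_ (gradedMk_wedge (zero_add x.1) _ _)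
    refine congrArg (GradedMonoid.mk x.1) ?_
    exact (wedge_const_left _ _ _).symm

/-- The inclusion of the forms of degree `k` into the algebra of forms. -/
def toAlg (k : ℕ) : Alt V k →ₗ[ℂ] FormAlg V := DirectSum.lof ℂ ℕ (fun k => Alt V k) k

theorem toAlg_injective (k : ℕ) : Function.Injective (toAlg (V := V) k) :=
  DirectSum.of_injective k

theorem toAlg_wedge {m n N : ℕ} (h : m + n = N) (a : Alt V m) (b : Alt V n) :
    toAlg N (wedge h a b) = toAlg m a * toAlg n b := by
  subst h
  exact (DirectSum.of_mul_of a b).symm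

theorem toAlg_one :
    toAlg 0 (ContinuousAlternatingMap.constOfIsEmpty ℝ V (Fin 0) (1 : ℂ)) = 1 := rfl

theorem toAlg_commute {m n : ℕ} (a : Alt V m) (b : Alt V n) (hm : Even m) :
    Commute (toAlg m a) (toAlg n b) := by
  rw [Commute, SemiconjBy, ← toAlg_wedge rfl, ← toAlg_wedge (add_comm n m),
    wedge_comm rfl, (hm.mul_right n).neg_one_pow, one_smul]

theorem toAlg_anticomm (a b : Alt V 1) : toAlg 1 a * toAlg 1 b = -(toAlg 1 b * toAlg 1 a) := by
  rw [← toAlg_wedge rfl, ← toAlg_wedge rfl, wedge_comm rfl]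
  simp

end FormAlgebra

/-! ### The operator `∂̄` on forms on open subsets of a vector space -/

section Flat

open ContinuousAlternatingMap Filter Topology

variable {V : Type*} [NormedAddCommGroup V] [NormedSpace ℂ V]
  {E : Type*} [NormedAddCommGroup E] [NormedSpace ℝ E]

theorem two_le_infty : (2 : WithTop ℕ∞) ≤ ∞ :=
  WithTop.coe_le_coe.2 (le_top : (2 : ℕ∞) ≤ ⊤)

theorem contDiffAt_clm_comp {F G : Type*} [NormedAddCommGroup F] [NormedSpace ℝ F]
    [NormedAddCommGroup G] [NormedSpace ℝ G] {r : WithTop ℕ∞} (A : F →L[ℝ] G) {f : E → F} {x : E}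
    (hf : ContDiffAt ℝ r f x) : ContDiffAt ℝ r (fun y => A (f y)) x :=
  A.contDiff.contDiffAt.comp x hf

theorem hasFDerivAt_clm_comp {F G : Type*} [NormedAddCommGroup F] [NormedSpace ℝ F]
    [NormedAddCommGroup G] [NormedSpace ℝ G] (A : F →L[ℝ] G) {f : E → F} {f' : E →L[ℝ] F} {x : E}
    (hf : HasFDerivAt f f' x) : HasFDerivAt (fun y => A (f y)) (A.comp f') x :=
  A.hasFDerivAt.comp x hf

/-- Needed to make the wedge product automatically continuous, and hence smooth, as a bilinear map.
-/
instance [FiniteDimensional ℂ V] (k : ℕ) : FiniteDimensional ℝ (Alt V k) := by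
  let f : Alt V k →ₗ[ℝ] MultilinearMap ℝ (fun _ : Fin k => V) ℂ :=
    { toFun := fun a => a.toMultilinearMap
      map_add' := fun _ _ => rfl
      map_smul' := fun _ _ => rfl }
  exact FiniteDimensional.of_injective f fun a b h => by
    ext v
    exact congrArg (fun m : MultilinearMap ℝ (fun _ : Fin k => V) ℂ => m v) h

theorem wedge_real_smul_left {m n N : ℕ} (h : m + n = N) (c : ℝ) (a : Alt V m) (b : Alt V n) :
    wedge h (c • a) b = c • wedge h a b := by
  simpa only [Complex.coe_smul] using wedge_smul_left h (c : ℂ) a b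

theorem wedge_real_smul_right {m n N : ℕ} (h : m + n = N) (c : ℝ) (a : Alt V m) (b : Alt V n) :
    wedge h a (c • b) = c • wedge h a b := by
  simpa only [Complex.coe_smul] using wedge_smul_right h (c : ℂ) a b

/-- The wedge product as a continuous bilinear map. -/
def wedgeL [FiniteDimensional ℂ V] {m n N : ℕ} (h : m + n = N) :
    Alt V m →L[ℝ] Alt V n →L[ℝ] Alt V N :=
  LinearMap.toContinuousLinearMap
    ((LinearMap.toContinuousLinearMap : (Alt V n →ₗ[ℝ] Alt V N) ≃ₗ[ℝ] _).toLinearMap ∘ₗ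
      LinearMap.mk₂ ℝ (wedge h) (wedge_add_left h) (wedge_real_smul_left h) (wedge_add_right h)
        (wedge_real_smul_right h))

@[simp]
theorem wedgeL_apply [FiniteDimensional ℂ V] {m n N : ℕ} (h : m + n = N) (a : Alt V m)
    (b : Alt V n) : wedgeL h a b = wedge h a b := rfl

theorem contDiffAt_wedge [FiniteDimensional ℂ V] {m n N : ℕ} (h : m + n = N) {r : WithTop ℕ∞}
    {f : E → Alt V m} {g : E → Alt V n} {x : E} (hf : ContDiffAt ℝ r f x)
    (hg : ContDiffAt ℝ r g x) : ContDiffAt ℝ r (fun y => wedge h (f y) (g y)) x :=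
  (contDiffAt_clm_comp (wedgeL h) hf).clm_apply hg

theorem fderiv_wedge [FiniteDimensional ℂ V] {m n N : ℕ} (h : m + n = N)
    {f : E → Alt V m} {g : E → Alt V n} {x : E} (hf : DifferentiableAt ℝ f x)
    (hg : DifferentiableAt ℝ g x) (v : E) :
    fderiv ℝ (fun y => wedge h (f y) (g y)) x v =
      wedge h (fderiv ℝ f x v) (g x) + wedge h (f x) (fderiv ℝ g x v) := by
  have := ((wedgeL h).hasFDerivAt_of_bilinear hf.hasFDerivAt hg.hasFDerivAt).fderiv
  change fderiv ℝ (fun y => wedgeL h (f y) (g y)) x v = _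
  rw [this]
  simp [ContinuousLinearMap.precompR, ContinuousLinearMap.precompL, add_comm]

theorem antilinPart_apply {k : ℕ} (L : V →L[ℝ] Alt V k) (v : V) :
    antilinPart L v = (1 / 2 : ℂ) • (L v + Complex.I • L (Complex.I • v)) := rfl

/-- The operator `∂̄` on forms on a vector space. -/
def dbarV {k : ℕ} (ψ : V → Alt V k) (y : V) : Alt V (k + 1) :=
  alternatizeUncurryFin (antilinPart (fderiv ℝ ψ y))

theorem dbarV_congr {k : ℕ} {ψ η : V → Alt V k} {y : V} (h : ψ =ᶠ[𝓝 y] η) :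
    dbarV ψ y = dbarV η y := by
  rw [dbarV, dbarV, h.fderiv_eq]

/-- The derivative of the product is a sum of two terms, and taking conjugate-linear parts respects
this splitting because the wedge product is complex bilinear. The sign arises from moving the new
slot past the `m` slots of `f`. -/
theorem dbarV_wedge [FiniteDimensional ℂ V] {m n N : ℕ} (h : m + n = N) (h₁ : m + 1 + n = N + 1)
    (h₂ : m + (n + 1) = N + 1) {f : V → Alt V m} {g : V → Alt V n} {x : V}
    (hf : DifferentiableAt ℝ f x) (hg : DifferentiableAt ℝ g x) :
    dbarV (fun y => wedge h (f y) (g y)) x =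
      wedge h₁ (dbarV f x) (g x) + (-1 : ℂ) ^ m • wedge h₂ (f x) (dbarV g x) := by
  let M₁ : V →L[ℝ] Alt V N := ((wedgeL h).flip (g x)).comp (antilinPart (fderiv ℝ f x))
  let M₂ : V →L[ℝ] Alt V N := ((wedgeL h) (f x)).comp (antilinPart (fderiv ℝ g x))
  rw [dbarV, dbarV, dbarV, ← alternatizeUncurryFin_wedge_left h h₁ _ _ M₁ fun _ => rfl,
    ← alternatizeUncurryFin_wedge_right h h₂ _ _ M₂ fun _ => rfl, ← alternatizeUncurryFin_add]
  congr 1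
  ext1 v
  change _ = wedge h (antilinPart (fderiv ℝ f x) v) (g x) +
    wedge h (f x) (antilinPart (fderiv ℝ g x) v)
  simp only [antilinPart_apply]
  rw [fderiv_wedge h hf hg, fderiv_wedge h hf hg, wedge_smul_left, wedge_smul_right,
    wedge_add_left, wedge_add_right, wedge_smul_left, wedge_smul_right, ← smul_add]
  congr 1
  rw [smul_add]
  abel

/-- The derivative of `g` is complex linear, so its conjugate-linear part vanishes and no term `∂̄g
∧ ψ` appears. -/
theorem dbarV_smul {k : ℕ} {g : V → ℂ} {ψ : V → Alt V k} {x : V} (hg : DifferentiableAt ℂ g x)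
    (hψ : DifferentiableAt ℝ ψ x) : dbarV (fun y => g y • ψ y) x = g x • dbarV ψ x := by
  rw [dbarV, dbarV, ← alternatizeUncurryFin_smul]
  congr 1
  ext1 v
  have hg' : fderiv ℝ g x = (fderiv ℂ g x).restrictScalars ℝ := hg.fderiv_restrictScalars ℝ
  have := (hg.restrictScalars ℝ).hasFDerivAt.smul hψ.hasFDerivAt
  have e : ∀ v, fderiv ℝ (fun y => g y • ψ y) x v =
      g x • fderiv ℝ ψ x v + (fderiv ℂ g x v) • ψ x := fun v => by
    have e := this.fderiv
    change fderiv ℝ (fun y => g y • ψ y) x = _ at e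
    rw [e, hg']; rfl
  rw [_root_.smul_apply, antilinPart_apply, antilinPart_apply, e, e]
  ext w
  simp only [ContinuousAlternatingMap.smul_apply, ContinuousAlternatingMap.add_apply, map_smul,
    smul_eq_mul]
  linear_combination (1 / 2 * (fderiv ℂ g x v) * ψ x w) * Complex.I_mul_I

theorem contDiffAt_complex_smul {k : ℕ} {r : WithTop ℕ∞} {g : E → ℂ} {ψ : E → Alt V k} {x : E}
    (hg : ContDiffAt ℝ r g x) (hψ : ContDiffAt ℝ r ψ x) :
    ContDiffAt ℝ r (fun y => g y • ψ y) x := hg.smul hψ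

/-- Taking the conjugate-linear part, as a continuous linear map. -/
def antilinPartL (k : ℕ) : (V →L[ℝ] Alt V k) →L[ℝ] (V →L[ℝ] Alt V k) :=
  (1 / 2 : ℂ) • (ContinuousLinearMap.id ℝ _ +
    Complex.I • (ContinuousLinearMap.compL ℝ V V (Alt V k)).flip mulI)

/-- The linear map that takes the derivative of a form to its image under `∂̄`. -/
def dbarL (k : ℕ) : (V →L[ℝ] Alt V k) →L[ℝ] Alt V (k + 1) :=
  (alternatizeUncurryFinCLM ℝ V ℂ).comp (antilinPartL k)

theorem dbarV_eq {k : ℕ} (ψ : V → Alt V k) : dbarV ψ = fun y => dbarL k (fderiv ℝ ψ y) := rfl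

theorem contDiffAt_dbarV {k : ℕ} {ψ : V → Alt V k} {x : V} (hψ : ContDiffAt ℝ ∞ ψ x) :
    ContDiffAt ℝ ∞ (dbarV ψ) x :=
  dbarV_eq ψ ▸ contDiffAt_clm_comp (dbarL k) (hψ.fderiv_right (m := ∞) (by simp))

/-- Up to alternation, `∂̄∂̄ψ` is the second derivative `B` of `ψ` with the conjugate-linear part
taken in both directions. This bilinear map `C` inherits the symmetry of `B`, and alternating a
symmetric map twice gives zero. -/
theorem dbarV_dbarV {k : ℕ} {ψ : V → Alt V k} {x : V} (hψ : ContDiffAt ℝ ∞ ψ x) :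
    dbarV (dbarV ψ) x = 0 := by
  have hd : DifferentiableAt ℝ (fderiv ℝ ψ) x :=
    (hψ.fderiv_right (m := ∞) (by simp)).differentiableAt (by simp)
  let B : V →L[ℝ] V →L[ℝ] Alt V k := fderiv ℝ (fderiv ℝ ψ) x
  have hB : ∀ v w, B v w = B w v := fun v w =>
    (hψ.isSymmSndFDerivAt (by simpa using two_le_infty)) v w
  have e : fderiv ℝ (dbarV ψ) x = (dbarL k).comp B := by
    rw [dbarV_eq]
    have h := hasFDerivAt_clm_comp (F := V →L[ℝ] Alt V k) (dbarL (V := V) k) hd.hasFDerivAt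
    exact h.fderiv
  let C : V →L[ℝ] V →L[ℝ] Alt V k := (1 / 2 : ℂ) • ((antilinPartL k).comp B +
    Complex.I • ((antilinPartL k).comp (B.comp mulI)))
  have hC : antilinPart (fderiv ℝ (dbarV ψ) x) = (alternatizeUncurryFinCLM ℝ V ℂ).comp C := by
    rw [e]
    ext1 v
    have hs : ∀ (c : ℂ) (L : V →L[ℝ] Alt V k),
        alternatizeUncurryFinCLM ℝ V ℂ (c • L) = c • alternatizeUncurryFinCLM ℝ V ℂ L :=
      fun c L => alternatizeUncurryFin_smul c L
    simp only [antilinPart_apply, C, ContinuousLinearMap.comp_apply, _root_.smul_apply,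
      _root_.add_apply, hs, map_add]
    rfl
  rw [dbarV, hC]
  refine alternatizeUncurryFin_alternatizeUncurryFinCLM_comp_of_symmetric fun v w => ?_
  have hCa : ∀ v w, C v w = (1 / 2 : ℂ) • ((1 / 2 : ℂ) • (B v w + Complex.I • B v (Complex.I • w)) +
      Complex.I • (1 / 2 : ℂ) • (B (Complex.I • v) w +
        Complex.I • B (Complex.I • v) (Complex.I • w))) := fun _ _ => rfl
  rw [hCa, hCa, hB v, hB v, hB _ w, hB _ (Complex.I • w)]
  simp only [smul_add, smul_comm Complex.I (1 / 2 : ℂ)]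
  abel

variable {U : Type*} [NormedAddCommGroup U] [NormedSpace ℂ U]

/-- Currying off one argument at a time reduces the claim to smoothness of the evaluation of a
linear map. Pullbacks need it because the form and the vectors `dF(v i)` both vary with the point.
-/
theorem contDiffAt_apply_vectors {k : ℕ} {r : WithTop ℕ∞} {a : E → Alt V k} {u : Fin k → E → V}
    {x : E} (ha : ContDiffAt ℝ r a x) (hu : ∀ i, ContDiffAt ℝ r (u i) x) :
    ContDiffAt ℝ r (fun y => a y fun i => u i y) x := by
  induction k with
  | zero =>
    exact ((ContinuousAlternatingMap.apply ℝ V ℂ (0 : Fin 0 → V)).contDiff.contDiffAt.comp x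
      ha).congr_of_eventuallyEq
        (Eventually.of_forall fun y => congrArg (a y) (Subsingleton.elim _ _))
  | succ k ih =>
    have hc : ContDiffAt ℝ r (fun y => (a y).curryLeft (u 0 y)) x :=
      (contDiffAt_clm_comp
        (curryLeftLI (𝕜 := ℝ) (E := V) (F := ℂ) (n := k)).toContinuousLinearMap ha).clm_apply (hu 0)
    refine (ih hc fun i => hu i.succ).congr_of_eventuallyEq (Eventually.of_forall fun y => ?_)
    change a y _ = a y (Matrix.vecCons (u 0 y) fun i : Fin k => u i.succ y)
    congr 1
    funext i
    refine Fin.cases ?_ (fun i => ?_) i <;> simp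

/-- Evaluation on tuples of basis vectors embeds the forms linearly in a finite-dimensional function
space, and a linear left inverse recovers `f` from its coefficients. -/
theorem contDiffAt_alt_iff [FiniteDimensional ℂ V] {k : ℕ} {r : WithTop ℕ∞} {f : E → Alt V k}
    {x : E} : ContDiffAt ℝ r f x ↔ ∀ v, ContDiffAt ℝ r (fun y => f y v) x := by
  refine ⟨fun h v => (ContinuousAlternatingMap.apply ℝ V ℂ v).contDiff.contDiffAt.comp x h,
    fun h => ?_⟩
  let b := Module.finBasis ℝ V
  let Φ : Alt V k →ₗ[ℝ] ((Fin k → Fin (Module.finrank ℝ V)) → ℂ) :=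
    { toFun := fun a s => a fun i => b (s i)
      map_add' := fun _ _ => rfl
      map_smul' := fun _ _ => rfl }
  have hΦ : LinearMap.ker Φ = ⊥ := LinearMap.ker_eq_bot'.2 fun a ha => by
    have : a.toMultilinearMap = 0 := Module.Basis.ext_multilinear (fun _ => b) fun s => congrFun ha s
    ext v
    exact congrArg (fun m : MultilinearMap ℝ (fun _ : Fin k => V) ℂ => m v) this
  obtain ⟨Ψ, hΨ⟩ := Φ.exists_leftInverse_of_injective hΦ
  have h₁ : ContDiffAt ℝ r (fun y => Φ (f y)) x := contDiffAt_pi.2 fun s => h _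
  refine (Ψ.toContinuousLinearMap.contDiff.contDiffAt.comp x h₁).congr_of_eventuallyEq
    (Eventually.of_forall fun y => (congrArg (fun L => L (f y)) hΨ).symm)

theorem contDiffAt_pullback {k : ℕ} [FiniteDimensional ℂ U] {ψ : V → Alt V k} {F : U → V} {z : U}
    (hF : ContDiffAt ℝ ∞ F z) (hψ : ContDiffAt ℝ ∞ ψ (F z)) :
    ContDiffAt ℝ ∞ (fun w => (ψ (F w)).compContinuousLinearMap (fderiv ℝ F w)) z := by
  have h₁ : ContDiffAt ℝ ∞ (fderiv ℝ F) z := hF.fderiv_right (m := ∞) (by simp)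
  exact contDiffAt_alt_iff.2 fun v => contDiffAt_apply_vectors (a := fun w => ψ (F w))
    (u := fun i w => fderiv ℝ F w (v i)) (hψ.comp z hF) fun i => h₁.clm_apply contDiffAt_const

/-- By the product rule the left side contains the expected term and terms with the second
derivative of `F`. The latter are symmetric in the two directions, so alternation removes them;
complex linearity of `dF` identifies the remaining term. -/
theorem dbarV_pullback {k : ℕ} {ψ : V → Alt V k} {F : U → V} {z : U}
    (hF : ContDiffAt ℂ ω F z) (hψ : DifferentiableAt ℝ ψ (F z)) :
    dbarV (fun w => (ψ (F w)).compContinuousLinearMap (fderiv ℝ F w)) z =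
      (dbarV ψ (F z)).compContinuousLinearMap (fderiv ℝ F z) := by
  have hF' : ContDiffAt ℝ ∞ F z := (hF.restrict_scalars ℝ).of_le le_top
  have hFd : DifferentiableAt ℝ F z := hF'.differentiableAt (by simp)
  have h₁ : DifferentiableAt ℝ (fderiv ℝ F) z :=
    (hF'.fderiv_right (m := ∞) (by simp)).differentiableAt (by simp)
  let D : U →L[ℝ] V := fderiv ℝ F z
  have hD : ∀ v, D (Complex.I • v) = Complex.I • D v := fun v => by
    have : D = (fderiv ℂ F z).restrictScalars ℝ :=
      (hF.differentiableAt (by simp)).fderiv_restrictScalars ℝ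
    rw [this]
    exact map_smul (fderiv ℂ F z) _ _
  let S : U →L[ℝ] U →L[ℝ] V := fderiv ℝ (fderiv ℝ F) z
  have hS : ∀ v w, S v w = S w v := fun v w =>
    (hF'.isSymmSndFDerivAt (by simpa using two_le_infty)) v w
  -- Since `F` is holomorphic on a neighbourhood of `z`, its derivative is complex linear at all
  -- nearby points, and this relation may be differentiated.
  have hSI : ∀ v w, S v (Complex.I • w) = Complex.I • S v w := fun v w => by
    have e : (fun y => fderiv ℝ F y (Complex.I • w)) =ᶠ[𝓝 z]
        mulI ∘ fun y => fderiv ℝ F y w := by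
      filter_upwards [hF.eventually (by simp)] with y hy
      change fderiv ℝ F y (Complex.I • w) = Complex.I • fderiv ℝ F y w
      rw [(hy.differentiableAt (by simp)).fderiv_restrictScalars ℝ]
      exact map_smul (fderiv ℂ F y) Complex.I w
    have hd : ∀ u, HasFDerivAt (fun y => fderiv ℝ F y u) (S.flip u) z := fun u =>
      ((ContinuousLinearMap.apply ℝ V u).hasFDerivAt (x := fderiv ℝ F z)).comp z h₁.hasFDerivAt
    have e₁ : HasFDerivAt (mulI ∘ fun y => fderiv ℝ F y w) (mulI.comp (S.flip w)) z :=
      mulI.hasFDerivAt.comp z (hd w)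
    have e₂ := (hd (Complex.I • w)).unique (e₁.congr_of_eventuallyEq e)
    exact congrArg (fun L : U →L[ℝ] V => L v) e₂
  -- `T` is `S` multiplied by `i`; it accounts for the direction `i v` in the conjugate-linear part,
  -- since `S (i v) = T v`. It is symmetric because `S` is.
  let T : U →L[ℝ] U →L[ℝ] V :=
    ((ContinuousLinearMap.compL ℝ U V V) mulI).comp S
  have hT : ∀ v w, T v w = T w v := fun v w => by
    change Complex.I • S v w = Complex.I • S w v
    rw [hS]
  have e := fderiv_continuousAlternatingMapCompContinuousLinearMap
    (f := fun w => ψ (F w)) (g := fderiv ℝ F) (hψ.comp z hFd) h₁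
  have e' : fderiv ℝ (fun w => ψ (F w)) z = (fderiv ℝ ψ (F z)).comp D :=
    fderiv_comp z hψ hFd
  have key : antilinPart (fderiv ℝ (fun w => (ψ (F w)).compContinuousLinearMap (fderiv ℝ F w)) z) =
      (compContinuousLinearMapCLM D).comp ((antilinPart (fderiv ℝ ψ (F z))).comp D) +
        (1 / 2 : ℂ) • ((ψ (F z)).fderivCompContinuousLinearMap D ∘L S +
          Complex.I • ((ψ (F z)).fderivCompContinuousLinearMap D ∘L T)) := by
    rw [e, e']
    ext1 v
    have hTv : S (Complex.I • v) = T v := by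
      ext1 w
      change S (Complex.I • v) w = Complex.I • S v w
      rw [hS, hSI, hS]
    ext w
    let A : V →L[ℝ] Alt V k := fderiv ℝ ψ (F z)
    let P := (ψ (F z)).fderivCompContinuousLinearMap D
    change (1 / 2 : ℂ) * ((A (D v) (fun i => D (w i)) + P (S v) w) +
        Complex.I * (A (D (Complex.I • v)) (fun i => D (w i)) + P (S (Complex.I • v)) w)) =
      (1 / 2 : ℂ) * (A (D v) (fun i => D (w i)) + Complex.I * A (Complex.I • D v) fun i => D (w i)) +
        (1 / 2 : ℂ) * (P (S v) w + Complex.I * P (T v) w)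
    rw [hD, hTv]
    ring
  rw [dbarV, key, alternatizeUncurryFin_add, alternatizeUncurryFin_smul, alternatizeUncurryFin_add,
    alternatizeUncurryFin_smul, alternatizeUncurryFin_fderivCompContinuousLinearMap_eq_zero _ _ hS,
    alternatizeUncurryFin_fderivCompContinuousLinearMap_eq_zero _ _ hT]
  ext v
  simp [dbarV, alternatizeUncurryFin_apply, Function.comp_def, D]
  rfl

theorem isType_fderiv {p q k : ℕ} {ψ : E → Alt V k} {x : E} (hψ : DifferentiableAt ℝ ψ x)
    (h : ∀ᶠ y in 𝓝 x, IsType p q (ψ y)) (v : E) : IsType p q (fderiv ℝ ψ x v) := fun c w => by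
  have hd : ∀ u, HasFDerivAt (fun y => ψ y u) ((ContinuousAlternatingMap.apply ℝ V ℂ u).comp
      (fderiv ℝ ψ x)) x := fun u =>
    (ContinuousAlternatingMap.apply ℝ V ℂ u).hasFDerivAt.comp x (f := ψ) hψ.hasFDerivAt
  have e : (fun y => ψ y fun i => c • w i) =ᶠ[𝓝 x]
      fun y => (c ^ p * (starRingEnd ℂ c) ^ q) * ψ y w := h.mono fun y hy => hy c w
  have := (hd fun i => c • w i).unique (((hd w).const_mul _).congr_of_eventuallyEq e)
  exact congrArg (fun L : E →L[ℝ] ℂ => L v) this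

/-- The new slot is filled by a conjugate-linear map, so it contributes one factor `conj c`; the
remaining slots keep the type of `ψ`, which passes to derivatives. -/
theorem isType_dbarV {p q k : ℕ} {ψ : V → Alt V k} {x : V} (hψ : DifferentiableAt ℝ ψ x)
    (h : ∀ᶠ y in 𝓝 x, IsType p q (ψ y)) : IsType p (q + 1) (dbarV ψ x) := fun c v => by
  have ht := isType_fderiv hψ h
  have hc : ∀ u, antilinPart (fderiv ℝ ψ x) (c • u) =
      (starRingEnd ℂ c) • antilinPart (fderiv ℝ ψ x) u := fun u => by
    have hr : ∀ (r : ℝ) u, fderiv ℝ ψ x ((r : ℂ) • u) = (r : ℂ) • fderiv ℝ ψ x u := fun r u => by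
      rw [Complex.coe_smul, Complex.coe_smul, map_smul]
    have e₁ : c • u = (c.re : ℂ) • u + (c.im : ℂ) • Complex.I • u := by
      rw [smul_smul, ← add_smul, Complex.re_add_im]
    have e₂ : Complex.I • c • u = (c.re : ℂ) • Complex.I • u - (c.im : ℂ) • u := by
      rw [e₁, smul_add, smul_comm _ (c.im : ℂ), smul_smul Complex.I Complex.I, Complex.I_mul_I,
        smul_comm Complex.I (c.re : ℂ), neg_smul, one_smul, smul_neg, sub_eq_add_neg]
    have e₃ : starRingEnd ℂ c = c.re - c.im * Complex.I := by
      apply Complex.ext <;> simp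
    rw [antilinPart_apply, antilinPart_apply, e₂, e₁, map_add, map_sub, hr, hr, hr, hr, e₃]
    ext w
    simp only [ContinuousAlternatingMap.smul_apply, ContinuousAlternatingMap.add_apply,
      ContinuousAlternatingMap.sub_apply, smul_eq_mul]
    linear_combination ((1 / 2) * (c.im : ℂ) * fderiv ℝ ψ x (Complex.I • u) w) * Complex.I_mul_I
  have ha : ∀ u, IsType p q (antilinPart (fderiv ℝ ψ x) u) := fun u =>
    ((ht u).add ((ht _).const_smul _)).const_smul _
  rw [dbarV, alternatizeUncurryFin_apply, alternatizeUncurryFin_apply, Finset.mul_sum]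
  refine Finset.sum_congr rfl fun i _ => ?_
  have e : (i.removeNth fun j => c • v j) = fun j => c • i.removeNth v j := rfl
  rw [hc, e, ContinuousAlternatingMap.smul_apply, ha]
  simp only [smul_eq_mul, zsmul_eq_mul]
  ring

/-- Since `ψ` has type (1,0), replacing both arguments by `i` times themselves turns `ψ'(v)(w)` into
`i ψ'(i v)(w)`. Averaging with the original therefore produces exactly the conjugate-linear part of
the derivative. -/
theorem part11_extDeriv {ψ : V → Alt V 1} {x : V} (hψ : DifferentiableAt ℝ ψ x)
    (h : ∀ᶠ y in 𝓝 x, IsType 1 0 (ψ y)) : part11 (extDeriv ψ x) = dbarV ψ x := by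
  have ht := isType_fderiv hψ h
  have hI : ∀ u (w : Fin 1 → V), fderiv ℝ ψ x u (fun i => Complex.I • w i) =
      Complex.I * fderiv ℝ ψ x u w := fun u w => by
    have := ht u Complex.I w
    simpa using this
  ext v
  have e : ∀ v : Fin (1 + 1) → V, extDeriv ψ x v =
      fderiv ℝ ψ x (v 0) (fun _ => v 1) - fderiv ℝ ψ x (v 1) (fun _ => v 0) := fun v => by
    rw [extDeriv, alternatizeUncurryFin_apply, Fin.sum_univ_two]
    have h₀ : Fin.removeNth 0 v = fun _ => v 1 := by
      funext i; fin_cases i; rfl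
    have h₁ : Fin.removeNth 1 v = fun _ => v 0 := by
      funext i; fin_cases i; rfl
    rw [h₀, h₁]
    simp [sub_eq_add_neg]
  change (1 / 2 : ℂ) * (extDeriv ψ x v + extDeriv ψ x fun i => Complex.I • v i) = _
  rw [e, e, dbarV, alternatizeUncurryFin_apply, Fin.sum_univ_two]
  have h₀ : Fin.removeNth 0 v = fun _ => v 1 := by
    funext i; fin_cases i; rfl
  have h₁ : Fin.removeNth 1 v = fun _ => v 0 := by
    funext i; fin_cases i; rfl
  rw [h₀, h₁, hI _ fun _ => v 1, hI _ fun _ => v 0]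
  simp [antilinPart_apply]
  ring

theorem part11_eq_zero {a : Alt V (1 + 1)} (h : IsType 2 0 a) : part11 a = 0 := by
  ext v
  have := h Complex.I v
  change (1 / 2 : ℂ) * (a v + a fun i => Complex.I • v i) = 0
  rw [this]
  simp

theorem part11_add (a b : Alt V (1 + 1)) : part11 (a + b) = part11 a + part11 b := by
  ext v
  simp [part11]
  ring

theorem part11_sum {ι : Type*} (s : Finset ι) (a : ι → Alt V (1 + 1)) :
    part11 (∑ i ∈ s, a i) = ∑ i ∈ s, part11 (a i) :=
  map_sum (⟨⟨part11, by ext; simp [part11]⟩, part11_add⟩ : Alt V (1 + 1) →+ Alt V (1 + 1)) a s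

theorem extDeriv_const_apply (g : V → ℂ) (x : V) (v : Fin 1 → V) :
    extDeriv (fun y => constOfIsEmpty ℝ V (Fin 0) (g y)) x v = fderiv ℝ g x (v 0) := by
  rw [extDeriv_constOfIsEmpty]
  rfl

/-- For holomorphic `g` the form `dg` has type (1,0), so `∂̄ dg` is the (1,1)-part of `ddg = 0`. -/
theorem dbarV_extDeriv_const {g : V → ℂ} {x : V} (hg : ContDiffAt ℂ ω g x) :
    dbarV (extDeriv fun y => constOfIsEmpty ℝ V (Fin 0) (g y)) x = 0 := by
  have hg' : ContDiffAt ℝ ∞ g x := (hg.restrict_scalars ℝ).of_le le_top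
  have hc : ContDiffAt ℝ ∞ (fun y => constOfIsEmpty ℝ V (Fin 0) (g y)) x :=
    contDiffAt_clm_comp (constOfIsEmptyLIE ℝ V ℂ (Fin 0)).toContinuousLinearEquiv.toContinuousLinearMap
      hg'
  have hd : ContDiffAt ℝ ∞ (extDeriv fun y => constOfIsEmpty ℝ V (Fin 0) (g y)) x :=
    contDiffAt_clm_comp (alternatizeUncurryFinCLM ℝ V ℂ) (hc.fderiv_right (m := ∞) (by simp))
  rw [← part11_extDeriv (hd.differentiableAt (by simp)),
    extDeriv_extDeriv_apply hc (by simpa using two_le_infty)]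
  · ext v; simp [part11]
  · filter_upwards [hg.eventually (by simp)] with y hy c v
    rw [extDeriv_const_apply, extDeriv_const_apply,
      (hy.differentiableAt (by simp)).fderiv_restrictScalars ℝ]
    simp

end Flat

/-! ### Calculus of forms on complex manifolds -/

section ManifoldCalculus

open Filter Topology

variable {V : Type*} [NormedAddCommGroup V] [NormedSpace ℂ V]
  {X : Type*} [TopologicalSpace X] [ChartedSpace V X]
  {W : Type*} [NormedAddCommGroup W] [NormedSpace ℂ W]
  {Y : Type*} [TopologicalSpace Y] [ChartedSpace W Y]
  {U : Type*} [NormedAddCommGroup U] [NormedSpace ℂ U]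
  {Z : Type*} [TopologicalSpace Z] [ChartedSpace U Z]

/-- The complex derivative of a map, as a complex-linear map between the model spaces. -/
def holDeriv (f : X → Y) (x : X) : V →L[ℂ] W := mfderiv 𝓘(ℂ, V) 𝓘(ℂ, W) f x

theorem realDeriv_eq (f : X → Y) (x : X) :
    realDeriv f x = (holDeriv f x : V →L[ℂ] W).restrictScalars ℝ := rfl

theorem realDeriv_comp {g : Y → Z} {f : X → Y} {x : X}
    (hg : MDifferentiableAt 𝓘(ℂ, W) 𝓘(ℂ, U) g (f x))
    (hf : MDifferentiableAt 𝓘(ℂ, V) 𝓘(ℂ, W) f x) :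
    realDeriv (g ∘ f) x = (realDeriv (V := W) (W := U) g (f x)).comp
      (realDeriv (V := V) (W := W) f x) := by
  have := mfderiv_comp x hg hf
  ext v
  exact congrArg (fun L : V →L[ℂ] U => L v) this

theorem realDeriv_congr {f g : X → Y} {x : X} (h : f =ᶠ[𝓝 x] g) :
    realDeriv (V := V) (W := W) f x = realDeriv (V := V) (W := W) g x := by
  ext v
  exact congrArg (fun L : V →L[ℂ] W => L v) h.mfderiv_eq

theorem realDeriv_eq_fderiv {f : U → V} {z : U} (hf : DifferentiableAt ℂ f z) :
    realDeriv f z = fderiv ℝ f z := by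
  rw [hf.fderiv_restrictScalars ℝ]
  ext v
  rw [realDeriv_eq, holDeriv, mfderiv_eq_fderiv]

theorem realDeriv_eq_fderiv_chart {f : X → Y} {x : X}
    (hf : MDifferentiableAt 𝓘(ℂ, V) 𝓘(ℂ, W) f x) :
    realDeriv (V := V) (W := W) f x =
      fderiv ℝ (chartAt W (f x) ∘ f ∘ (chartAt V x).symm) (chartAt V x x) := by
  have hd : DifferentiableAt ℂ (chartAt W (f x) ∘ f ∘ (chartAt V x).symm) (chartAt V x x) := by
    have := hf.differentiableWithinAt_writtenInExtChartAt
    simpa [writtenInExtChartAt, mfld_simps, differentiableWithinAt_univ] using this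
  rw [hd.fderiv_restrictScalars ℝ, realDeriv_eq]
  congr 1
  refine Eq.trans (b := fderivWithin ℂ (writtenInExtChartAt 𝓘(ℂ, V) 𝓘(ℂ, W) x f)
    (Set.range 𝓘(ℂ, V)) (extChartAt 𝓘(ℂ, V) x x)) hf.mfderiv ?_
  simp [writtenInExtChartAt, mfld_simps, fderivWithin_univ]

variable [IsManifold 𝓘(ℂ, V) ω X] [IsManifold 𝓘(ℂ, W) ω Y] [IsManifold 𝓘(ℂ, U) ω Z]

omit [IsManifold 𝓘(ℂ, W) ω Y] [IsManifold 𝓘(ℂ, U) ω Z] in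
theorem isManifold_one : IsManifold 𝓘(ℂ, V) 1 X := IsManifold.of_le (n := ω) le_top

theorem eventually_contMDiffAt {f : X → Y} {x : X} (hf : ContMDiffAt 𝓘(ℂ, V) 𝓘(ℂ, W) ω f x) :
    ∀ᶠ y in 𝓝 x, ContMDiffAt 𝓘(ℂ, V) 𝓘(ℂ, W) ω f y :=
  (contMDiffAt_iff_contMDiffAt_nhds (by simp)).1 hf

theorem mdifferentiableAt_chart_symm (x₀ : X) {y : V} (hy : y ∈ (chartAt V x₀).target) :
    MDifferentiableAt 𝓘(ℂ, V) 𝓘(ℂ, V) (chartAt V x₀).symm y :=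
  have := isManifold_one (V := V) (X := X)
  mdifferentiableAt_atlas_symm (chart_mem_atlas V x₀) hy

theorem mdifferentiableAt_chart (x₀ : X) {x : X} (hx : x ∈ (chartAt V x₀).source) :
    MDifferentiableAt 𝓘(ℂ, V) 𝓘(ℂ, V) (chartAt V x₀) x :=
  have := isManifold_one (V := V) (X := X)
  mdifferentiableAt_atlas (chart_mem_atlas V x₀) hx

theorem contMDiffAt_chart_symm (x₀ : X) {y : V} (hy : y ∈ (chartAt V x₀).target) :
    ContMDiffAt 𝓘(ℂ, V) 𝓘(ℂ, V) ω (chartAt V x₀).symm y :=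
  (contMDiffOn_chart_symm y hy).contMDiffAt ((chartAt V x₀).open_target.mem_nhds hy)

/-- The tangent space at `x` is identified with `V` through the preferred chart at `x`, so this
chart has derivative the identity there. Consequently the coordinate representation of a form at the
centre of its chart is its value. -/
theorem realDeriv_chart_symm_self (x : X) :
    realDeriv (V := V) (W := V) (chartAt V x).symm (chartAt V x x) = ContinuousLinearMap.id ℝ V := by
  have hx := mem_chart_source V x
  have h₁ := mdifferentiableAt_chart_symm x (mem_chart_target V x)
  rw [realDeriv_eq_fderiv_chart h₁]
  have e : (chartAt V ((chartAt V x).symm (chartAt V x x)) ∘ (chartAt V x).symm ∘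
      (chartAt V (chartAt V x x)).symm) =ᶠ[𝓝 (chartAt V x x)] id := by
    filter_upwards [(chartAt V x).open_target.mem_nhds (mem_chart_target V x)] with y hy
    rw [(chartAt V x).left_inv hx]
    exact (chartAt V x).right_inv hy
  exact e.fderiv_eq.trans fderiv_id

omit [IsManifold 𝓘(ℂ, W) ω Y] in
theorem pullbackForm_comp {f : Y → Z} {g : X → Y} {x : X} {k : ℕ} (φ : Form U Z k)
    (hf : MDifferentiableAt 𝓘(ℂ, W) 𝓘(ℂ, U) f (g x))
    (hg : MDifferentiableAt 𝓘(ℂ, V) 𝓘(ℂ, W) g x) :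
    (pullbackForm (f ∘ g) φ : Form V X k) x =
      (pullbackForm g (pullbackForm f φ : Form W Y k) : Form V X k) x := by
  change (φ (f (g x))).compContinuousLinearMap (realDeriv (f ∘ g) x) = _
  rw [realDeriv_comp hf hg]
  rfl

theorem coordRep_self (x : X) {k : ℕ} (φ : Form V X k) : coordRep x φ (chartAt V x x) = φ x := by
  rw [coordRep, realDeriv_chart_symm_self, (chartAt V x).left_inv (mem_chart_source V x)]
  rfl

/-- Near `z` the map `G` factors through the chart at `G z`, and the chain rule turns the pullback
into one between vector spaces, where the flat calculus applies. -/
theorem pullbackForm_eventuallyEq {G : U → X} {z : U} (hG : ContMDiffAt 𝓘(ℂ, U) 𝓘(ℂ, V) ω G z)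
    {k : ℕ} (φ : Form V X k) :
    (pullbackForm G φ : Form U U k) =ᶠ[𝓝 z] fun w =>
      (coordRep (G z) φ ((chartAt V (G z) ∘ G) w)).compContinuousLinearMap
        (fderiv ℝ (chartAt V (G z) ∘ G) w) := by
  have hs := hG.continuousAt.preimage_mem_nhds
    ((chartAt V (G z)).open_source.mem_nhds (mem_chart_source V (G z)))
  filter_upwards [eventually_contMDiffAt hG, eventually_eventually_nhds.2 hs] with w hw hs
  have hsw : G w ∈ (chartAt V (G z)).source := hs.self_of_nhds
  have hGd : MDifferentiableAt 𝓘(ℂ, U) 𝓘(ℂ, V) G w := hw.mdifferentiableAt (by simp)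
  have hcG : MDifferentiableAt 𝓘(ℂ, U) 𝓘(ℂ, V) (chartAt V (G z) ∘ G) w :=
    (mdifferentiableAt_chart (G z) hsw).comp w hGd
  have hcs := mdifferentiableAt_chart_symm (G z) ((chartAt V (G z)).map_source hsw)
  have e : G =ᶠ[𝓝 w] (chartAt V (G z)).symm ∘ (chartAt V (G z) ∘ G) := by
    filter_upwards [hs] with u hu
    exact ((chartAt V (G z)).left_inv hu).symm
  have hD : realDeriv (V := U) (W := V) G w =
      (realDeriv (chartAt V (G z)).symm ((chartAt V (G z) ∘ G) w)).comp
        (fderiv ℝ (chartAt V (G z) ∘ G) w) := by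
    rw [realDeriv_congr e, realDeriv_comp (g := (chartAt V (G z)).symm) (f := chartAt V (G z) ∘ G) hcs hcG, realDeriv_eq_fderiv
      (mdifferentiableAt_iff_differentiableAt.1 hcG)]
  change (φ (G w)).compContinuousLinearMap (realDeriv G w) = _
  rw [hD]
  simp only [coordRep, Function.comp, (chartAt V (G z)).left_inv hsw]
  rfl

theorem contDiffAt_chart_comp {G : U → X} {z : U} (hG : ContMDiffAt 𝓘(ℂ, U) 𝓘(ℂ, V) ω G z) :
    ContDiffAt ℂ ω (chartAt V (G z) ∘ G) z :=
  (((contMDiffOn_chart (I := 𝓘(ℂ, V)) (n := ω) (x := G z)).contMDiffAt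
    ((chartAt V (G z)).open_source.mem_nhds (mem_chart_source V (G z)))).comp z hG).contDiffAt

theorem contDiffAt_pullbackForm [FiniteDimensional ℂ U] {G : U → X} {z : U}
    (hG : ContMDiffAt 𝓘(ℂ, U) 𝓘(ℂ, V) ω G z) {k : ℕ} {φ : Form V X k} (hφ : SmoothAt φ (G z)) :
    ContDiffAt ℝ ∞ (pullbackForm G φ : Form U U k) z :=
  (contDiffAt_pullback (((contDiffAt_chart_comp hG).restrict_scalars ℝ).of_le le_top)
    hφ).congr_of_eventuallyEq (pullbackForm_eventuallyEq hG φ)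

theorem realDeriv_eq_fderiv_chart_comp {G : U → X} {z : U}
    (hG : ContMDiffAt 𝓘(ℂ, U) 𝓘(ℂ, V) ω G z) :
    realDeriv (V := U) (W := V) G z = fderiv ℝ (chartAt V (G z) ∘ G) z := by
  exact realDeriv_eq_fderiv_chart (hG.mdifferentiableAt (by simp))

theorem dbarV_pullbackForm {G : U → X} {z : U}
    (hG : ContMDiffAt 𝓘(ℂ, U) 𝓘(ℂ, V) ω G z) {k : ℕ} {φ : Form V X k} (hφ : SmoothAt φ (G z)) :
    dbarV (pullbackForm G φ : Form U U k) z = (pullbackForm G (dbar φ) : Form U U (k + 1)) z := by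
  rw [dbarV_congr (pullbackForm_eventuallyEq hG φ), dbarV_pullback (contDiffAt_chart_comp hG)
    hφ.differentiableAt, ← realDeriv_eq_fderiv_chart_comp hG]
  rfl

/-- Chart independence: on the left, `∂̄` at each point is computed in the preferred chart of that
point, on the right in the fixed chart at `x₀`. The inverse chart is holomorphic, so pullback along
it commutes with `∂̄`. -/
theorem coordRep_dbar (x₀ : X) {k : ℕ} {φ : Form V X k} {y : V} (hy : y ∈ (chartAt V x₀).target)
    (hφ : SmoothAt φ ((chartAt V x₀).symm y)) :
    coordRep x₀ (dbar φ) y = dbarV (coordRep x₀ φ) y :=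
  (dbarV_pullbackForm (contMDiffAt_chart_symm x₀ hy) hφ).symm

theorem dbar_eq_dbarV {k : ℕ} (φ : Form V X k) (x : X) :
    dbar φ x = dbarV (coordRep x φ) (chartAt V x x) := rfl

/-- A property that holds near `x` holds in the chart at `x` near the image of `x`. -/
theorem eventually_chart {x : X} {P : X → Prop} (h : ∀ᶠ y in 𝓝 x, P y) :
    ∀ᶠ z in 𝓝 (chartAt V x x), P ((chartAt V x).symm z) := by
  have := (chartAt V x).continuousAt_symm (mem_chart_target V x)
  rw [ContinuousAt, (chartAt V x).left_inv (mem_chart_source V x)] at this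
  exact this.eventually h

theorem coordRep_eventuallyEq {x : X} {k : ℕ} {φ η : Form V X k} (h : φ =ᶠ[𝓝 x] η) :
    coordRep x φ =ᶠ[𝓝 (chartAt V x x)] coordRep x η :=
  (eventually_chart h).mono fun z hz => by rw [coordRep, coordRep, hz]

theorem SmoothAt.congr {x : X} {k : ℕ} {φ η : Form V X k} (hφ : SmoothAt φ x)
    (h : η =ᶠ[𝓝 x] φ) : SmoothAt η x :=
  ContDiffAt.congr_of_eventuallyEq hφ (coordRep_eventuallyEq h)

theorem dbar_congr {x : X} {k : ℕ} {φ η : Form V X k} (h : φ =ᶠ[𝓝 x] η) :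
    dbar φ x = dbar η x :=
  dbarV_congr (coordRep_eventuallyEq h)

theorem coordRep_dbar_eventuallyEq {x : X} {k : ℕ} {φ : Form V X k}
    (hφ : ∀ᶠ y in 𝓝 x, SmoothAt φ y) :
    coordRep x (dbar φ) =ᶠ[𝓝 (chartAt V x x)] dbarV (coordRep x φ) := by
  filter_upwards [eventually_chart hφ,
    (chartAt V x).open_target.mem_nhds (mem_chart_target V x)] with y h₁ h₂
  exact coordRep_dbar x h₂ h₁

theorem SmoothAt.dbar {x : X} {k : ℕ} {φ : Form V X k} (hφ : ∀ᶠ y in 𝓝 x, SmoothAt φ y) :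
    SmoothAt (dbar φ) x :=
  (contDiffAt_dbarV hφ.self_of_nhds).congr_of_eventuallyEq (coordRep_dbar_eventuallyEq hφ)

theorem dbar_dbar {x : X} {k : ℕ} {φ : Form V X k} (hφ : ∀ᶠ y in 𝓝 x, SmoothAt φ y) :
    dbar (dbar φ) x = 0 :=
  (dbarV_congr (coordRep_dbar_eventuallyEq hφ)).trans (dbarV_dbarV hφ.self_of_nhds)

theorem IsType.coordRep {p q k : ℕ} {φ : Form V X k} (x₀ : X) {y : V}
    (h : IsType p q (φ ((chartAt V x₀).symm y))) : IsType p q (coordRep x₀ φ y) := by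
  exact h.comp (holDeriv (chartAt V x₀).symm y)

theorem IsType.dbar {p q k : ℕ} {φ : Form V X k} {x : X} (hφ : SmoothAt φ x)
    (h : ∀ᶠ y in 𝓝 x, IsType p q (φ y)) : IsType p (q + 1) (dbar φ x) :=
  isType_dbarV hφ.differentiableAt ((eventually_chart h).mono fun _ hy => hy.coordRep x)

theorem coordRep_wedge (x : X) {m n N : ℕ} (h : m + n = N) (φ : Form V X m) (η : Form V X n) :
    coordRep x (fun y => wedge h (φ y) (η y)) =
      fun y => wedge h (coordRep x φ y) (coordRep x η y) :=
  funext fun _ => wedge_comp h _ _ _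

theorem SmoothAt.wedge [FiniteDimensional ℂ V] {x : X} {m n N : ℕ} (h : m + n = N)
    {φ : Form V X m} {η : Form V X n} (hφ : SmoothAt φ x) (hη : SmoothAt η x) :
    SmoothAt (fun y => wedge h (φ y) (η y)) x := by
  rw [SmoothAt, coordRep_wedge]
  exact contDiffAt_wedge h hφ hη

theorem dbar_wedge [FiniteDimensional ℂ V] {x : X} {m n N : ℕ} (h : m + n = N)
    (h₁ : m + 1 + n = N + 1) (h₂ : m + (n + 1) = N + 1)
    {φ : Form V X m} {η : Form V X n} (hφ : SmoothAt φ x) (hη : SmoothAt η x) :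
    dbar (fun y => wedge h (φ y) (η y)) x =
      wedge h₁ (dbar φ x) (η x) + (-1 : ℂ) ^ m • wedge h₂ (φ x) (dbar η x) := by
  rw [dbar_eq_dbarV, coordRep_wedge, dbarV_wedge h h₁ h₂ hφ.differentiableAt hη.differentiableAt,
    coordRep_self, coordRep_self]
  rfl

/-- The complex-valued function `g` is `C^∞` (in the real sense) at `x`. -/
def FunSmoothAt (g : X → ℂ) (x : X) : Prop :=
  ContDiffAt ℝ ∞ (g ∘ (chartAt V x).symm) (chartAt V x x)

theorem coordRep_funSmul (x : X) {k : ℕ} (g : X → ℂ) (φ : Form V X k) :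
    coordRep x (fun y => g y • φ y) =
      fun y => (g ∘ (chartAt V x).symm) y • coordRep x φ y := rfl

theorem SmoothAt.funSmul {x : X} {k : ℕ} {g : X → ℂ} {φ : Form V X k}
    (hg : FunSmoothAt (V := V) g x) (hφ : SmoothAt φ x) : SmoothAt (fun y => g y • φ y) x :=
  contDiffAt_complex_smul hg hφ

theorem contDiffAt_comp_chart_symm {g : X → ℂ} {x : X} (hg : ContMDiffAt 𝓘(ℂ, V) 𝓘(ℂ, ℂ) ω g x) :
    ContDiffAt ℂ ω (g ∘ (chartAt V x).symm) (chartAt V x x) := by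
  have h := contMDiffAt_chart_symm x (mem_chart_target V x)
  exact (ContMDiffAt.comp (chartAt V x x) (by
    rwa [(chartAt V x).left_inv (mem_chart_source V x)]) h).contDiffAt

theorem funSmoothAt_of_holomorphic {g : X → ℂ} {x : X}
    (hg : ContMDiffAt 𝓘(ℂ, V) 𝓘(ℂ, ℂ) ω g x) : FunSmoothAt (V := V) g x :=
  ((contDiffAt_comp_chart_symm hg).restrict_scalars ℝ).of_le le_top

theorem dbar_funSmul {x : X} {k : ℕ} {g : X → ℂ} {φ : Form V X k}
    (hg : ContMDiffAt 𝓘(ℂ, V) 𝓘(ℂ, ℂ) ω g x) (hφ : SmoothAt φ x) :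
    dbar (fun y => g y • φ y) x = g x • dbar φ x := by
  rw [dbar_eq_dbarV, coordRep_funSmul, dbarV_smul
    ((contDiffAt_comp_chart_symm hg).differentiableAt (by simp)) hφ.differentiableAt]
  simp [dbar_eq_dbarV, (chartAt V x).left_inv (mem_chart_source V x)]

theorem extD_ofFun_apply {g : X → ℂ} {x : X} (hg : ContMDiffAt 𝓘(ℂ, V) 𝓘(ℂ, ℂ) ω g x)
    (v : Fin 1 → V) : (extD (ofFun g) : Form V X 1) x v = realDeriv g x (v 0) := by
  rw [realDeriv_eq_fderiv_chart (hg.mdifferentiableAt (by simp))]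
  exact extDeriv_const_apply (g ∘ (chartAt V x).symm) _ v

/-- The analogue of `coordRep_dbar` for differentials of holomorphic functions, here just the chain
rule. -/
theorem coordRep_extD_ofFun {g : X → ℂ} {x : X}
    (hg : ∀ᶠ y in 𝓝 x, ContMDiffAt 𝓘(ℂ, V) 𝓘(ℂ, ℂ) ω g y) :
    coordRep x (extD (ofFun g)) =ᶠ[𝓝 (chartAt V x x)] extDeriv fun y =>
      ContinuousAlternatingMap.constOfIsEmpty ℝ V (Fin 0) ((g ∘ (chartAt V x).symm) y) := by
  filter_upwards [eventually_chart hg,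
    (chartAt V x).open_target.mem_nhds (mem_chart_target V x)] with y h₁ h₂
  ext v
  have h₃ := mdifferentiableAt_chart_symm x h₂
  have h₄ := h₁.mdifferentiableAt (by simp)
  rw [extDeriv_const_apply, ← realDeriv_eq_fderiv
    (mdifferentiableAt_iff_differentiableAt.1 (h₄.comp y h₃)), realDeriv_comp h₄ h₃]
  exact extD_ofFun_apply h₁ _

theorem SmoothAt.extD_ofFun {g : X → ℂ} {x : X}
    (hg : ∀ᶠ y in 𝓝 x, ContMDiffAt 𝓘(ℂ, V) 𝓘(ℂ, ℂ) ω g y) :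
    SmoothAt (extD (ofFun g) : Form V X 1) x := by
  have h := funSmoothAt_of_holomorphic hg.self_of_nhds
  have hc : ContDiffAt ℝ ∞ (fun y => ContinuousAlternatingMap.constOfIsEmpty ℝ V (Fin 0)
      ((g ∘ (chartAt V x).symm) y)) (chartAt V x x) :=
    contDiffAt_clm_comp (ContinuousAlternatingMap.constOfIsEmptyLIE ℝ V ℂ
      (Fin 0)).toContinuousLinearEquiv.toContinuousLinearMap h
  exact (contDiffAt_clm_comp (ContinuousAlternatingMap.alternatizeUncurryFinCLM ℝ V ℂ)
    (hc.fderiv_right (m := ∞) (by simp))).congr_of_eventuallyEq (coordRep_extD_ofFun hg)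

theorem dbar_extD_ofFun {g : X → ℂ} {x : X}
    (hg : ∀ᶠ y in 𝓝 x, ContMDiffAt 𝓘(ℂ, V) 𝓘(ℂ, ℂ) ω g y) :
    dbar (extD (ofFun g) : Form V X 1) x = 0 :=
  (dbarV_congr (coordRep_extD_ofFun hg)).trans
    (dbarV_extDeriv_const (contDiffAt_comp_chart_symm hg.self_of_nhds))

theorem isType_extD_ofFun {g : X → ℂ} {x : X} (hg : ContMDiffAt 𝓘(ℂ, V) 𝓘(ℂ, ℂ) ω g x) :
    IsType 1 0 ((extD (ofFun g) : Form V X 1) x) := fun c v => by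
  rw [extD_ofFun_apply hg, extD_ofFun_apply hg, realDeriv_eq]
  simp

theorem part11_extD {φ : Form V X 1} {x : X} (hφ : SmoothAt φ x)
    (h : ∀ᶠ y in 𝓝 x, IsType 1 0 (φ y)) : part11 (extD φ x) = dbar φ x :=
  part11_extDeriv hφ.differentiableAt ((eventually_chart h).mono fun _ hy => hy.coordRep x)

/-! ### Pullback of forms along holomorphic maps -/

section Pullback

variable {f : X → Y} {x : X}

theorem coordRep_pullbackForm_eventuallyEq (hf : ContMDiffAt 𝓘(ℂ, V) 𝓘(ℂ, W) ω f x)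
    {k : ℕ} (φ : Form W Y k) :
    coordRep x (pullbackForm f φ : Form V X k) =ᶠ[𝓝 (chartAt V x x)]
      (pullbackForm (f ∘ (chartAt V x).symm) φ : Form V V k) := by
  filter_upwards [eventually_chart (eventually_contMDiffAt hf),
    (chartAt V x).open_target.mem_nhds (mem_chart_target V x)] with y h₁ h₂
  exact (pullbackForm_comp φ (h₁.mdifferentiableAt (by simp))
    (mdifferentiableAt_chart_symm x h₂)).symm

theorem contMDiffAt_comp_chart_symm (hf : ContMDiffAt 𝓘(ℂ, V) 𝓘(ℂ, W) ω f x) :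
    ContMDiffAt 𝓘(ℂ, V) 𝓘(ℂ, W) ω (f ∘ (chartAt V x).symm) (chartAt V x x) :=
  ContMDiffAt.comp (chartAt V x x) (by
    rwa [(chartAt V x).left_inv (mem_chart_source V x)])
    (contMDiffAt_chart_symm x (mem_chart_target V x))

theorem SmoothAt.pullbackForm [FiniteDimensional ℂ V] (hf : ContMDiffAt 𝓘(ℂ, V) 𝓘(ℂ, W) ω f x)
    {k : ℕ} {φ : Form W Y k} (hφ : SmoothAt φ (f x)) : SmoothAt (pullbackForm f φ : Form V X k) x :=
  (contDiffAt_pullbackForm (contMDiffAt_comp_chart_symm hf) (by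
    rwa [Function.comp, (chartAt V x).left_inv (mem_chart_source V x)])).congr_of_eventuallyEq
    (coordRep_pullbackForm_eventuallyEq hf φ)

theorem dbar_pullbackForm (hf : ContMDiffAt 𝓘(ℂ, V) 𝓘(ℂ, W) ω f x)
    {k : ℕ} {φ : Form W Y k} (hφ : SmoothAt φ (f x)) :
    dbar (pullbackForm f φ : Form V X k) x = (pullbackForm f (dbar φ) : Form V X (k + 1)) x := by
  rw [dbar_eq_dbarV, dbarV_congr (coordRep_pullbackForm_eventuallyEq hf φ),
    dbarV_pullbackForm (contMDiffAt_comp_chart_symm hf) (by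
      rwa [Function.comp, (chartAt V x).left_inv (mem_chart_source V x)]),
    ← (coordRep_pullbackForm_eventuallyEq hf (dbar φ)).self_of_nhds, coordRep_self]

theorem IsType.pullbackForm {p q k : ℕ} {φ : Form W Y k} (h : IsType p q (φ (f x))) :
    IsType p q ((pullbackForm f φ : Form V X k) x) :=
  h.comp (holDeriv f x)

theorem pullbackForm_extD_ofFun (hf : ContMDiffAt 𝓘(ℂ, V) 𝓘(ℂ, W) ω f x) {g : Y → ℂ}
    (hg : ContMDiffAt 𝓘(ℂ, W) 𝓘(ℂ, ℂ) ω g (f x)) :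
    (pullbackForm f (extD (ofFun g) : Form W Y 1) : Form V X 1) x =
      (extD (ofFun (g ∘ f)) : Form V X 1) x := by
  ext v
  rw [extD_ofFun_apply (hg.comp x hf), realDeriv_comp (hg.mdifferentiableAt (by simp))
    (hf.mdifferentiableAt (by simp))]
  exact extD_ofFun_apply hg _

end Pullback

end ManifoldCalculus

/-! ### Products and pullbacks of Dolbeault classes -/

section DolbeaultClasses

open Filter Topology

variable {V : Type*} [NormedAddCommGroup V] [NormedSpace ℂ V]
  {X : Type*} [TopologicalSpace X] [ChartedSpace V X]

section Represents

variable {p q : ℕ} {φ η : Form V X (p + q)} {c d : Dolbeault V X p q}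

theorem Represents.add (h₁ : Represents φ c) (h₂ : Represents η d) :
    Represents (φ + η) (c + d) := by
  obtain ⟨h₁, rfl⟩ := h₁
  obtain ⟨h₂, rfl⟩ := h₂
  exact ⟨Submodule.add_mem _ h₁ h₂, rfl⟩

theorem Represents.smul (a : ℂ) (h : Represents φ c) : Represents (a • φ) (a • c) := by
  obtain ⟨h, rfl⟩ := h
  exact ⟨Submodule.smul_mem _ a h, rfl⟩

theorem Represents.zero : Represents (0 : Form V X (p + q)) (0 : Dolbeault V X p q) :=
  ⟨Submodule.zero_mem _, rfl⟩

theorem Represents.sum {ι : Type*} (s : Finset ι) {φ : ι → Form V X (p + q)}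
    {c : ι → Dolbeault V X p q} (h : ∀ i, Represents (φ i) (c i)) :
    Represents (∑ i ∈ s, φ i) (∑ i ∈ s, c i) := by
  classical
  induction s using Finset.induction_on with
  | empty => simpa using Represents.zero
  | insert i s hi ih =>
    rw [Finset.sum_insert hi, Finset.sum_insert hi]
    exact (h i).add ih

theorem Represents.unique (h₁ : Represents φ c) (h₂ : Represents φ d) : c = d := by
  obtain ⟨_, rfl⟩ := h₁
  obtain ⟨_, rfl⟩ := h₂
  rfl

theorem Represents.sub_mem (h₁ : Represents φ c) (h₂ : Represents η c) :
    φ - η ∈ coboundaries V X p q := by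
  obtain ⟨h₁, rfl⟩ := h₁
  obtain ⟨h₂, h⟩ := h₂
  exact (Submodule.Quotient.eq (p := (coboundaries V X p q).comap (cocycles V X p q).subtype)).1
    h.symm

theorem Represents.of_sub_mem (h₁ : Represents φ c) (h₂ : η ∈ cocycles V X p q)
    (h : η - φ ∈ coboundaries V X p q) : Represents η c := by
  obtain ⟨h₁, rfl⟩ := h₁
  exact ⟨h₂, (Submodule.Quotient.eq
    (p := (coboundaries V X p q).comap (cocycles V X p q).subtype)).2 h⟩

end Represents

variable [FiniteDimensional ℂ V] [IsManifold 𝓘(ℂ, V) ω X]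

section Wedge

variable {p q p' q' P Q : ℕ} (hP : p + p' = P) (hQ : q + q' = Q)

include hP hQ in
theorem smoothForms_wedge (h : p + q + (p' + q') = P + Q) {α : Form V X (p + q)}
    {β : Form V X (p' + q')} (hα : α ∈ smoothForms V X p q) (hβ : β ∈ smoothForms V X p' q') :
    (fun x => wedge h (α x) (β x)) ∈ smoothForms V X P Q := by
  subst hP hQ
  exact ⟨fun x => (hα.1 x).wedge h (hβ.1 x), fun x => (hα.2 x).wedge h (hβ.2 x)⟩

include hP hQ in
theorem cocycles_wedge (h : p + q + (p' + q') = P + Q) {α : Form V X (p + q)}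
    {β : Form V X (p' + q')} (hα : α ∈ cocycles V X p q) (hβ : β ∈ cocycles V X p' q') :
    (fun x => wedge h (α x) (β x)) ∈ cocycles V X P Q := by
  refine ⟨smoothForms_wedge hP hQ h hα.1 hβ.1, fun x => ?_⟩
  rw [dbar_wedge h (by omega) (by omega) (hα.1.1 x) (hβ.1.1 x), hα.2, hβ.2, wedge_zero_left,
    wedge_zero_right, smul_zero, add_zero]

-- As `β` is closed, `∂̄η ∧ β = ∂̄(η ∧ β)`. In degree `q = 0` the only coboundary is zero.
include hP hQ in
theorem coboundaries_wedge_left (h : p + q + (p' + q') = P + Q) {α : Form V X (p + q)}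
    {β : Form V X (p' + q')} (hα : α ∈ coboundaries V X p q) (hβ : β ∈ cocycles V X p' q') :
    (fun x => wedge h (α x) (β x)) ∈ coboundaries V X P Q := by
  cases q with
  | zero =>
    obtain rfl : α = 0 := hα
    simp only [Pi.zero_apply, wedge_zero_left]
    exact Submodule.zero_mem (coboundaries V X P Q)
  | succ q =>
    obtain ⟨Q, rfl⟩ : ∃ Q', Q = Q' + 1 := ⟨q + q', by omega⟩
    obtain ⟨η, hη, e⟩ := hα
    have h' : p + q + (p' + q') = P + Q := by omega
    refine ⟨fun x => wedge h' (η x) (β x), smoothForms_wedge hP (by omega) h' hη hβ.1, fun x => ?_⟩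
    rw [dbar_wedge h' h (by omega) (hη.1 x) (hβ.1.1 x), hβ.2, wedge_zero_right, smul_zero,
      add_zero, ← e]

include hP hQ in
theorem coboundaries_wedge_right (h : p + q + (p' + q') = P + Q) {α : Form V X (p + q)}
    {β : Form V X (p' + q')} (hα : α ∈ cocycles V X p q) (hβ : β ∈ coboundaries V X p' q') :
    (fun x => wedge h (α x) (β x)) ∈ coboundaries V X P Q := by
  cases q' with
  | zero =>
    obtain rfl : β = 0 := hβ
    simp only [Pi.zero_apply, wedge_zero_right]
    exact Submodule.zero_mem (coboundaries V X P Q)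
  | succ q' =>
    obtain ⟨Q, rfl⟩ : ∃ Q', Q = Q' + 1 := ⟨q + q', by omega⟩
    obtain ⟨η, hη, e⟩ := hβ
    have h' : p + q + (p' + q') = P + Q := by omega
    have hs := smoothForms_wedge hP (by omega) h' hα.1 hη
    -- The primitive carries the sign `(-1) ^ (p + q)` to cancel the one from the Leibniz rule.
    refine ⟨_, Submodule.smul_mem _ ((-1 : ℂ) ^ (p + q)) hs, fun x => ?_⟩
    rw [dbar_smul _ (hs.1 x), dbar_wedge h' (by omega) h (hα.1.1 x) (hη.1 x), hα.2, wedge_zero_left,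
      zero_add, smul_smul, ← mul_pow, ← e]
    simp

/-- The product of Dolbeault classes is represented by the products of representatives. -/
theorem Represents.cup (h : p + q + (p' + q') = P + Q) {a : Dolbeault V X p q}
    {b : Dolbeault V X p' q'} {α : Form V X (p + q)} {β : Form V X (p' + q')}
    (hα : Represents α a) (hβ : Represents β b) :
    Represents (p := P) (q := Q) (fun x => wedge h (α x) (β x)) (cup hP hQ a b) := by
  -- The product is a chosen class, so it has its defining property once some class is represented
  -- by all products of representatives. The class of the given product serves as this witness.
  refine Classical.epsilon_spec (p := fun c : Dolbeault V X P Q =>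
    ∀ (α : Form V X (p + q)) (β : Form V X (p' + q')), Represents α a → Represents β b →
      Represents (p := P) (q := Q) (fun x => wedge (by omega) (α x) (β x)) c) ?_ α β hα hβ
  have hc := cocycles_wedge hP hQ h hα.1 hβ.1
  refine ⟨Submodule.Quotient.mk ⟨_, hc⟩, fun α' β' hα' hβ' =>
    Represents.of_sub_mem ⟨hc, rfl⟩ (cocycles_wedge hP hQ h hα'.1 hβ'.1) ?_⟩
  -- Changing one factor at a time writes the difference of two products as a sum of products that
  -- each contain a coboundary.
  have e : ((fun x => wedge h (α' x) (β' x)) - fun x => wedge h (α x) (β x) : Form V X (P + Q)) =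
      (fun x => wedge h ((α' - α) x) (β' x)) + fun x => wedge h (α x) ((β' - β) x) := by
    funext x
    have e₁ : α' x = (α' - α) x + α x := by simp
    have e₂ : β' x = (β' - β) x + β x := by simp
    rw [Pi.sub_apply, Pi.add_apply, e₁, wedge_add_left]
    nth_rw 2 [e₂]
    rw [wedge_add_right]
    simp only [Pi.sub_apply]
    abel
  rw [e]
  exact Submodule.add_mem _ (coboundaries_wedge_left hP hQ h (hα'.sub_mem hα) hβ'.1)
    (coboundaries_wedge_right hP hQ h hα.1 (hβ'.sub_mem hβ))

end Wedge

section Pullback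

variable {W : Type*} [NormedAddCommGroup W] [NormedSpace ℂ W]
  {Y : Type*} [TopologicalSpace Y] [ChartedSpace W Y] [IsManifold 𝓘(ℂ, W) ω Y]
  {f : X → Y} (hf : ContMDiff 𝓘(ℂ, V) 𝓘(ℂ, W) ω f)

include hf

theorem smoothForms_pullback {p q : ℕ} {φ : Form W Y (p + q)} (hφ : φ ∈ smoothForms W Y p q) :
    (pullbackForm f φ : Form V X (p + q)) ∈ smoothForms V X p q :=
  ⟨fun x => (hφ.1 (f x)).pullbackForm (hf x), fun x => (hφ.2 (f x)).pullbackForm⟩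

theorem cocycles_pullback {p q : ℕ} {φ : Form W Y (p + q)} (hφ : φ ∈ cocycles W Y p q) :
    (pullbackForm f φ : Form V X (p + q)) ∈ cocycles V X p q :=
  ⟨smoothForms_pullback hf hφ.1, fun x => by
    rw [dbar_pullbackForm (hf x) (hφ.1.1 _)]
    simp only [pullbackForm, hφ.2]
    rfl⟩

theorem coboundaries_pullback {p q : ℕ} {φ : Form W Y (p + q)} (hφ : φ ∈ coboundaries W Y p q) :
    (pullbackForm f φ : Form V X (p + q)) ∈ coboundaries V X p q := by
  cases q with
  | zero =>
    obtain rfl : φ = 0 := hφ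
    exact Submodule.zero_mem (coboundaries V X p 0)
  | succ q =>
    obtain ⟨η, hη, e⟩ := hφ
    refine ⟨pullbackForm f η, smoothForms_pullback hf hη, fun x => ?_⟩
    rw [dbar_pullbackForm (hf x) (hη.1 _), pullbackForm, e]
    rfl

/-- The pullback of a Dolbeault class is represented by the pullback of a representative. -/
theorem Represents.pullbackClass {p q : ℕ} {c : Dolbeault W Y p q} {φ : Form W Y (p + q)}
    (hφ : Represents φ c) :
    Represents (pullbackForm f φ) (pullbackClass f c : Dolbeault V X p q) := by
  refine Classical.epsilon_spec (p := fun c' : Dolbeault V X p q => ∀ φ : Form W Y (p + q),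
    Represents φ c → Represents (pullbackForm f φ) c') ?_ φ hφ
  have hc := cocycles_pullback hf hφ.1
  exact ⟨Submodule.Quotient.mk ⟨_, hc⟩, fun φ' hφ' =>
    Represents.of_sub_mem ⟨hc, rfl⟩ (cocycles_pullback hf hφ'.1)
      (coboundaries_pullback hf (hφ'.sub_mem hφ))⟩

end Pullback

end DolbeaultClasses

/-! ### Matrices of forms -/

section FormMatrices

variable {V : Type*} [NormedAddCommGroup V] [NormedSpace ℂ V]
  {l m n : Type*} [Fintype l] [Fintype m] [Fintype n]

/-- A matrix of forms as a matrix over the algebra of forms. -/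
def algMat {k : ℕ} (M : Matrix m n (Alt V k)) : Matrix m n (FormAlg V) := M.map (toAlg k)

/-- A matrix of scalars as a matrix over the algebra of forms. -/
def scalMat (V : Type*) [NormedAddCommGroup V] [NormedSpace ℂ V] (T : Matrix m n ℂ) :
    Matrix m n (FormAlg V) := T.map (algebraMap ℂ (FormAlg V))

theorem algMat_apply {k : ℕ} (M : Matrix m n (Alt V k)) (i : m) (j : n) :
    algMat M i j = toAlg k (M i j) := rfl

theorem scalMat_apply (T : Matrix m n ℂ) (i : m) (j : n) :
    scalMat V T i j = algebraMap ℂ (FormAlg V) (T i j) := rfl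

theorem algMat_injective {k : ℕ} :
    Function.Injective (algMat : Matrix m n (Alt V k) → Matrix m n (FormAlg V)) := fun M N h => by
  ext1 i j
  exact toAlg_injective k (congrFun (congrFun h i) j)

theorem eq_of_algMat_of_eq {k : ℕ} {M N : m → n → Alt V k}
    (h : algMat (Matrix.of M) = algMat (Matrix.of N)) (i : m) (j : n) : M i j = N i j :=
  congrFun (congrFun (algMat_injective h) i) j

theorem algMat_zero {k : ℕ} : algMat (0 : Matrix m n (Alt V k)) = 0 := by
  ext1 i j; exact map_zero (toAlg k)

theorem scalMat_mul (S : Matrix l m ℂ) (T : Matrix m n ℂ) :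
    scalMat V (S * T) = scalMat V S * scalMat V T := by
  ext1 i j
  simp [scalMat, Matrix.mul_apply]

theorem scalMat_one [DecidableEq n] : scalMat V (1 : Matrix n n ℂ) = 1 := by
  ext1 i j
  by_cases h : i = j <;> simp [scalMat, Matrix.one_apply, h]

theorem algMat_wedge {k k' K : ℕ} (h : k + k' = K) (M : Matrix l m (Alt V k))
    (N : Matrix m n (Alt V k')) :
    algMat (Matrix.of fun i j => ∑ c, wedge h (M i c) (N c j) : Matrix l n (Alt V K)) =
      algMat M * algMat N := by
  ext1 i j
  change toAlg K (∑ c, wedge h (M i c) (N c j)) = _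
  simp [algMat_apply, Matrix.mul_apply, toAlg_wedge]

theorem algMat_smul_left {k : ℕ} (T : Matrix l m ℂ) (M : Matrix m n (Alt V k)) :
    algMat (Matrix.of fun i j => ∑ c, T i c • M c j : Matrix l n (Alt V k)) = scalMat V T * algMat M := by
  ext1 i j
  change toAlg k (∑ c, T i c • M c j) = _
  rw [map_sum]
  exact Finset.sum_congr rfl fun c _ => (map_smul (toAlg k) _ _).trans
    (Algebra.smul_def (T i c) (toAlg k (M c j)))

theorem algMat_smul_right {k : ℕ} (M : Matrix l m (Alt V k)) (T : Matrix m n ℂ) :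
    algMat (Matrix.of fun i j => ∑ c, T c j • M i c : Matrix l n (Alt V k)) = algMat M * scalMat V T := by
  ext1 i j
  change toAlg k (∑ c, T c j • M i c) = _
  rw [map_sum]
  exact Finset.sum_congr rfl fun c _ => ((map_smul (toAlg k) _ _).trans
    (Algebra.smul_def (T c j) (toAlg k (M i c)))).trans (Algebra.commutes (T c j) (toAlg k (M i c)))

/-- Forms do not commute, so the trace is not cyclic in general; it is when one factor has central
entries. -/
theorem trace_mul_scalMat (M : Matrix m n (FormAlg V)) (T : Matrix n m ℂ) :
    (M * scalMat V T).trace = (scalMat V T * M).trace := by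
  simp only [Matrix.trace, Matrix.diag_apply, Matrix.mul_apply, scalMat, Matrix.map_apply]
  rw [Finset.sum_comm]
  exact Finset.sum_congr rfl fun i _ => Finset.sum_congr rfl fun j _ => (Algebra.commutes _ _).symm

end FormMatrices

/-! ### Endomorphism-valued forms in local frames -/

section EndFormCalculus

open Filter Topology

variable {V : Type*} [NormedAddCommGroup V] [NormedSpace ℂ V]
  {X : Type*} [TopologicalSpace X] [ChartedSpace V X]

namespace HolBundle

variable (E : HolBundle V X)

theorem eventually_mem_baseSet {i : E.ι} {x : X} (hx : x ∈ E.core.baseSet i) :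
    ∀ᶠ y in 𝓝 x, y ∈ E.core.baseSet i :=
  (E.core.isOpen_baseSet i).mem_nhds hx

theorem trans_mul_trans {i j : E.ι} {x : X} (hi : x ∈ E.core.baseSet i)
    (hj : x ∈ E.core.baseSet j) : E.trans j i x * E.trans i j x = 1 := by
  rw [E.trans_comp i j i x ⟨⟨hi, hj⟩, hi⟩, E.trans_self i x hi]

theorem contMDiffAt_trans {i j : E.ι} {x : X} (hi : x ∈ E.core.baseSet i)
    (hj : x ∈ E.core.baseSet j) (a b : E.n) :
    ContMDiffAt 𝓘(ℂ, V) 𝓘(ℂ, ℂ) ω (fun y => E.trans i j y a b) x :=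
  (E.trans_holomorphic i j a b).contMDiffAt
    (((E.core.isOpen_baseSet i).inter (E.core.isOpen_baseSet j)).mem_nhds ⟨hi, hj⟩)

end HolBundle

theorem SmoothAt.sum {ι : Type*} (s : Finset ι) {k : ℕ} {φ : ι → Form V X k} {x : X}
    (h : ∀ i ∈ s, SmoothAt (φ i) x) : SmoothAt (fun y => ∑ i ∈ s, φ i y) x := by
  classical
  induction s using Finset.induction_on with
  | empty => exact SmoothAt.zero (V := V) x
  | insert i s hi ih =>
    simp only [Finset.sum_insert hi]
    exact (h i (by simp)).add (ih fun j hj => h j (by simp [hj]))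

theorem dbar_sum {ι : Type*} (s : Finset ι) {k : ℕ} {φ : ι → Form V X k} {x : X}
    (h : ∀ i ∈ s, SmoothAt (φ i) x) :
    dbar (fun y => ∑ i ∈ s, φ i y) x = ∑ i ∈ s, dbar (φ i) x := by
  classical
  induction s using Finset.induction_on with
  | empty => exact dbar_zero (V := V) x
  | insert i s hi ih =>
    simp only [Finset.sum_insert hi]
    rw [← ih fun j hj => h j (by simp [hj])]
    exact dbar_add (h i (by simp)) (SmoothAt.sum s fun j hj => h j (by simp [hj]))

theorem IsType.sum {ι : Type*} (s : Finset ι) {p q N : ℕ} {a : ι → Alt V N}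
    (h : ∀ i ∈ s, IsType p q (a i)) : IsType p q (∑ i ∈ s, a i) := by
  classical
  induction s using Finset.induction_on with
  | empty => simpa using IsType.zero
  | insert i s hi ih =>
    rw [Finset.sum_insert hi]
    exact (h i (by simp)).add (ih fun j hj => h j (by simp [hj]))

variable {E : HolBundle V X}

/-- The matrix of the `End E`-valued form `α` at `x` in the local frame `i`. -/
def frameMat (E : HolBundle V X) (i : E.ι) {k : ℕ} (α : EndForm E k) (x : X) :
    Matrix E.n E.n (Alt V k) := Matrix.of fun a b => localRep E i α a b x

theorem frameMat_apply (i : E.ι) {k : ℕ} (α : EndForm E k) (x : X) (a b : E.n) :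
    frameMat E i α x a b = localRep E i α a b x := rfl

/-- Over the algebra of forms, the double sum defining `localRep` is conjugation by the transition
matrix. The behaviour of products, traces and the identity in other frames follows from this
description. -/
theorem algMat_frameMat (i : E.ι) {k : ℕ} (α : EndForm E k) (x : X) :
    algMat (frameMat E i α x) =
      scalMat V (E.trans (E.core.indexAt x) i x) * algMat (α x) *
        scalMat V (E.trans i (E.core.indexAt x) x) := by
  rw [← algMat_smul_left, ← algMat_smul_right]
  congr 1
  ext1 a b
  simp only [frameMat_apply, localRep, Finset.smul_sum, smul_smul, Matrix.of_apply]
  rw [Finset.sum_comm]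
  exact Finset.sum_congr rfl fun c _ => Finset.sum_congr rfl fun d _ => by rw [mul_comm]

theorem localRep_indexAt (x : X) {k : ℕ} (α : EndForm E k) (a b : E.n) :
    localRep E (E.core.indexAt x) α a b x = α x a b := by
  simp only [localRep, E.trans_self _ x (E.core.mem_baseSet_at x), Matrix.one_apply]
  simp

/-- The local representation of a form that is given by compatible local data. -/
theorem localRep_eq_of_compatible {k : ℕ} {α : EndForm E k} (B : E.ι → E.n → E.n → Form V X k)
    {x : X} (hB : ∀ a b, α x a b = B (E.core.indexAt x) a b x) {i : E.ι}
    (hi : x ∈ E.core.baseSet i)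
    (h : ∀ a b, ∑ c, E.trans (E.core.indexAt x) i x c b • B i a c x =
      ∑ c, E.trans (E.core.indexAt x) i x a c • B (E.core.indexAt x) c b x) (a b : E.n) :
    localRep E i α a b x = B i a b x := by
  refine eq_of_algMat_of_eq (N := fun a b => B i a b x) (?_ : algMat (frameMat E i α x) = _) a b
  have h' : algMat (Matrix.of fun a b => B i a b x : Matrix E.n E.n (Alt V k)) *
      scalMat V (E.trans (E.core.indexAt x) i x) =
      scalMat V (E.trans (E.core.indexAt x) i x) * algMat (α x) := by
    rw [← algMat_smul_left, ← algMat_smul_right]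
    congr 1
    ext1 a b
    simp only [hB, Matrix.of_apply]
    exact h a b
  rw [algMat_frameMat, ← h', Matrix.mul_assoc, ← scalMat_mul,
    E.trans_mul_trans hi (E.core.mem_baseSet_at x), scalMat_one, Matrix.mul_one]

theorem algMat_endMul {m n N : ℕ} (h : m + n = N) (α : EndForm E m) (β : EndForm E n) (x : X) :
    algMat (endMul h α β x) = algMat (α x) * algMat (β x) := algMat_wedge h (α x) (β x)

theorem localRep_endMul {i : E.ι} {x : X} (hi : x ∈ E.core.baseSet i) {m n N : ℕ} (h : m + n = N)
    (α : EndForm E m) (β : EndForm E n) (a b : E.n) :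
    localRep E i (endMul h α β) a b x =
      ∑ c, wedge h (localRep E i α a c x) (localRep E i β c b x) := by
  refine eq_of_algMat_of_eq (N := fun a b =>
    ∑ c, wedge h (frameMat E i α x a c) (frameMat E i β x c b))
    (?_ : algMat (frameMat E i (endMul h α β) x) = _) a b
  rw [algMat_frameMat, algMat_wedge h, algMat_frameMat, algMat_frameMat, algMat_endMul]
  have e' : scalMat V (E.trans i (E.core.indexAt x) x) * scalMat V (E.trans (E.core.indexAt x) i x) =
      1 := by
    rw [← scalMat_mul, E.trans_mul_trans (E.core.mem_baseSet_at x) hi, scalMat_one]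
  calc _ = scalMat V (E.trans (E.core.indexAt x) i x) * algMat (α x) *
        (1 * algMat (β x) * scalMat V (E.trans i (E.core.indexAt x) x)) := by
        simp only [Matrix.mul_assoc, Matrix.one_mul]
    _ = _ := by rw [← e']; simp only [Matrix.mul_assoc]

theorem toAlg_trace {n : Type*} [Fintype n] {k : ℕ} (M : Matrix n n (Alt V k)) :
    toAlg k (∑ a, M a a) = (algMat M).trace := by
  simp [Matrix.trace, algMat_apply]

/-- Conjugation by scalar matrices does not change the trace. Near a point the trace can thus be
computed in one fixed frame, where `∂̄` acts on matrix entries. -/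
theorem endTr_eq_localRep {i : E.ι} {x : X} (hi : x ∈ E.core.baseSet i) {k : ℕ}
    (α : EndForm E k) : endTr α x = ∑ a, localRep E i α a a x := by
  apply toAlg_injective
  refine Eq.trans (toAlg_trace (α x)) (Eq.trans ?_ (toAlg_trace (frameMat E i α x)).symm)
  rw [algMat_frameMat, trace_mul_scalMat, ← Matrix.mul_assoc,
    ← scalMat_mul, E.trans_mul_trans (E.core.mem_baseSet_at x) hi, scalMat_one, Matrix.one_mul]

theorem algMat_endOne (x : X) : algMat (endOne E x) = 1 := by
  ext1 a b
  change toAlg 0 (if a = b then _ else _) = _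
  by_cases h : a = b
  · rw [if_pos h, toAlg_one, Matrix.one_apply, if_pos h]
  · rw [if_neg h, map_zero, Matrix.one_apply, if_neg h]

theorem localRep_endOne {i : E.ι} {x : X} (hi : x ∈ E.core.baseSet i) (a b : E.n) :
    localRep E i (endOne E) a b x =
      if a = b then ContinuousAlternatingMap.constOfIsEmpty ℝ V (Fin 0) 1 else 0 := by
  refine congrFun (congrFun (algMat_injective (?_ : algMat (frameMat E i (endOne E) x) =
    algMat (endOne E x))) a) b
  rw [algMat_frameMat, algMat_endOne, Matrix.mul_one, ← scalMat_mul,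
    E.trans_mul_trans hi (E.core.mem_baseSet_at x), scalMat_one]

variable [IsManifold 𝓘(ℂ, V) ω X]

theorem EndSmooth.smoothAt_endTr {k : ℕ} {α : EndForm E k} (hα : EndSmooth E α) (x : X) :
    SmoothAt (endTr α) x := by
  have hx := E.core.mem_baseSet_at x
  refine SmoothAt.congr (SmoothAt.sum Finset.univ fun a _ => hα (E.core.indexAt x) a a x hx) ?_
  filter_upwards [E.eventually_mem_baseSet hx] with y hy
  exact endTr_eq_localRep hy α

theorem dbar_endTr {k : ℕ} {α : EndForm E k} (hα : EndSmooth E α) (x : X) :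
    dbar (endTr α) x = endTr (endDbar E α) x := by
  have hx := E.core.mem_baseSet_at x
  have e : endTr α =ᶠ[𝓝 x] fun y => ∑ a, localRep E (E.core.indexAt x) α a a y := by
    filter_upwards [E.eventually_mem_baseSet hx] with y hy
    exact endTr_eq_localRep hy α
  rw [dbar_congr e, dbar_sum _ fun a _ => hα (E.core.indexAt x) a a x hx]
  rfl

variable [FiniteDimensional ℂ V]

theorem EndSmooth.endMul {m n N : ℕ} (h : m + n = N) {α : EndForm E m} {β : EndForm E n}
    (hα : EndSmooth E α) (hβ : EndSmooth E β) : EndSmooth E (endMul h α β) := fun i a b x hx => by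
  refine SmoothAt.congr (SmoothAt.sum Finset.univ fun c _ =>
    (hα i a c x hx).wedge h (hβ i c b x hx)) ?_
  filter_upwards [E.eventually_mem_baseSet hx] with y hy
  exact localRep_endMul hy h α β a b

theorem endDbar_endMul {m n N : ℕ} (h : m + n = N) (h₁ : m + 1 + n = N + 1)
    (h₂ : m + (n + 1) = N + 1) {α : EndForm E m} {β : EndForm E n}
    (hα : EndSmooth E α) (hβ : EndSmooth E β) :
    endDbar E (endMul h α β) =
      endMul h₁ (endDbar E α) β + (-1 : ℂ) ^ m • endMul h₂ α (endDbar E β) := by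
  funext x a b
  have hx := E.core.mem_baseSet_at x
  have e : localRep E (E.core.indexAt x) (HiggsClasses.endMul h α β) a b =ᶠ[𝓝 x]
      fun y => ∑ c, wedge h (localRep E (E.core.indexAt x) α a c y)
        (localRep E (E.core.indexAt x) β c b y) := by
    filter_upwards [E.eventually_mem_baseSet hx] with y hy
    exact localRep_endMul hy h α β a b
  rw [HiggsClasses.endDbar, dbar_congr e, dbar_sum _ fun c _ => (hα _ a c x hx).wedge h (hβ _ c b x hx)]
  simp only [dbar_wedge h h₁ h₂ (hα _ a _ x hx) (hβ _ _ b x hx), localRep_indexAt]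
  rw [Finset.sum_add_distrib, ← Finset.smul_sum]
  rfl

end EndFormCalculus

/-! ### Products and traces of endomorphism-valued Dolbeault classes -/

section EndDolbeaultClasses

open Filter Topology

variable {V : Type*} [NormedAddCommGroup V] [NormedSpace ℂ V]
  {X : Type*} [TopologicalSpace X] [ChartedSpace V X] {E : HolBundle V X}

section

variable {p q : ℕ} {φ η : EndForm E (p + q)} {c d : EndDolbeault E p q}

theorem EndRepresents.sub_mem (h₁ : EndRepresents φ c) (h₂ : EndRepresents η c) :
    φ - η ∈ endCoboundaries E p q := by
  obtain ⟨h₁, rfl⟩ := h₁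
  obtain ⟨h₂, h⟩ := h₂
  exact (Submodule.Quotient.eq
    (p := (endCoboundaries E p q).comap (endCocycles E p q).subtype)).1 h.symm

theorem EndRepresents.of_sub_mem (h₁ : EndRepresents φ c) (h₂ : η ∈ endCocycles E p q)
    (h : η - φ ∈ endCoboundaries E p q) : EndRepresents η c := by
  obtain ⟨h₁, rfl⟩ := h₁
  exact ⟨h₂, (Submodule.Quotient.eq
    (p := (endCoboundaries E p q).comap (endCocycles E p q).subtype)).2 h⟩

theorem endRepresents_endClass (h : φ ∈ endCocycles E p q) : EndRepresents φ (endClass φ) :=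
  Classical.epsilon_spec (p := fun c : EndDolbeault E p q => EndRepresents φ c) ⟨_, h, rfl⟩

end

section MulAlgebra

variable {m n N : ℕ} (h : m + n = N)

theorem endMul_add_left (α α' : EndForm E m) (β : EndForm E n) :
    endMul h (α + α') β = endMul h α β + endMul h α' β := by
  funext x a b
  simp [endMul, wedge_add_left, Finset.sum_add_distrib]

theorem endMul_add_right (α : EndForm E m) (β β' : EndForm E n) :
    endMul h α (β + β') = endMul h α β + endMul h α β' := by
  funext x a b
  simp [endMul, wedge_add_right, Finset.sum_add_distrib]

theorem endMul_zero_left (β : EndForm E n) : endMul h (0 : EndForm E m) β = 0 := by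
  funext x a b
  simp [endMul, wedge_zero_left]

theorem endMul_zero_right (α : EndForm E m) : endMul h α (0 : EndForm E n) = 0 := by
  funext x a b
  simp [endMul, wedge_zero_right]

end MulAlgebra

theorem endTr_sub {k : ℕ} (α β : EndForm E k) : endTr (α - β) = endTr α - endTr β := by
  funext x
  simp [endTr]

variable [IsManifold 𝓘(ℂ, V) ω X]

theorem smoothForms_endTr {p q : ℕ} {α : EndForm E (p + q)} (hα : α ∈ endSmoothForms E p q) :
    endTr α ∈ smoothForms V X p q :=
  ⟨hα.1.smoothAt_endTr, fun x => IsType.sum _ fun a _ => hα.2 x a a⟩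

theorem cocycles_endTr {p q : ℕ} {α : EndForm E (p + q)} (hα : α ∈ endCocycles E p q) :
    endTr α ∈ cocycles V X p q :=
  ⟨smoothForms_endTr hα.1, fun x => by
    rw [dbar_endTr hα.1.1, hα.2]
    simp [endTr]⟩

theorem coboundaries_endTr {p q : ℕ} {α : EndForm E (p + q)} (hα : α ∈ endCoboundaries E p q) :
    endTr α ∈ coboundaries V X p q := by
  cases q with
  | zero =>
    obtain rfl : α = 0 := hα
    have : endTr (0 : EndForm E (p + 0)) = 0 := by funext x; simp [endTr]
    rw [this]
    exact Submodule.zero_mem _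
  | succ q =>
    obtain ⟨η, hη, rfl⟩ := hα
    exact ⟨endTr η, smoothForms_endTr hη, fun x => (dbar_endTr hη.1 x).symm⟩

/-- The trace of a class is represented by the trace of a representative. -/
theorem EndRepresents.trClass {p q : ℕ} {a : EndDolbeault E p q} {α : EndForm E (p + q)}
    (hα : EndRepresents α a) : Represents (endTr α) (trClass a) := by
  refine Classical.epsilon_spec (p := fun c : Dolbeault V X p q => ∀ α : EndForm E (p + q),
    EndRepresents α a → Represents (endTr α) c) ?_ α hα
  have hc := cocycles_endTr hα.1
  refine ⟨Submodule.Quotient.mk ⟨_, hc⟩, fun α' hα' =>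
    Represents.of_sub_mem ⟨hc, rfl⟩ (cocycles_endTr hα'.1) ?_⟩
  rw [← endTr_sub]
  exact coboundaries_endTr (hα'.sub_mem hα)

/-- In every frame the identity has the constant entries 0 and 1. This is the base of the powers of
the Atiyah class. -/
theorem endOne_mem_endCocycles : (endOne E : EndForm E (0 + 0)) ∈ endCocycles E 0 0 := by
  have key : ∀ (i : E.ι) (a b : E.n), ∀ x ∈ E.core.baseSet i, localRep E i (endOne E) a b =ᶠ[𝓝 x]
      ofFun fun _ => if a = b then 1 else 0 := fun i a b x hx => by
    filter_upwards [E.eventually_mem_baseSet hx] with y hy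
    rw [localRep_endOne hy]
    by_cases h : a = b
    · simp [h, ofFun]
    · simp only [h, ofFun, if_false]
      ext; simp
  have hc : ∀ (c : ℂ) (x : X), coordRep x (ofFun (fun _ => c) : Form V X 0) = fun _ =>
      ContinuousAlternatingMap.constOfIsEmpty ℝ V (Fin 0) c := fun c x => by
    funext y; ext v; simp [coordRep, ofFun]
  refine ⟨⟨fun i a b x hx => SmoothAt.congr ?_ (key i a b x hx), fun x a b c v => ?_⟩, ?_⟩
  · rw [SmoothAt, hc]
    exact contDiffAt_const
  · by_cases h : a = b
    · simp [endOne, h]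
    · simp [endOne, h]
  · funext x a b
    rw [endDbar, dbar_congr (key _ a b x (E.core.mem_baseSet_at x)), dbar, hc]
    simp only [fderiv_fun_const]
    ext v
    simp [ContinuousAlternatingMap.alternatizeUncurryFin_apply, antilinPart_apply]

variable [FiniteDimensional ℂ V]

section Mul

variable {p q p' q' P Q : ℕ} (hP : p + p' = P) (hQ : q + q' = Q)

include hP hQ

theorem endSmoothForms_endMul (h : p + q + (p' + q') = P + Q) {α : EndForm E (p + q)}
    {β : EndForm E (p' + q')} (hα : α ∈ endSmoothForms E p q) (hβ : β ∈ endSmoothForms E p' q') :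
    endMul h α β ∈ endSmoothForms E P Q := by
  subst hP hQ
  exact ⟨hα.1.endMul h hβ.1, fun x a b => IsType.sum _ fun c _ => (hα.2 x a c).wedge h (hβ.2 x c b)⟩

theorem endCocycles_endMul (h : p + q + (p' + q') = P + Q) {α : EndForm E (p + q)}
    {β : EndForm E (p' + q')} (hα : α ∈ endCocycles E p q) (hβ : β ∈ endCocycles E p' q') :
    endMul h α β ∈ endCocycles E P Q := by
  refine ⟨endSmoothForms_endMul hP hQ h hα.1 hβ.1, ?_⟩
  rw [endDbar_endMul h (by omega) (by omega) hα.1.1 hβ.1.1, hα.2, hβ.2, endMul_zero_left,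
    endMul_zero_right, smul_zero, add_zero]

theorem endCoboundaries_endMul_left (h : p + q + (p' + q') = P + Q) {α : EndForm E (p + q)}
    {β : EndForm E (p' + q')} (hα : α ∈ endCoboundaries E p q) (hβ : β ∈ endCocycles E p' q') :
    endMul h α β ∈ endCoboundaries E P Q := by
  cases q with
  | zero =>
    obtain rfl : α = 0 := hα
    rw [endMul_zero_left]
    exact Submodule.zero_mem _
  | succ q =>
    obtain ⟨Q, rfl⟩ : ∃ Q', Q = Q' + 1 := ⟨q + q', by omega⟩
    obtain ⟨η, hη, rfl⟩ := hα
    have h' : p + q + (p' + q') = P + Q := by omega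
    refine ⟨endMul h' η β, endSmoothForms_endMul hP (by omega) h' hη hβ.1, ?_⟩
    rw [endDbar_endMul h' h (by omega) hη.1 hβ.1.1, hβ.2, endMul_zero_right, smul_zero, add_zero]

theorem endCoboundaries_endMul_right (h : p + q + (p' + q') = P + Q) {α : EndForm E (p + q)}
    {β : EndForm E (p' + q')} (hα : α ∈ endCocycles E p q) (hβ : β ∈ endCoboundaries E p' q') :
    endMul h α β ∈ endCoboundaries E P Q := by
  cases q' with
  | zero =>
    obtain rfl : β = 0 := hβ
    rw [endMul_zero_right]
    exact Submodule.zero_mem _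
  | succ q' =>
    obtain ⟨Q, rfl⟩ : ∃ Q', Q = Q' + 1 := ⟨q + q', by omega⟩
    obtain ⟨η, hη, rfl⟩ := hβ
    have h' : p + q + (p' + q') = P + Q := by omega
    have hs := endSmoothForms_endMul hP (by omega) h' hα.1 hη
    refine ⟨_, Submodule.smul_mem _ ((-1 : ℂ) ^ (p + q)) hs, ?_⟩
    rw [endDbar_smul E _ hs.1, endDbar_endMul h' (by omega) h hα.1.1 hη.1, hα.2, endMul_zero_left,
      zero_add, smul_smul, ← mul_pow]
    simp

/-- The product of classes is represented by the products of representatives. -/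
theorem EndRepresents.endCup (h : p + q + (p' + q') = P + Q) {a : EndDolbeault E p q}
    {b : EndDolbeault E p' q'} {α : EndForm E (p + q)} {β : EndForm E (p' + q')}
    (hα : EndRepresents α a) (hβ : EndRepresents β b) :
    EndRepresents (p := P) (q := Q) (endMul h α β) (endCup hP hQ a b) := by
  refine Classical.epsilon_spec (p := fun c : EndDolbeault E P Q =>
    ∀ (α : EndForm E (p + q)) (β : EndForm E (p' + q')), EndRepresents α a → EndRepresents β b →
      EndRepresents (p := P) (q := Q) (endMul (by omega) α β) c) ?_ α β hα hβ
  have hc := endCocycles_endMul hP hQ h hα.1 hβ.1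
  refine ⟨Submodule.Quotient.mk ⟨_, hc⟩, fun α' β' hα' hβ' =>
    EndRepresents.of_sub_mem ⟨hc, rfl⟩ (endCocycles_endMul hP hQ h hα'.1 hβ'.1) ?_⟩
  have e : endMul h α' β' - endMul h α β = endMul h (α' - α) β' + endMul h α (β' - β) := by
    have e₁ : endMul h α' β' = endMul h (α' - α) β' + endMul h α β' := by
      rw [← endMul_add_left, sub_add_cancel]
    have e₂ : endMul h α β' = endMul h α (β' - β) + endMul h α β := by
      rw [← endMul_add_right, sub_add_cancel]
    rw [e₁, e₂]
    abel
  rw [e]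
  exact Submodule.add_mem _ (endCoboundaries_endMul_left hP hQ h (hα'.sub_mem hα) hβ'.1)
    (endCoboundaries_endMul_right hP hQ h hα.1 (hβ'.sub_mem hβ))

end Mul

end EndDolbeaultClasses

/-! ### Gluing forms with a partition of unity -/

section Gluing

open Filter Topology

variable {V : Type*} [NormedAddCommGroup V] [NormedSpace ℂ V]
  {X : Type*} [TopologicalSpace X] [ChartedSpace V X]

/-- Partitions of unity are smooth only in the real sense, so the underlying real manifold is
needed. -/
theorem isManifold_real [IsManifold 𝓘(ℂ, V) ω X] : IsManifold 𝓘(ℝ, V) ∞ X := by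
  refine isManifold_of_contDiffOn 𝓘(ℝ, V) ∞ X fun e e' he he' => ?_
  have h : ContDiffOn ℂ ω _ _ := ((contDiffGroupoid ω 𝓘(ℂ, V)).compatible he he').1
  exact (h.restrict_scalars ℝ).of_le le_top

variable [FiniteDimensional ℂ V] [T2Space X] [SecondCountableTopology X]
  [IsManifold 𝓘(ℂ, V) ω X]

theorem exists_partitionOfUnity {ι : Type*} (U : ι → Set X) (hU : ∀ i, IsOpen (U i))
    (hc : ∀ x, ∃ i, x ∈ U i) :
    ∃ ρ : SmoothPartitionOfUnity ι 𝓘(ℝ, V) X Set.univ, ρ.IsSubordinate U := by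
  have := isManifold_real (V := V) (X := X)
  have : FiniteDimensional ℝ V := FiniteDimensional.complexToReal V
  have : ProperSpace V := FiniteDimensional.proper ℂ V
  have := ChartedSpace.locallyCompactSpace V X
  exact SmoothPartitionOfUnity.exists_isSubordinate 𝓘(ℝ, V) isClosed_univ U hU
    fun x _ => Set.mem_iUnion.2 (hc x)

/-- The sum of the forms `φ i`, weighted with a partition of unity. -/
def glueForm {ι : Type*} (ρ : SmoothPartitionOfUnity ι 𝓘(ℝ, V) X Set.univ) {k : ℕ}
    (φ : ι → Form V X k) : Form V X k := fun x => ∑ i ∈ ρ.finsupport x, (ρ i x : ℂ) • φ i x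

variable {ι : Type*} (ρ : SmoothPartitionOfUnity ι 𝓘(ℝ, V) X Set.univ)

theorem funSmoothAt_partition (i : ι) (x : X) : FunSmoothAt (V := V) (fun y => (ρ i y : ℂ)) x := by
  have h : ContMDiffAt 𝓘(ℝ, V) 𝓘(ℝ, ℝ) ∞ (ρ i) x := (ρ i).contMDiff x
  have h' := (contMDiffAt_iff.1 h).2
  simp only [mfld_simps, contDiffWithinAt_univ] at h'
  exact contDiffAt_clm_comp Complex.ofRealCLM h'

omit [FiniteDimensional ℂ V] [T2Space X] [SecondCountableTopology X]
  [IsManifold 𝓘(ℂ, V) ω X] in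
theorem sum_partition (x : X) : ∑ i ∈ ρ.finsupport x, (ρ i x : ℂ) = 1 := by
  exact_mod_cast ρ.sum_finsupport x (Set.mem_univ x)

omit [FiniteDimensional ℂ V] [T2Space X] [SecondCountableTopology X]
  [IsManifold 𝓘(ℂ, V) ω X] in
theorem mem_of_mem_finsupport {U : ι → Set X} {ρ : SmoothPartitionOfUnity ι 𝓘(ℝ, V) X Set.univ}
    (hρ : ρ.IsSubordinate U) {x : X} {i : ι} (hi : i ∈ ρ.finsupport x) : x ∈ U i :=
  hρ i (subset_closure (by simpa using hi))

theorem smoothAt_glueForm {U : ι → Set X} (hρ : ρ.IsSubordinate U) {k : ℕ} {φ : ι → Form V X k}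
    {x : X} (hφ : ∀ i, x ∈ U i → SmoothAt (φ i) x) : SmoothAt (glueForm ρ φ) x := by
  have h : ∀ i ∈ ρ.fintsupport x, SmoothAt (fun y => (ρ i y : ℂ) • φ i y) x := fun i hi =>
    SmoothAt.funSmul (funSmoothAt_partition ρ i x)
      (hφ i (hρ i ((ρ.mem_fintsupport_iff x i).1 hi)))
  refine SmoothAt.congr (SmoothAt.sum _ h) ?_
  filter_upwards [ρ.eventually_finsupport_subset x] with y hy
  -- The set of indices in the sum varies with `y`. Near `x` it lies in one fixed finite set, and
  -- the additional indices have weight zero.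
  refine Finset.sum_subset hy fun i _ hi => ?_
  have : ρ i y = 0 := by simpa using hi
  simp [this]

omit [FiniteDimensional ℂ V] [T2Space X] [SecondCountableTopology X]
  [IsManifold 𝓘(ℂ, V) ω X] in
theorem isType_glueForm {U : ι → Set X} (hρ : ρ.IsSubordinate U) {p q k : ℕ}
    {φ : ι → Form V X k} {x : X} (hφ : ∀ i, x ∈ U i → IsType p q (φ i x)) :
    IsType p q (glueForm ρ φ x) :=
  IsType.sum _ fun i hi => (hφ i (mem_of_mem_finsupport hρ hi)).const_smul _

end Gluing

/-! ### Matrices of one-forms and derivatives of holomorphic matrices -/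

section MatrixOneForms

open Filter Topology

variable {V : Type*} [NormedAddCommGroup V] [NormedSpace ℂ V]
  {X : Type*} [TopologicalSpace X] [ChartedSpace V X]
  {l m n : Type*} [Fintype l] [Fintype m] [Fintype n]

/-- The value of a matrix of `1`-forms at a tangent vector. -/
def evalMat (A : Matrix m n (Alt V 1)) (v : V) : Matrix m n ℂ :=
  Matrix.of fun a b => A a b fun _ => v

theorem evalMat_apply (A : Matrix m n (Alt V 1)) (v : V) (a : m) (b : n) :
    evalMat A v a b = A a b fun _ => v := rfl

/-- Lets identities between matrices of 1-forms be checked one tangent vector at a time, as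
identities of complex matrices. -/
theorem evalMat_ext {A B : Matrix m n (Alt V 1)} (h : ∀ v, evalMat A v = evalMat B v) : A = B := by
  ext a b v
  have e : v = fun _ => v 0 := funext fun i => by rw [Subsingleton.elim i 0]
  rw [e]
  exact congrFun (congrFun (h (v 0)) a) b

/-- All entries of the matrix `G` are holomorphic at `x`. -/
def MatHolAt (G : X → Matrix m n ℂ) (x : X) : Prop :=
  ∀ a b, ContMDiffAt 𝓘(ℂ, V) 𝓘(ℂ, ℂ) ω (fun y => G y a b) x

/-- The derivative of a matrix-valued function in the direction `v`. -/
def matDeriv (G : X → Matrix m n ℂ) (x : X) (v : V) : Matrix m n ℂ :=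
  Matrix.of fun a b => realDeriv (V := V) (W := ℂ) (fun y => G y a b) x v

theorem matDeriv_apply (G : X → Matrix m n ℂ) (x : X) (v : V) (a : m) (b : n) :
    matDeriv G x v a b = realDeriv (V := V) (W := ℂ) (fun y => G y a b) x v := rfl

theorem matDeriv_congr {G H : X → Matrix m n ℂ} {x : X} (h : G =ᶠ[𝓝 x] H) (v : V) :
    matDeriv G x v = matDeriv H x v := by
  ext a b
  rw [matDeriv_apply, matDeriv_apply, realDeriv_congr (h.mono fun y hy => by rw [hy])]

theorem realDeriv_const (c : ℂ) (x : X) : realDeriv (V := V) (W := ℂ) (fun _ => c) x = 0 := by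
  ext v
  rw [realDeriv_eq, holDeriv, mfderiv_const]
  rfl

theorem matDeriv_const (T : Matrix m n ℂ) (x : X) (v : V) :
    matDeriv (fun _ : X => T) x v = 0 := by
  ext a b
  rw [matDeriv_apply, realDeriv_const]
  rfl

variable [IsManifold 𝓘(ℂ, V) ω X]

theorem MatHolAt.mul {G : X → Matrix l m ℂ} {H : X → Matrix m n ℂ} {x : X}
    (hG : MatHolAt (V := V) G x) (hH : MatHolAt (V := V) H x) :
    MatHolAt (V := V) (fun y => G y * H y) x := fun a b => by
  simp only [Matrix.mul_apply]
  exact ContMDiffAt.sum fun c _ => (hG a c).mul (hH c b)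

theorem realDeriv_fun_eq {f : X → ℂ} {x : X} (hf : ContMDiffAt 𝓘(ℂ, V) 𝓘(ℂ, ℂ) ω f x) :
    realDeriv (V := V) (W := ℂ) f x = fderiv ℝ (f ∘ (chartAt V x).symm) (chartAt V x x) :=
  realDeriv_eq_fderiv_chart (hf.mdifferentiableAt (by simp))

theorem differentiableAt_comp_chart {f : X → ℂ} {x : X}
    (hf : ContMDiffAt 𝓘(ℂ, V) 𝓘(ℂ, ℂ) ω f x) :
    DifferentiableAt ℝ (f ∘ (chartAt V x).symm) (chartAt V x x) :=
  ((contDiffAt_comp_chart_symm hf).differentiableAt (by simp)).restrictScalars ℝ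

theorem matDeriv_mul {G : X → Matrix l m ℂ} {H : X → Matrix m n ℂ} {x : X}
    (hG : MatHolAt (V := V) G x) (hH : MatHolAt (V := V) H x) (v : V) :
    matDeriv (fun y => G y * H y) x v = matDeriv G x v * H x + G x * matDeriv H x v := by
  ext a b
  have e : ((fun y => (G y * H y) a b) ∘ (chartAt V x).symm) = fun z =>
      ∑ c, (fun z => G ((chartAt V x).symm z) a c) z * (fun z => H ((chartAt V x).symm z) c b) z := by
    funext z
    simp [Matrix.mul_apply]
  have h := HasFDerivAt.fun_sum fun c (_ : c ∈ Finset.univ) =>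
    (differentiableAt_comp_chart (hG a c)).hasFDerivAt.fun_mul
      (differentiableAt_comp_chart (hH c b)).hasFDerivAt
  rw [matDeriv_apply, realDeriv_fun_eq (hG.mul hH a b), e]
  refine (congrArg (fun L : V →L[ℝ] ℂ => L v) h.fderiv).trans ?_
  simp only [_root_.sum_apply, Matrix.add_apply, Matrix.mul_apply, matDeriv_apply,
    ← Finset.sum_add_distrib]
  refine Finset.sum_congr rfl fun c _ => ?_
  rw [realDeriv_fun_eq (hG a c), realDeriv_fun_eq (hH c b)]
  simp [(chartAt V x).left_inv (mem_chart_source V x)]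
  ring

theorem evalMat_extD {G : X → Matrix m n ℂ} {x : X} (hG : MatHolAt (V := V) G x) (v : V) :
    evalMat (Matrix.of fun a b => (extD (ofFun fun y => G y a b) : Form V X 1) x) v =
      matDeriv G x v := by
  ext a b
  exact extD_ofFun_apply (hG a b) _

end MatrixOneForms

/-! ### Connections and their curvature -/

section Connections

open Filter Topology

variable {V : Type*} [NormedAddCommGroup V] [NormedSpace ℂ V]
  {X : Type*} [TopologicalSpace X] [ChartedSpace V X] {E : HolBundle V X}

theorem HolBundle.matHolAt_trans {i j : E.ι} {x : X} (hi : x ∈ E.core.baseSet i)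
    (hj : x ∈ E.core.baseSet j) : MatHolAt (V := V) (E.trans i j) x :=
  fun a b => E.contMDiffAt_trans hi hj a b

/-- The matrix of connection forms at a point. -/
def Connection.mat (D : Connection E) (i : E.ι) (x : X) : Matrix E.n E.n (Alt V 1) :=
  Matrix.of fun a b => D.form i a b x

variable [IsManifold 𝓘(ℂ, V) ω X]

/-- Puts the gauge law in the form `A_j g = g A_i - dg`, to which noncommutative matrix algebra
applies. -/
theorem gauge_iff_evalMat (B : E.ι → E.n → E.n → Form V X 1) {i j : E.ι} {x : X}
    (hi : x ∈ E.core.baseSet i) (hj : x ∈ E.core.baseSet j) :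
    (∀ a b, ∑ c, E.trans i j x c b • B j a c x =
      ∑ c, E.trans i j x a c • B i c b x - extD (ofFun fun y => E.trans i j y a b) x) ↔
    ∀ v, evalMat (Matrix.of fun a b => B j a b x) v * E.trans i j x =
      E.trans i j x * evalMat (Matrix.of fun a b => B i a b x) v - matDeriv (E.trans i j) x v := by
  have key : ∀ v a b, (extD (ofFun fun y => E.trans i j y a b) : Form V X 1) x (fun _ => v) =
      matDeriv (E.trans i j) x v a b := fun v a b => extD_ofFun_apply (E.contMDiffAt_trans hi hj a b) _
  constructor
  · intro h v
    ext a b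
    have := congrArg (fun φ : Alt V 1 => φ fun _ => v) (h a b)
    simp only [ContinuousAlternatingMap.sub_apply, key] at this
    simp only [Matrix.sub_apply, Matrix.mul_apply, evalMat_apply, Matrix.of_apply]
    simpa [mul_comm] using this
  · intro h a b
    ext w
    have e : w = fun _ => w 0 := funext fun i => by rw [Subsingleton.elim i 0]
    rw [e]
    have := congrFun (congrFun (h (w 0)) a) b
    simp only [Matrix.sub_apply, Matrix.mul_apply, evalMat_apply, Matrix.of_apply] at this
    simp only [ContinuousAlternatingMap.sub_apply, key]
    simpa [mul_comm] using this

theorem Connection.evalMat_gauge (D : Connection E) {i j : E.ι} {x : X}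
    (hi : x ∈ E.core.baseSet i) (hj : x ∈ E.core.baseSet j) (v : V) :
    evalMat (D.mat j x) v * E.trans i j x =
      E.trans i j x * evalMat (D.mat i x) v - matDeriv (E.trans i j) x v :=
  (gauge_iff_evalMat D.form hi hj).1 (fun a b => D.gauge i j x ⟨hi, hj⟩ a b) v

/-! ### Curvature of compatible connections and the Atiyah class -/

section Curvature

variable {D D₁ D₂ : Connection E} (hD : D.IsCompatible) (h₁ : D₁.IsCompatible)
  (h₂ : D₂.IsCompatible)

-- The connection forms have type (1,0), so `A ∧ A` has type (2,0) and does not contribute, and the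
-- (1,1)-part of `dA` is `∂̄A`.
include hD in
theorem Connection.curvature11_apply (x : X) (a b : E.n) :
    D.curvature11 x a b = dbar (D.form (E.core.indexAt x) a b) x := by
  have hx := E.core.mem_baseSet_at x
  rw [curvature11, curvature, part11_add, part11_sum, Finset.sum_eq_zero, add_zero,
    part11_extD (D.smooth _ a b x hx) ((E.eventually_mem_baseSet hx).mono fun y hy => hD _ y hy a b)]
  exact fun c _ => part11_eq_zero ((hD _ x hx a c).wedge rfl (hD _ x hx c b))

/-- Apply `∂̄` to the gauge law: the holomorphic coefficients pass through and `∂̄ dg = 0`. What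
remains is the transformation law of an `End E`-valued form. -/
theorem Connection.dbar_gauge {i j : E.ι} {x : X} (hi : x ∈ E.core.baseSet i)
    (hj : x ∈ E.core.baseSet j) (a b : E.n) :
    ∑ c, E.trans i j x c b • dbar (D.form j a c) x =
      ∑ c, E.trans i j x a c • dbar (D.form i c b) x := by
  have hg := fun a b => E.contMDiffAt_trans hi hj a b
  have hsj : ∀ c, SmoothAt (fun y => E.trans i j y c b • D.form j a c y) x := fun c =>
    SmoothAt.funSmul (funSmoothAt_of_holomorphic (hg c b)) (D.smooth j a c x hj)
  have hsi : ∀ c, SmoothAt (fun y => E.trans i j y a c • D.form i c b y) x := fun c =>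
    SmoothAt.funSmul (funSmoothAt_of_holomorphic (hg a c)) (D.smooth i c b x hi)
  have he : ∀ᶠ y in 𝓝 x, ContMDiffAt 𝓘(ℂ, V) 𝓘(ℂ, ℂ) ω (fun y => E.trans i j y a b) y :=
    eventually_contMDiffAt (hg a b)
  have e : (fun y => ∑ c, E.trans i j y c b • D.form j a c y) =ᶠ[𝓝 x]
      (fun y => ∑ c, E.trans i j y a c • D.form i c b y) +
        (-1 : ℂ) • extD (ofFun fun y => E.trans i j y a b) := by
    filter_upwards [E.eventually_mem_baseSet hi, E.eventually_mem_baseSet hj] with y h₁ h₂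
    rw [D.gauge i j y ⟨h₁, h₂⟩ a b]
    simp [sub_eq_add_neg]
  have h := dbar_congr e
  rw [dbar_add (SmoothAt.sum _ fun c _ => hsi c) (SmoothAt.const_smul _ (SmoothAt.extD_ofFun he)),
    dbar_smul _ (SmoothAt.extD_ofFun he), dbar_extD_ofFun he, smul_zero, add_zero,
    dbar_sum _ fun c _ => hsi c, dbar_sum _ fun c _ => hsj c] at h
  simpa only [dbar_funSmul (hg _ _) (D.smooth j _ _ x hj),
    dbar_funSmul (hg _ _) (D.smooth i _ _ x hi)] using h

include hD in
theorem Connection.localRep_curvature11 {i : E.ι} {x : X} (hi : x ∈ E.core.baseSet i) (a b : E.n) :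
    localRep E i D.curvature11 a b x = dbar (D.form i a b) x :=
  localRep_eq_of_compatible (fun i a b => dbar (D.form i a b)) (D.curvature11_apply hD x) hi
    (fun a b => D.dbar_gauge (E.core.mem_baseSet_at x) hi a b) a b

include hD in
theorem Connection.localRep_curvature11_eventuallyEq {i : E.ι} {x : X}
    (hi : x ∈ E.core.baseSet i) (a b : E.n) :
    localRep E i D.curvature11 a b =ᶠ[𝓝 x] dbar (D.form i a b) :=
  (E.eventually_mem_baseSet hi).mono fun _ hy => localRep_curvature11 hD hy a b

theorem Connection.eventually_smoothAt (D : Connection E) {i : E.ι} {x : X}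
    (hi : x ∈ E.core.baseSet i) (a b : E.n) : ∀ᶠ y in 𝓝 x, SmoothAt (D.form i a b) y :=
  (E.eventually_mem_baseSet hi).mono fun y hy => D.smooth i a b y hy

include hD in
theorem Connection.curvature11_mem_endCocycles :
    (D.curvature11 : EndForm E (1 + 1)) ∈ endCocycles E 1 1 := by
  refine ⟨⟨fun i a b x hx => ?_, fun x a b => ?_⟩, ?_⟩
  · exact SmoothAt.congr (SmoothAt.dbar (D.eventually_smoothAt hx a b))
      (localRep_curvature11_eventuallyEq hD hx a b)
  · have hx := E.core.mem_baseSet_at x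
    rw [D.curvature11_apply hD]
    exact IsType.dbar (D.smooth _ a b x hx)
      ((E.eventually_mem_baseSet hx).mono fun y hy => hD _ y hy a b)
  · funext x a b
    have hx := E.core.mem_baseSet_at x
    rw [endDbar, dbar_congr (localRep_curvature11_eventuallyEq hD hx a b)]
    exact dbar_dbar (D.eventually_smoothAt hx a b)

/-- The inhomogeneous terms `dg` of the two gauge laws cancel. -/
theorem Connection.localRep_sub {i : E.ι} {x : X} (hi : x ∈ E.core.baseSet i) (a b : E.n) :
    localRep E i (fun x a b => D₁.form (E.core.indexAt x) a b x - D₂.form (E.core.indexAt x) a b x)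
      a b x = D₁.form i a b x - D₂.form i a b x := by
  refine localRep_eq_of_compatible (fun i a b => D₁.form i a b - D₂.form i a b)
    (fun a b => rfl) hi (fun a b => ?_) a b
  have hx := E.core.mem_baseSet_at x
  have e₁ := D₁.gauge _ i x ⟨hx, hi⟩ a b
  have e₂ := D₂.gauge _ i x ⟨hx, hi⟩ a b
  simp only [Pi.sub_apply, smul_sub, Finset.sum_sub_distrib, e₁, e₂]
  abel

-- The curvatures are locally `∂̄A₁` and `∂̄A₂`, and `A₁ - A₂` is a global `End E`-valued form of
-- type (1,0), which is therefore a primitive of the difference.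
include h₁ h₂ in
theorem Connection.curvature11_sub_mem_endCoboundaries :
    (D₁.curvature11 - D₂.curvature11 : EndForm E (1 + 1)) ∈ endCoboundaries E 1 1 := by
  let η : EndForm E (1 + 0) := fun x a b =>
    D₁.form (E.core.indexAt x) a b x - D₂.form (E.core.indexAt x) a b x
  have key : ∀ {i : E.ι} {x : X} (_ : x ∈ E.core.baseSet i) (a b : E.n),
      localRep E i η a b =ᶠ[𝓝 x] D₁.form i a b + (-1 : ℂ) • D₂.form i a b := fun hx a b =>
    (E.eventually_mem_baseSet hx).mono fun y hy => (Connection.localRep_sub hy a b).trans (by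
      simp [sub_eq_add_neg])
  refine ⟨η, ⟨fun i a b x hx => ?_, fun x a b => ?_⟩, ?_⟩
  · exact SmoothAt.congr ((D₁.smooth i a b x hx).add ((D₂.smooth i a b x hx).const_smul _))
      (key hx a b)
  · have hx := E.core.mem_baseSet_at x
    have := (h₁ _ x hx a b).add ((h₂ _ x hx a b).const_smul (-1))
    simpa [η, sub_eq_add_neg] using this
  · funext x a b
    have hx := E.core.mem_baseSet_at x
    have hs := (D₂.smooth _ a b x hx)
    rw [endDbar, dbar_congr (key hx a b), dbar_add (D₁.smooth _ a b x hx) (hs.const_smul _),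
      dbar_smul _ hs]
    change D₁.curvature11 x a b - D₂.curvature11 x a b = _
    rw [D₁.curvature11_apply h₁, D₂.curvature11_apply h₂, sub_eq_add_neg, neg_one_smul]

include hD in
/-- The Atiyah class is represented by the curvature of any compatible connection. -/
theorem Connection.endRepresents_atiyah : EndRepresents D.curvature11 (atiyah E) := by
  refine Classical.epsilon_spec (p := fun c : EndDolbeault E 1 1 => ∀ D : Connection E,
    D.IsCompatible → EndRepresents D.curvature11 c)
    ⟨Submodule.Quotient.mk ⟨_, curvature11_mem_endCocycles hD⟩, fun D' hD' => ?_⟩ D hD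
  exact EndRepresents.of_sub_mem ⟨curvature11_mem_endCocycles hD, rfl⟩
    (curvature11_mem_endCocycles hD') (curvature11_sub_mem_endCoboundaries hD' hD)

variable [FiniteDimensional ℂ V]

include hD

theorem Connection.endRepresents_endPow (k : ℕ) :
    EndRepresents (D.curvaturePow k) (endPow (atiyah E) k) := by
  induction k with
  | zero => exact endRepresents_endClass endOne_mem_endCocycles
  | succ k ih => exact ih.endCup rfl rfl (by omega) (endRepresents_atiyah hD)

theorem Connection.represents_atClass (k : ℕ) :
    Represents (coeff k • endTr (D.curvaturePow k)) (atClass k E) :=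
  (endRepresents_endPow hD k).trClass.smul _

theorem Connection.represents_ahClass (k : ℕ) (h : k + k + (1 + 0) = k + 1 + k)
    {θ : EndForm E (1 + 0)} (hθ : IsHiggsField E θ) :
    Represents (p := k + 1) (q := k) (coeff k • endTr (endMul h (D.curvaturePow k) θ))
      (ahClass k E θ) :=
  ((endRepresents_endPow hD k).endCup rfl rfl h
    (endRepresents_endClass ⟨hθ.1, hθ.2.1⟩)).trClass.smul _

end Curvature

/-! ### Existence of compatible connections -/

omit [IsManifold 𝓘(ℂ, V) ω X] in
theorem evalMat_glueForm {ι : Type*} (ρ : SmoothPartitionOfUnity ι 𝓘(ℝ, V) X Set.univ)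
    {m n : Type*} [Fintype m] [Fintype n]
    (φ : ι → m → n → Form V X 1) (x : X) (v : V) :
    evalMat (Matrix.of fun a b => glueForm ρ (fun i => φ i a b) x) v =
      ∑ i ∈ ρ.finsupport x, (ρ i x : ℂ) • evalMat (Matrix.of fun a b => φ i a b x) v := by
  ext a b
  simp [evalMat_apply, glueForm, Matrix.sum_apply]

/-- The flat connection of the frame `i`, in the frame `j`. -/
def frameForm (E : HolBundle V X) (i j : E.ι) (a b : E.n) : Form V X 1 := fun x =>
  ∑ c, -(E.trans j i x c b • extD (ofFun fun y => E.trans i j y a c) x)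

theorem evalMat_frameForm {i j : E.ι} {x : X} (hi : x ∈ E.core.baseSet i)
    (hj : x ∈ E.core.baseSet j) (v : V) :
    evalMat (Matrix.of fun a b => frameForm E i j a b x) v =
      -(matDeriv (E.trans i j) x v * E.trans j i x) := by
  have key : ∀ v a b, (extD (ofFun fun y => E.trans i j y a b) : Form V X 1) x (fun _ => v) =
      matDeriv (E.trans i j) x v a b := fun v a b => extD_ofFun_apply (E.contMDiffAt_trans hi hj a b) _
  ext a b
  simp only [evalMat_apply, frameForm, Matrix.of_apply, Matrix.neg_apply, Matrix.mul_apply,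
    ← Finset.sum_neg_distrib, ContinuousAlternatingMap.sum_apply,
    ContinuousAlternatingMap.neg_apply, ContinuousAlternatingMap.smul_apply, key]
  exact Finset.sum_congr rfl fun c _ => by rw [smul_eq_mul, mul_comm]

theorem smoothAt_frameForm {i j : E.ι} {x : X} (hi : x ∈ E.core.baseSet i)
    (hj : x ∈ E.core.baseSet j) (a b : E.n) : SmoothAt (frameForm E i j a b) x := by
  refine SmoothAt.sum _ fun c _ => SmoothAt.congr (SmoothAt.const_smul (-1 : ℂ)
    (SmoothAt.funSmul (funSmoothAt_of_holomorphic (E.contMDiffAt_trans hj hi c b))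
      (SmoothAt.extD_ofFun (eventually_contMDiffAt (E.contMDiffAt_trans hi hj a c))))) ?_
  exact Eventually.of_forall fun y => by simp

theorem isType_frameForm {i j : E.ι} {x : X} (hi : x ∈ E.core.baseSet i)
    (hj : x ∈ E.core.baseSet j) (a b : E.n) : IsType 1 0 (frameForm E i j a b x) := by
  refine IsType.sum _ fun c _ => ?_
  rw [← neg_one_smul ℂ]
  exact ((isType_extD_ofFun (E.contMDiffAt_trans hi hj a c)).const_smul _).const_smul _

/-- With `A_j = -(d g_ij) g_ji`, this is the product rule applied to the cocycle identity `g_ik =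
g_jk g_ij`. -/
theorem frameForm_gauge {i j k : E.ι} {x : X} (hi : x ∈ E.core.baseSet i)
    (hj : x ∈ E.core.baseSet j) (hk : x ∈ E.core.baseSet k) (v : V) :
    evalMat (Matrix.of fun a b => frameForm E i k a b x) v * E.trans j k x =
      E.trans j k x * evalMat (Matrix.of fun a b => frameForm E i j a b x) v -
        matDeriv (E.trans j k) x v := by
  have e : E.trans i k =ᶠ[𝓝 x] fun y => E.trans j k y * E.trans i j y := by
    filter_upwards [E.eventually_mem_baseSet hi, E.eventually_mem_baseSet hj,
      E.eventually_mem_baseSet hk] with y h₁ h₂ h₃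
    exact (E.trans_comp i j k y ⟨⟨h₁, h₂⟩, h₃⟩).symm
  rw [evalMat_frameForm hi hk, evalMat_frameForm hi hj, matDeriv_congr e,
    matDeriv_mul (E.matHolAt_trans hj hk) (E.matHolAt_trans hi hj), Matrix.neg_mul,
    Matrix.mul_assoc, E.trans_comp j k i x ⟨⟨hj, hk⟩, hi⟩, Matrix.add_mul, Matrix.mul_assoc,
    E.trans_mul_trans hj hi, Matrix.mul_one, Matrix.mul_neg, ← Matrix.mul_assoc]
  abel

variable [FiniteDimensional ℂ V] [T2Space X] [SecondCountableTopology X]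

/-- Every holomorphic vector bundle has a connection whose `(0, 1)` part is `∂̄`. -/
theorem exists_isCompatible (E : HolBundle V X) : ∃ D : Connection E, D.IsCompatible := by
  obtain ⟨ρ, hρ⟩ := exists_partitionOfUnity (V := V) E.core.baseSet E.core.isOpen_baseSet
    fun x => ⟨_, E.core.mem_baseSet_at x⟩
  let B : E.ι → E.n → E.n → Form V X 1 := fun j a b => glueForm ρ fun i => frameForm E i j a b
  have hs : ∀ j a b, ∀ x ∈ E.core.baseSet j, SmoothAt (B j a b) x := fun j a b x hx =>
    smoothAt_glueForm ρ hρ fun i hi => smoothAt_frameForm hi hx a b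
  have ht : ∀ j, ∀ x ∈ E.core.baseSet j, ∀ a b, IsType 1 0 (B j a b x) := fun j x hx a b =>
    isType_glueForm ρ hρ fun i hi => isType_frameForm hi hx a b
  have hB : ∀ j x v, evalMat (Matrix.of fun a b => B j a b x) v =
      ∑ i ∈ ρ.finsupport x, (ρ i x : ℂ) • evalMat (Matrix.of fun a b => frameForm E i j a b x) v :=
    fun j x v => evalMat_glueForm ρ (fun i a b => frameForm E i j a b) x v
  refine ⟨⟨B, hs, fun j k x hx => (gauge_iff_evalMat B hx.1 hx.2).2 fun v => ?_⟩, ht⟩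
  -- The gauge law is affine in the connection forms. As the weights add up to 1, its constant term
  -- `dg` can be distributed over the summands, and the law follows term by term.
  have hm : matDeriv (E.trans j k) x v =
      ∑ i ∈ ρ.finsupport x, (ρ i x : ℂ) • matDeriv (E.trans j k) x v := by
    rw [← Finset.sum_smul, sum_partition, one_smul]
  rw [hB, hB, Matrix.sum_mul, Matrix.mul_sum, hm, ← Finset.sum_sub_distrib]
  refine Finset.sum_congr rfl fun i hi => ?_
  rw [Matrix.smul_mul, Matrix.mul_smul, ← smul_sub,
    frameForm_gauge (mem_of_mem_finsupport hρ hi) hx.1 hx.2]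

end Connections

/-! ### Naturality -/

section Naturality

open Filter Topology

variable {V : Type*} [NormedAddCommGroup V] [NormedSpace ℂ V]
  {X : Type*} [TopologicalSpace X] [ChartedSpace V X]
  {W : Type*} [NormedAddCommGroup W] [NormedSpace ℂ W]
  {Y : Type*} [TopologicalSpace Y] [ChartedSpace W Y]
  {f : X → Y} (hf : ContMDiff 𝓘(ℂ, V) 𝓘(ℂ, W) ω f) {E : HolBundle W Y}

theorem pullbackForm_apply {k : ℕ} (φ : Form W Y k) (x : X) :
    (pullbackForm f φ : Form V X k) x = (φ (f x)).compContinuousLinearMap (realDeriv f x) := rfl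

theorem pullbackEnd_apply {k : ℕ} (α : EndForm E k) (x : X) (a b : E.n) :
    pullbackEnd f hf α x a b = (α (f x) a b).compContinuousLinearMap (realDeriv f x) := rfl

theorem pullbackForm_smul {k : ℕ} (c : ℂ) (φ : Form W Y k) :
    (pullbackForm f (c • φ) : Form V X k) = c • pullbackForm f φ := rfl

theorem sum_compContinuousLinearMap {ι : Type*} (s : Finset ι) {k : ℕ} (a : ι → Alt W k)
    (L : V →L[ℝ] W) : (∑ i ∈ s, a i).compContinuousLinearMap L =
      ∑ i ∈ s, (a i).compContinuousLinearMap L := by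
  ext v
  simp

/-- The pulled back bundle keeps the frames of `E`, with transition matrices composed with `f`, and
pullback of forms is complex linear at each point. -/
theorem localRep_pullbackEnd (i : E.ι) {k : ℕ} (θ : EndForm E k) (a b : E.n) :
    localRep (E.pullback f hf) i (pullbackEnd f hf θ) a b = pullbackForm f (localRep E i θ a b) := by
  funext x
  simp only [pullbackForm, localRep, sum_compContinuousLinearMap]
  rfl

theorem pullbackEnd_endMul {m n N : ℕ} (h : m + n = N) (α : EndForm E m) (β : EndForm E n) :
    pullbackEnd f hf (endMul h α β) = endMul h (pullbackEnd f hf α) (pullbackEnd f hf β) := by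
  funext x a b
  simp only [pullbackEnd, pullbackForm, endMul, sum_compContinuousLinearMap, wedge_comp]
  rfl

theorem pullbackEnd_endOne : pullbackEnd f hf (endOne E) = endOne (E.pullback f hf) := by
  funext x a b
  change ContinuousAlternatingMap.compContinuousLinearMap (if a = b then _ else _) _ =
    if a = b then _ else _
  split_ifs
  · rfl
  · rfl

theorem endTr_pullbackEnd {k : ℕ} (α : EndForm E k) :
    endTr (pullbackEnd f hf α) = pullbackForm f (endTr α) := by
  funext x
  exact (sum_compContinuousLinearMap _ _ _).symm

variable [IsManifold 𝓘(ℂ, V) ω X] [IsManifold 𝓘(ℂ, W) ω Y]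

theorem endDbar_pullbackEnd {k : ℕ} {α : EndForm E k} (hα : EndSmooth E α) :
    endDbar (E.pullback f hf) (pullbackEnd f hf α) = pullbackEnd f hf (endDbar E α) := by
  funext x a b
  have h := localRep_pullbackEnd hf (E.core.indexAt (f x)) α a b
  have h' := dbar_pullbackForm (hf x) (hα _ a b (f x) (E.core.mem_baseSet_at (f x)))
  rw [← h, pullbackForm_apply] at h'
  exact h'.trans (pullbackEnd_apply hf (endDbar E α) x a b).symm

theorem pullbackForm_gauge {n : Type*} [Fintype n] {G : Y → Matrix n n ℂ} {A B : n → n → Form W Y 1}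
    {x : X} {a b : n} (hfx : ContMDiffAt 𝓘(ℂ, V) 𝓘(ℂ, W) ω f x)
    (hG : ContMDiffAt 𝓘(ℂ, W) 𝓘(ℂ, ℂ) ω (fun y => G y a b) (f x))
    (h : ∑ c, G (f x) c b • B a c (f x) =
      ∑ c, G (f x) a c • A c b (f x) - extD (ofFun fun y => G y a b) (f x)) :
    ∑ c, G (f x) c b • (pullbackForm f (B a c) : Form V X 1) x =
      ∑ c, G (f x) a c • (pullbackForm f (A c b) : Form V X 1) x -
        extD (ofFun fun y => G (f y) a b) x := by
  have e := pullbackForm_extD_ofFun hfx hG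
  ext w
  have h := congrArg (fun φ : Alt W 1 => φ fun i => realDeriv (V := V) (W := W) f x (w i)) h
  simp only [ContinuousAlternatingMap.sub_apply, ContinuousAlternatingMap.sum_apply] at h ⊢
  exact h.trans (congrArg (fun z : ℂ => _ - z) (congrArg (fun φ : Alt V 1 => φ w) e))

variable [FiniteDimensional ℂ V]

theorem EndSmooth.pullbackEnd {k : ℕ} {α : EndForm E k} (hα : EndSmooth E α) :
    EndSmooth (E.pullback f hf) (pullbackEnd f hf α) := fun i a b x hx => by
  have h := localRep_pullbackEnd hf i α a b
  exact h ▸ (hα i a b (f x) hx).pullbackForm (hf x)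

theorem IsHiggsField.pullback {θ : EndForm E (1 + 0)} (hθ : IsHiggsField E θ) :
    IsHiggsField (E.pullback f hf) (pullbackEnd f hf θ) := by
  refine ⟨⟨hθ.1.1.pullbackEnd hf, fun x a b => (hθ.1.2 (f x) a b).pullbackForm⟩, ?_, ?_⟩
  · rw [endDbar_pullbackEnd hf hθ.1.1, hθ.2.1]
    rfl
  · rw [← pullbackEnd_endMul, hθ.2.2]
    rfl

/-- The pullback of a connection. -/
def Connection.pullback (D : Connection E) : Connection (E.pullback f hf) where
  form i a b := pullbackForm f (D.form i a b)
  smooth i a b x hx := (D.smooth i a b (f x) hx).pullbackForm (hf x)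
  gauge i j x hx a b :=
    pullbackForm_gauge (G := E.trans i j) (hf x) (E.contMDiffAt_trans hx.1 hx.2 a b)
      (D.gauge i j (f x) hx a b)

variable {D : Connection E} (hD : D.IsCompatible)

include hD

theorem Connection.IsCompatible.pullback : (D.pullback hf).IsCompatible :=
  fun i x hx a b => (hD i (f x) hx a b).pullbackForm

theorem Connection.curvature11_pullback :
    (D.pullback hf).curvature11 = pullbackEnd f hf D.curvature11 := by
  funext x a b
  rw [curvature11_apply (hD.pullback hf)]
  refine Eq.trans ((dbar_pullbackForm (hf x) (D.smooth _ a b (f x)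
    (E.core.mem_baseSet_at (f x)))).trans (pullbackForm_apply _ _)) ?_
  refine Eq.trans ?_ (pullbackEnd_apply hf _ x a b).symm
  exact congrArg (fun φ : Alt W (1 + 1) => φ.compContinuousLinearMap (realDeriv f x))
    (curvature11_apply hD (f x) a b).symm

theorem Connection.curvaturePow_pullback (k : ℕ) :
    (D.pullback hf).curvaturePow k = pullbackEnd f hf (D.curvaturePow k) := by
  induction k with
  | zero => exact (pullbackEnd_endOne hf).symm
  | succ k ih => rw [curvaturePow, curvaturePow, ih, curvature11_pullback hf hD, pullbackEnd_endMul]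

-- With the pulled back connection on `f^* E`, the two classes have literally the same representing
-- form.
omit hD in
theorem ahClass_pullback [T2Space Y] [SecondCountableTopology Y] [FiniteDimensional ℂ W]
    {θ : EndForm E (1 + 0)} (hθ : IsHiggsField E θ) (k : ℕ) :
    ahClass k (E.pullback f hf) (pullbackEnd f hf θ) = pullbackClass f (ahClass k E θ) := by
  obtain ⟨D, hD⟩ := exists_isCompatible E
  have h₁ := Connection.represents_ahClass (hD.pullback hf) k (by omega) (hθ.pullback hf)
  have h₂ := (Connection.represents_ahClass hD k (by omega) hθ).pullbackClass hf
  rw [Connection.curvaturePow_pullback hf hD, ← pullbackEnd_endMul, endTr_pullbackEnd,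
    ← pullbackForm_smul] at h₁
  exact h₁.unique h₂

end Naturality

/-! ### Kronecker products with the identity -/

section Kronecker

variable {R : Type*} [Ring R] {m n : Type*} [Fintype m] [Fintype n] [DecidableEq m] [DecidableEq n]

/-- The ring homomorphism `A ↦ A ⊗ 1`. -/
def leftKron (R m n : Type*) [Ring R] [Fintype m] [Fintype n] [DecidableEq m] [DecidableEq n] :
    Matrix m m R →+* Matrix (m × n) (m × n) R where
  toFun A := Matrix.of fun a b => if a.2 = b.2 then A a.1 b.1 else 0
  map_one' := by
    ext ⟨a₁, a₂⟩ ⟨b₁, b₂⟩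
    by_cases h₁ : a₁ = b₁ <;> by_cases h₂ : a₂ = b₂ <;> simp [Matrix.one_apply, h₁, h₂]
  map_zero' := by
    ext a b
    simp
  map_add' A B := by
    ext a b
    by_cases h : a.2 = b.2 <;> simp [h]
  map_mul' A B := by
    ext ⟨a₁, a₂⟩ ⟨b₁, b₂⟩
    by_cases h : a₂ = b₂ <;> simp [Matrix.mul_apply, Fintype.sum_prod_type, h]

/-- The ring homomorphism `B ↦ 1 ⊗ B`. -/
def rightKron (R m n : Type*) [Ring R] [Fintype m] [Fintype n] [DecidableEq m] [DecidableEq n] :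
    Matrix n n R →+* Matrix (m × n) (m × n) R where
  toFun A := Matrix.of fun a b => if a.1 = b.1 then A a.2 b.2 else 0
  map_one' := by
    ext ⟨a₁, a₂⟩ ⟨b₁, b₂⟩
    by_cases h₁ : a₁ = b₁ <;> by_cases h₂ : a₂ = b₂ <;> simp [Matrix.one_apply, h₁, h₂]
  map_zero' := by
    ext a b
    simp
  map_add' A B := by
    ext a b
    by_cases h : a.1 = b.1 <;> simp [h]
  map_mul' A B := by
    ext ⟨a₁, a₂⟩ ⟨b₁, b₂⟩
    by_cases h : a₁ = b₁ <;> simp [Matrix.mul_apply, Fintype.sum_prod_type, h]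

theorem leftKron_apply (A : Matrix m m R) (a b : m × n) :
    leftKron R m n A a b = if a.2 = b.2 then A a.1 b.1 else 0 := rfl

theorem rightKron_apply (B : Matrix n n R) (a b : m × n) :
    rightKron R m n B a b = if a.1 = b.1 then B a.2 b.2 else 0 := rfl

theorem leftKron_mul_rightKron_apply (A : Matrix m m R) (B : Matrix n n R) (a b : m × n) :
    (leftKron R m n A * rightKron R m n B) a b = A a.1 b.1 * B a.2 b.2 := by
  simp [Matrix.mul_apply, Fintype.sum_prod_type, leftKron_apply, rightKron_apply]

theorem rightKron_mul_leftKron_apply (A : Matrix m m R) (B : Matrix n n R) (a b : m × n) :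
    (rightKron R m n B * leftKron R m n A) a b = B a.2 b.2 * A a.1 b.1 := by
  simp [Matrix.mul_apply, Fintype.sum_prod_type, leftKron_apply, rightKron_apply]

/-- Over a noncommutative ring `A ⊗ 1` and `1 ⊗ B` need not commute: their two products have entries
`A a b * B c d` and `B c d * A a b`. -/
theorem commute_leftKron_rightKron {A : Matrix m m R} {B : Matrix n n R}
    (h : ∀ a b c d, Commute (A a b) (B c d)) : Commute (leftKron R m n A) (rightKron R m n B) := by
  ext a b
  rw [leftKron_mul_rightKron_apply, rightKron_mul_leftKron_apply]
  exact h _ _ _ _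

theorem trace_leftKron_mul_rightKron (A : Matrix m m R) (B : Matrix n n R) :
    (leftKron R m n A * rightKron R m n B).trace = A.trace * B.trace := by
  simp only [Matrix.trace, Matrix.diag_apply, leftKron_mul_rightKron_apply,
    Fintype.sum_prod_type, Finset.sum_mul_sum]

/-- The binomial theorem for the commuting matrices `A ⊗ 1` and `1 ⊗ B`. In each term `T ⊗ 1` is
moved to the left past the powers of `1 ⊗ B`, which requires the hypothesis on `T`; `1 ⊗ S` already
stands on the correct side, so `S` is arbitrary. -/
theorem trace_add_pow_mul_add {A T : Matrix m m R} {B S : Matrix n n R}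
    (hAB : ∀ a b c d, Commute (A a b) (B c d)) (hTB : ∀ a b c d, Commute (T a b) (B c d)) (k : ℕ) :
    ((leftKron R m n A + rightKron R m n B) ^ k * (leftKron R m n T + rightKron R m n S)).trace =
      ∑ j ∈ Finset.range (k + 1), k.choose j • ((A ^ j * T).trace * (B ^ (k - j)).trace +
        (A ^ j).trace * (B ^ (k - j) * S).trace) := by
  rw [(commute_leftKron_rightKron hAB).add_pow, Finset.sum_mul, Matrix.trace_sum]
  refine Finset.sum_congr rfl fun j _ => ?_
  have h := ((commute_leftKron_rightKron hTB).pow_right (k - j)).eq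
  rw [← nsmul_eq_mul', smul_mul_assoc, Matrix.trace_smul, mul_add, Matrix.trace_add,
    ← trace_leftKron_mul_rightKron, ← trace_leftKron_mul_rightKron, map_mul, map_mul, map_pow,
    map_pow, mul_assoc, ← h, mul_assoc, mul_assoc]

end Kronecker

/-! ### Tensor products -/

section Tensor

open Filter Topology

variable {V : Type*} [NormedAddCommGroup V] [NormedSpace ℂ V]
  {X : Type*} [TopologicalSpace X] [ChartedSpace V X]

section Matrices

variable {m n : Type*} [Fintype m] [Fintype n] [DecidableEq m] [DecidableEq n]

/-- `A ⊗ 1 + 1 ⊗ B` for matrices of forms. -/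
def kronSum {k : ℕ} (A : Matrix m m (Alt V k)) (B : Matrix n n (Alt V k)) :
    Matrix (m × n) (m × n) (Alt V k) :=
  Matrix.of fun a b => (if a.2 = b.2 then A a.1 b.1 else 0) + (if a.1 = b.1 then B a.2 b.2 else 0)

theorem algMat_kronSum {k : ℕ} (A : Matrix m m (Alt V k)) (B : Matrix n n (Alt V k)) :
    algMat (kronSum A B) = leftKron _ m n (algMat A) + rightKron _ m n (algMat B) := by
  ext1 a b
  change toAlg k ((if a.2 = b.2 then A a.1 b.1 else 0) + (if a.1 = b.1 then B a.2 b.2 else 0)) =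
    (if a.2 = b.2 then toAlg k (A a.1 b.1) else 0) + (if a.1 = b.1 then toAlg k (B a.2 b.2) else 0)
  rw [map_add, apply_ite (toAlg k), apply_ite (toAlg k), map_zero]

theorem evalMat_kronSum (A : Matrix m m (Alt V 1)) (B : Matrix n n (Alt V 1)) (v : V) :
    evalMat (kronSum A B) v = leftKron ℂ m n (evalMat A v) + rightKron ℂ m n (evalMat B v) := by
  ext a b
  by_cases h₁ : a.1 = b.1 <;> by_cases h₂ : a.2 = b.2 <;>
    simp [evalMat_apply, kronSum, leftKron_apply, rightKron_apply, h₁, h₂]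

theorem scalMat_leftKron (T : Matrix m m ℂ) :
    scalMat V (leftKron ℂ m n T) = leftKron _ m n (scalMat V T) := by
  ext1 a b
  simp only [scalMat_apply, leftKron_apply, apply_ite (algebraMap ℂ (FormAlg V)), map_zero]

theorem scalMat_rightKron (T : Matrix n n ℂ) :
    scalMat V (rightKron ℂ m n T) = rightKron _ m n (scalMat V T) := by
  ext1 a b
  simp only [scalMat_apply, rightKron_apply, apply_ite (algebraMap ℂ (FormAlg V)), map_zero]

theorem matDeriv_leftKron (G : X → Matrix m m ℂ) (x : X) (v : V) :
    matDeriv (fun y => leftKron ℂ m n (G y)) x v = leftKron ℂ m n (matDeriv G x v) := by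
  ext a b
  by_cases h : a.2 = b.2
  · simp only [matDeriv_apply, leftKron_apply, if_pos h]
  · simp only [matDeriv_apply, leftKron_apply, if_neg h, realDeriv_const,
      _root_.zero_apply]

theorem matDeriv_rightKron (G : X → Matrix n n ℂ) (x : X) (v : V) :
    matDeriv (fun y => rightKron ℂ m n (G y)) x v = rightKron ℂ m n (matDeriv G x v) := by
  ext a b
  by_cases h : a.1 = b.1
  · simp only [matDeriv_apply, rightKron_apply, if_pos h]
  · simp only [matDeriv_apply, rightKron_apply, if_neg h, realDeriv_const,
      _root_.zero_apply]

theorem MatHolAt.leftKron {G : X → Matrix m m ℂ} {x : X} (h : MatHolAt (V := V) G x) :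
    MatHolAt (V := V) (fun y => leftKron ℂ m n (G y)) x := fun a b => by
  by_cases hab : a.2 = b.2
  · simpa only [leftKron_apply, if_pos hab] using h a.1 b.1
  · simpa only [leftKron_apply, if_neg hab] using contMDiffAt_const

theorem MatHolAt.rightKron {G : X → Matrix n n ℂ} {x : X} (h : MatHolAt (V := V) G x) :
    MatHolAt (V := V) (fun y => rightKron ℂ m n (G y)) x := fun a b => by
  by_cases hab : a.1 = b.1
  · simpa only [rightKron_apply, if_pos hab] using h a.2 b.2
  · simpa only [rightKron_apply, if_neg hab] using contMDiffAt_const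

end Matrices

variable {E' : HolBundle.{_, _, u₁} V X} {E'' : HolBundle.{_, _, u₂} V X}

theorem tensor_trans (i j : E'.ι × E''.ι) (x : X) :
    ((E'.tensor E'').trans i j x : Matrix (E'.n × E''.n) (E'.n × E''.n) ℂ) =
      leftKron ℂ E'.n E''.n (E'.trans i.1 j.1 x) * rightKron ℂ E'.n E''.n (E''.trans i.2 j.2 x) := by
  refine Eq.trans (b := Matrix.kronecker (E'.trans i.1 j.1 x) (E''.trans i.2 j.2 x)) ?_ ?_
  · exact LinearMap.toMatrix'_toLin' _
  · ext a b
    rw [leftKron_mul_rightKron_apply]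
    rfl

/-- Conjugate `A ⊗ 1 + 1 ⊗ B` by the Kronecker product of the transition matrices. Scalars are
central, so the factors from the opposite tensor slot can be brought together, where they cancel. -/
theorem localRep_tensorHiggs {i : E'.ι × E''.ι} {x : X} (h₁ : x ∈ E'.core.baseSet i.1)
    (h₂ : x ∈ E''.core.baseSet i.2) {k : ℕ} (α : EndForm E' k) (β : EndForm E'' k)
    (a b : E'.n × E''.n) :
    localRep (E'.tensor E'') i (tensorHiggs α β) a b x =
      (if a.2 = b.2 then localRep E' i.1 α a.1 b.1 x else 0) +
        (if a.1 = b.1 then localRep E'' i.2 β a.2 b.2 x else 0) := by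
  have hx₁ := E'.core.mem_baseSet_at x
  have hx₂ := E''.core.mem_baseSet_at x
  have comm : ∀ (T : Matrix E''.n E''.n ℂ) (M : Matrix E'.n E'.n (FormAlg V)),
      Commute (leftKron _ E'.n E''.n M) (rightKron _ E'.n E''.n (scalMat V T)) := fun T M =>
    commute_leftKron_rightKron fun a b c d => Algebra.commute_algebraMap_right (T c d) (M a b)
  have comm' : ∀ (T : Matrix E'.n E'.n ℂ) (M : Matrix E''.n E''.n (FormAlg V)),
      Commute (leftKron _ E'.n E''.n (scalMat V T)) (rightKron _ E'.n E''.n M) := fun T M =>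
    commute_leftKron_rightKron fun a b c d => Algebra.commute_algebraMap_left (T a b) (M c d)
  have h : algMat (frameMat (E'.tensor E'') i (tensorHiggs α β) x) =
      algMat (kronSum (frameMat E' i.1 α x) (frameMat E'' i.2 β x)) := by
    refine (algMat_frameMat (E := E'.tensor E'') i (tensorHiggs α β) x).trans ?_
    have e₁ := tensor_trans (E' := E') (E'' := E'') (E'.core.indexAt x, E''.core.indexAt x) i x
    have e₂ := tensor_trans (E' := E') (E'' := E'') i (E'.core.indexAt x, E''.core.indexAt x) x
    refine Eq.trans (b := scalMat V (leftKron ℂ E'.n E''.n (E'.trans (E'.core.indexAt x) i.1 x) *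
      rightKron ℂ E'.n E''.n (E''.trans (E''.core.indexAt x) i.2 x)) *
      algMat (kronSum (α x) (β x)) *
      scalMat V (leftKron ℂ E'.n E''.n (E'.trans i.1 (E'.core.indexAt x) x) *
      rightKron ℂ E'.n E''.n (E''.trans i.2 (E''.core.indexAt x) x))) ?_ ?_
    · rw [← e₁, ← e₂]
      rfl
    · rw [algMat_kronSum, algMat_kronSum, algMat_frameMat, algMat_frameMat, scalMat_mul,
        scalMat_mul, scalMat_leftKron, scalMat_leftKron, scalMat_rightKron, scalMat_rightKron]
      have f₁ : scalMat V (E'.trans (E'.core.indexAt x) i.1 x) *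
          scalMat V (E'.trans i.1 (E'.core.indexAt x) x) = 1 := by
        rw [← scalMat_mul, E'.trans_mul_trans h₁ hx₁, scalMat_one]
      have f₂ : scalMat V (E''.trans (E''.core.indexAt x) i.2 x) *
          scalMat V (E''.trans i.2 (E''.core.indexAt x) x) = 1 := by
        rw [← scalMat_mul, E''.trans_mul_trans h₂ hx₂, scalMat_one]
      generalize E'.trans (E'.core.indexAt x) i.1 x = g₁ at *
      generalize E'.trans i.1 (E'.core.indexAt x) x = k₁ at *
      generalize E''.trans (E''.core.indexAt x) i.2 x = g₂ at *
      generalize E''.trans i.2 (E''.core.indexAt x) x = k₂ at *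
      generalize algMat (α x) = A
      generalize algMat (β x) = B
      have f₁' := congrArg (leftKron _ E'.n E''.n) f₁
      have f₂' := congrArg (rightKron _ E'.n E''.n) f₂
      rw [map_mul, map_one] at f₁' f₂'
      simp only [map_mul]
      generalize hL : leftKron (FormAlg V) E'.n E''.n = L at *
      generalize hR : rightKron (FormAlg V) E'.n E''.n = R at *
      rw [mul_add, add_mul]
      congr 1
      · calc _ = L (scalMat V g₁) * (R (scalMat V g₂) * L A) * (L (scalMat V k₁) * R (scalMat V k₂)) := by
              simp only [mul_assoc]
          _ = L (scalMat V g₁) * L A * (R (scalMat V g₂) * L (scalMat V k₁)) * R (scalMat V k₂) := by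
              rw [← (comm g₂ A).eq]; simp only [mul_assoc]
          _ = L (scalMat V g₁) * L A * L (scalMat V k₁) * (R (scalMat V g₂) * R (scalMat V k₂)) := by
              rw [← (comm g₂ _).eq]; simp only [mul_assoc]
          _ = _ := by rw [f₂', mul_one]
      · calc _ = L (scalMat V g₁) * (R (scalMat V g₂) * R B * L (scalMat V k₁)) * R (scalMat V k₂) := by
              simp only [mul_assoc]
          _ = L (scalMat V g₁) * L (scalMat V k₁) * (R (scalMat V g₂) * R B * R (scalMat V k₂)) := by
              rw [← map_mul, ← (comm' k₁ _).eq]; simp only [mul_assoc, map_mul]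
          _ = _ := by rw [f₁', one_mul]
  exact congrFun (congrFun (algMat_injective h) a) b

theorem SmoothAt.ite {k : ℕ} {φ : Form V X k} {x : X} {p : Prop} [Decidable p]
    (h : SmoothAt φ x) : SmoothAt (fun y => if p then φ y else 0) x := by
  by_cases hp : p
  · simpa only [if_pos hp] using h
  · simp only [if_neg hp]
    exact SmoothAt.zero (V := V) x

theorem dbar_ite {k : ℕ} {φ : Form V X k} {x : X} {p : Prop} [Decidable p] :
    dbar (fun y => if p then φ y else 0) x = if p then dbar φ x else 0 := by
  by_cases hp : p
  · simp only [if_pos hp]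
  · simp only [if_neg hp]
    exact dbar_zero (V := V) x

theorem IsType.ite {p q N : ℕ} {a : Alt V N} {P : Prop} [Decidable P] (h : IsType p q a) :
    IsType p q (if P then a else 0) := by
  by_cases hp : P
  · rwa [if_pos hp]
  · rw [if_neg hp]
    exact IsType.zero

theorem localRep_tensorHiggs_eventuallyEq {i : E'.ι × E''.ι} {x : X}
    (h₁ : x ∈ E'.core.baseSet i.1) (h₂ : x ∈ E''.core.baseSet i.2) {k : ℕ} (α : EndForm E' k)
    (β : EndForm E'' k) (a b : E'.n × E''.n) :
    localRep (E'.tensor E'') i (tensorHiggs α β) a b =ᶠ[𝓝 x]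
      (fun y => if a.2 = b.2 then localRep E' i.1 α a.1 b.1 y else 0) +
        fun y => if a.1 = b.1 then localRep E'' i.2 β a.2 b.2 y else 0 := by
  filter_upwards [E'.eventually_mem_baseSet h₁, E''.eventually_mem_baseSet h₂] with y hy₁ hy₂
  exact localRep_tensorHiggs hy₁ hy₂ α β a b

variable [IsManifold 𝓘(ℂ, V) ω X]

theorem EndSmooth.tensorHiggs {k : ℕ} {α : EndForm E' k} {β : EndForm E'' k}
    (hα : EndSmooth E' α) (hβ : EndSmooth E'' β) :
    EndSmooth (E'.tensor E'') (tensorHiggs α β) := fun i a b x hx =>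
  SmoothAt.congr ((SmoothAt.ite (hα i.1 a.1 b.1 x hx.1)).add
    (SmoothAt.ite (hβ i.2 a.2 b.2 x hx.2)))
    (localRep_tensorHiggs_eventuallyEq hx.1 hx.2 α β a b)

theorem endDbar_tensorHiggs {k : ℕ} {α : EndForm E' k} {β : EndForm E'' k}
    (hα : EndSmooth E' α) (hβ : EndSmooth E'' β) :
    endDbar (E'.tensor E'') (tensorHiggs α β) = tensorHiggs (endDbar E' α) (endDbar E'' β) := by
  funext x a b
  have h₁ := E'.core.mem_baseSet_at x
  have h₂ := E''.core.mem_baseSet_at x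
  refine (dbar_congr (localRep_tensorHiggs_eventuallyEq (i := (E'.core.indexAt x,
    E''.core.indexAt x)) h₁ h₂ α β a b)).trans ?_
  rw [dbar_add (SmoothAt.ite (hα _ _ _ x h₁)) (SmoothAt.ite (hβ _ _ _ x h₂)), dbar_ite, dbar_ite]
  rfl

theorem tensorHiggs_zero {k : ℕ} :
    tensorHiggs (0 : EndForm E' k) (0 : EndForm E'' k) = 0 := by
  funext x a b
  change ((if a.2 = b.2 then 0 else 0) + (if a.1 = b.1 then 0 else 0) : Alt V k) = 0
  simp

theorem IsHiggsField.tensor {θ' : EndForm E' (1 + 0)} {θ'' : EndForm E'' (1 + 0)}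
    (h' : IsHiggsField E' θ') (h'' : IsHiggsField E'' θ'') :
    IsHiggsField (E'.tensor E'') (tensorHiggs θ' θ'') := by
  refine ⟨⟨h'.1.1.tensorHiggs h''.1.1, fun x a b => (h'.1.2 x _ _).ite.add (h''.1.2 x _ _).ite⟩,
    ?_, ?_⟩
  · rw [endDbar_tensorHiggs h'.1.1 h''.1.1, h'.2.1, h''.2.1, tensorHiggs_zero]
  · funext x
    refine algMat_injective ?_
    rw [algMat_endMul]
    suffices h : algMat (kronSum (θ' x) (θ'' x)) * algMat (kronSum (θ' x) (θ'' x)) = 0 from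
      h.trans algMat_zero.symm
    have e' : algMat (θ' x) * algMat (θ' x) = 0 := by
      rw [← algMat_endMul (N := 2) rfl, h'.2.2]
      exact algMat_zero
    have e'' : algMat (θ'' x) * algMat (θ'' x) = 0 := by
      rw [← algMat_endMul (N := 2) rfl, h''.2.2]
      exact algMat_zero
    -- The mixed terms of `θ ∧ θ` cancel because 1-forms anticommute.
    have hc : leftKron _ E'.n E''.n (algMat (θ' x)) * rightKron _ E'.n E''.n (algMat (θ'' x)) +
        rightKron _ E'.n E''.n (algMat (θ'' x)) * leftKron _ E'.n E''.n (algMat (θ' x)) = 0 := by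
      ext1 a b
      rw [Matrix.add_apply, leftKron_mul_rightKron_apply, rightKron_mul_leftKron_apply,
        algMat_apply, algMat_apply, toAlg_anticomm]
      exact neg_add_cancel _
    rw [algMat_kronSum, mul_add, add_mul, add_mul, ← map_mul, ← map_mul, e', e'', map_zero,
      map_zero, zero_add]
    exact (congrArg (_ + ·) (add_zero _)).trans ((add_comm _ _).trans hc)

/-! ### The tensor product connection -/

section Connection

variable (D' : Connection E') (D'' : Connection E'')

/-- The connection forms of `D' ⊗ 1 + 1 ⊗ D''`. -/
def tensorForm (i : E'.ι × E''.ι) (a b : E'.n × E''.n) : Form V X 1 :=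
  (fun x => if a.2 = b.2 then D'.form i.1 a.1 b.1 x else 0) +
    fun x => if a.1 = b.1 then D''.form i.2 a.2 b.2 x else 0

/-- The product rule for `g' ⊗ g''` gives two inhomogeneous terms, each supplied by the gauge law of
one factor. -/
theorem tensorForm_evalMat_gauge {i j : E'.ι × E''.ι} {x : X}
    (hi : x ∈ E'.core.baseSet i.1 ∧ x ∈ E''.core.baseSet i.2)
    (hj : x ∈ E'.core.baseSet j.1 ∧ x ∈ E''.core.baseSet j.2) (v : V) :
    let G := fun y => leftKron ℂ E'.n E''.n (E'.trans i.1 j.1 y) *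
      rightKron ℂ E'.n E''.n (E''.trans i.2 j.2 y)
    evalMat (kronSum (D'.mat j.1 x) (D''.mat j.2 x)) v * G x =
      G x * evalMat (kronSum (D'.mat i.1 x) (D''.mat i.2 x)) v - matDeriv G x v := by
  intro G
  have comm : ∀ (M : Matrix E'.n E'.n ℂ) (N : Matrix E''.n E''.n ℂ),
      leftKron ℂ E'.n E''.n M * rightKron ℂ E'.n E''.n N =
      rightKron ℂ E'.n E''.n N * leftKron ℂ E'.n E''.n M := fun M N =>
    commute_leftKron_rightKron fun _ _ _ _ => Commute.all _ _
  have g' := D'.evalMat_gauge hi.1 hj.1 v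
  have g'' := D''.evalMat_gauge hi.2 hj.2 v
  have hG : matDeriv G x v = _ := matDeriv_mul
    (E'.matHolAt_trans hi.1 hj.1).leftKron (E''.matHolAt_trans hi.2 hj.2).rightKron v
  rw [hG, matDeriv_leftKron, matDeriv_rightKron, evalMat_kronSum, evalMat_kronSum]
  have e' := congrArg (leftKron ℂ E'.n E''.n) g'
  have e'' := congrArg (rightKron ℂ E'.n E''.n) g''
  simp only [map_mul, map_sub] at e' e''
  simp only [G]
  rw [add_mul, ← mul_assoc, e', ← mul_assoc, ← comm, mul_assoc, e'', mul_sub, sub_mul, mul_add]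
  have c₁ := comm (evalMat (D'.mat i.1 x) v) (E''.trans i.2 j.2 x)
  rw [mul_assoc (leftKron ℂ E'.n E''.n (E'.trans i.1 j.1 x)) _ (leftKron ℂ E'.n E''.n _), ← c₁]
  simp only [mul_assoc]
  abel

/-- The connection `D' ⊗ 1 + 1 ⊗ D''`. -/
def Connection.tensor : Connection (E'.tensor E'') where
  form := tensorForm D' D''
  smooth i a b x hx := (SmoothAt.ite (D'.smooth i.1 a.1 b.1 x hx.1)).add
    (SmoothAt.ite (D''.smooth i.2 a.2 b.2 x hx.2))
  gauge i j x hx := by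
    refine (gauge_iff_evalMat (E := E'.tensor E'') (tensorForm D' D'') hx.1 hx.2).2 fun v => ?_
    have e : (E'.tensor E'').trans i j = fun y => (leftKron ℂ E'.n E''.n (E'.trans i.1 j.1 y) *
      rightKron ℂ E'.n E''.n (E''.trans i.2 j.2 y) : Matrix (E'.n × E''.n) (E'.n × E''.n) ℂ) :=
      funext fun y => tensor_trans i j y
    rw [e]
    exact tensorForm_evalMat_gauge D' D'' hx.1 hx.2 v

variable {D' D''} (h' : D'.IsCompatible) (h'' : D''.IsCompatible)

include h' h''

theorem Connection.IsCompatible.tensor : (D'.tensor D'').IsCompatible := fun i x hx a b =>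
  (h' i.1 x hx.1 a.1 b.1).ite.add (h'' i.2 x hx.2 a.2 b.2).ite

theorem Connection.curvature11_tensor :
    (D'.tensor D'').curvature11 = tensorHiggs D'.curvature11 D''.curvature11 := by
  funext x a b
  rw [Connection.curvature11_apply (h'.tensor h'')]
  refine (dbar_add (SmoothAt.ite (D'.smooth _ _ _ x (E'.core.mem_baseSet_at x)))
    (SmoothAt.ite (D''.smooth _ _ _ x (E''.core.mem_baseSet_at x)))).trans ?_
  rw [dbar_ite, dbar_ite, ← curvature11_apply h', ← curvature11_apply h'']
  rfl

end Connection

end Tensor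

/-! ### Characteristic classes of tensor products -/

section TensorClasses

variable {V : Type*} [NormedAddCommGroup V] [NormedSpace ℂ V]
  {X : Type*} [TopologicalSpace X] [ChartedSpace V X]

/-- This is why the classes are normalised by `1 / k!`: the binomial coefficients disappear from the
product formula. -/
theorem coeff_mul_choose {k j : ℕ} (h : j ≤ k) :
    coeff k * (k.choose j : ℂ) = coeff j * coeff (k - j) := by
  have e : (Complex.I / (2 * Real.pi)) ^ k =
      (Complex.I / (2 * Real.pi)) ^ j * (Complex.I / (2 * Real.pi)) ^ (k - j) := by
    rw [← pow_add, Nat.add_sub_cancel' h]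
  have hj : (j.factorial : ℂ) ≠ 0 := by exact_mod_cast j.factorial_ne_zero
  have hk : (k.factorial : ℂ) ≠ 0 := by exact_mod_cast k.factorial_ne_zero
  have hkj : ((k - j).factorial : ℂ) ≠ 0 := by exact_mod_cast (k - j).factorial_ne_zero
  have hc : (k.choose j : ℂ) * j.factorial * (k - j).factorial = k.factorial := by
    exact_mod_cast Nat.choose_mul_factorial_mul_factorial h
  have hc' : (k.factorial : ℂ)⁻¹ * k.choose j = (j.factorial : ℂ)⁻¹ * ((k - j).factorial : ℂ)⁻¹ := by
    rw [← hc]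
    have : (k.choose j : ℂ) ≠ 0 := fun h0 => hk (by rw [← hc, h0]; ring)
    field_simp
  simp only [coeff, one_div, e]
  linear_combination (Complex.I / (2 * Real.pi)) ^ j * (Complex.I / (2 * Real.pi)) ^ (k - j) * hc'

theorem formAlg_smul_mul_smul (a b : ℂ) (x y : FormAlg V) :
    (a • x) * (b • y) = (a * b) • (x * y) := by
  have h₁ : (a • x) * (b • y) = a • (x * (b • y)) := Algebra.smul_mul_assoc a x (b • y)
  have h₂ : x * (b • y) = b • (x * y) := Algebra.mul_smul_comm b x y
  rw [h₁, h₂, smul_smul]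

theorem toAlg_endTr {E : HolBundle V X} {k : ℕ} (α : EndForm E k) (x : X) :
    toAlg k (endTr α x) = (algMat (α x)).trace := toAlg_trace (α x)

theorem algMat_curvaturePow {E : HolBundle V X} (D : Connection E) (k : ℕ) (x : X) :
    algMat (D.curvaturePow k x) = algMat (D.curvature11 x) ^ k := by
  induction k with
  | zero => rw [pow_zero]; exact algMat_endOne x
  | succ k ih => rw [pow_succ, ← ih]; exact algMat_endMul _ _ _ x

theorem commute_algMat {l m n o : Type*} [Fintype l] [Fintype m] [Fintype n] [Fintype o] {k k' : ℕ}
    (h : Even k') (A : Matrix l m (Alt V k)) (B : Matrix n o (Alt V k')) (a : l) (b : m) (c : n)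
    (d : o) : Commute (algMat A a b) (algMat B c d) :=
  (toAlg_commute (B c d) (A a b) h).symm

variable [IsManifold 𝓘(ℂ, V) ω X] [FiniteDimensional ℂ V] [T2Space X] [SecondCountableTopology X]
  {E' : HolBundle.{_, _, u₁} V X} {E'' : HolBundle.{_, _, u₂} V X}

theorem ahClass_tensor {θ' : EndForm E' (1 + 0)} {θ'' : EndForm E'' (1 + 0)}
    (h' : IsHiggsField E' θ') (h'' : IsHiggsField E'' θ'') (k : ℕ)
    (e₁ : ∀ j : Fin (k + 1), (j : ℕ) + 1 + (k - j) = k + 1) (e₂ : ∀ j : Fin (k + 1), (j : ℕ) + (k - j) = k)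
    (e₃ : ∀ j : Fin (k + 1), (j : ℕ) + (k - j + 1) = k + 1) :
    ahClass k (E'.tensor E'') (tensorHiggs θ' θ'') =
      ∑ j : Fin (k + 1), (cup (e₁ j) (e₂ j) (ahClass j E' θ') (atClass (k - j) E'') +
        cup (e₃ j) (e₂ j) (atClass j E') (ahClass (k - j) E'' θ'')) := by
  obtain ⟨D', hD'⟩ := exists_isCompatible E'
  obtain ⟨D'', hD''⟩ := exists_isCompatible E''
  have hL := Connection.represents_ahClass (hD'.tensor hD'') k (by omega) (h'.tensor h'')
  have hR := Represents.sum Finset.univ fun j : Fin (k + 1) =>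
    ((Connection.represents_ahClass hD' j (by omega) h').cup (e₁ j) (e₂ j)
      (by have := e₂ j; omega) (Connection.represents_atClass hD'' (k - j))).add
    ((Connection.represents_atClass hD' j).cup (e₃ j) (e₂ j)
      (by have := e₂ j; omega) (Connection.represents_ahClass hD'' (k - j) (by omega) h''))
  refine hL.unique (Eq.subst (motive := fun φ : Form V X (k + 1 + k) => Represents φ _) ?_ hR)
  funext x
  apply toAlg_injective
  rw [Finset.sum_apply, map_sum, Pi.smul_apply, map_smul, toAlg_endTr, algMat_endMul,
    algMat_curvaturePow, Connection.curvature11_tensor hD' hD'']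
  -- The entries of the curvature of `E''` are 2-forms, hence commute with the entries of both the
  -- curvature and the Higgs field of `E'`.
  have key := trace_add_pow_mul_add (A := algMat (D'.curvature11 x)) (T := algMat (θ' x))
    (B := algMat (D''.curvature11 x)) (S := algMat (θ'' x))
    (commute_algMat (by decide) _ _) (commute_algMat (by decide) _ _) k
  rw [← algMat_kronSum, ← algMat_kronSum] at key
  refine Eq.trans ?_ (congrArg (coeff k • ·) key).symm
  rw [Finset.sum_range, Finset.smul_sum]
  refine Finset.sum_congr rfl fun j _ => ?_
  rw [← Nat.cast_smul_eq_nsmul ℂ, smul_smul, coeff_mul_choose (by omega), Pi.add_apply, map_add,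
    toAlg_wedge, toAlg_wedge]
  simp only [Pi.smul_apply, map_smul, toAlg_endTr, algMat_endMul, algMat_curvaturePow]
  rw [formAlg_smul_mul_smul, formAlg_smul_mul_smul, smul_add]

end TensorClasses

/-! ### Holomorphic matrices -/

section HolomorphicMatrices

open Filter Topology

variable {V : Type*} [NormedAddCommGroup V] [NormedSpace ℂ V]
  {X : Type*} [TopologicalSpace X] [ChartedSpace V X]
  {l m n : Type*} [Fintype l] [Fintype m] [Fintype n]

theorem MatHolAt.const (T : Matrix m n ℂ) (x : X) : MatHolAt (V := V) (fun _ => T) x :=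
  fun _ _ => contMDiffAt_const

theorem MatHolAt.det [DecidableEq n] {G : X → Matrix n n ℂ} {x : X} (hG : MatHolAt (V := V) G x) :
    ContMDiffAt 𝓘(ℂ, V) 𝓘(ℂ, ℂ) ω (fun y => (G y).det) x := by
  simp only [Matrix.det_apply']
  exact ContMDiffAt.sum fun σ _ => contMDiffAt_const.mul
    (contMDiffAt_finsetProd fun i _ => hG _ _)

theorem MatHolAt.adjugate [DecidableEq n] {G : X → Matrix n n ℂ} {x : X}
    (hG : MatHolAt (V := V) G x) : MatHolAt (V := V) (fun y => (G y).adjugate) x := fun a b => by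
  simp only [Matrix.adjugate_apply]
  refine MatHolAt.det fun c d => ?_
  simp only [Matrix.updateRow_apply]
  by_cases h : c = b
  · simpa only [if_pos h] using contMDiffAt_const
  · simpa only [if_neg h] using hG c d

/-- By Cramer's rule, the inverse is the adjugate, polynomial in the entries, divided by the
nonvanishing determinant. -/
theorem MatHolAt.inv [DecidableEq n] {G : X → Matrix n n ℂ} {x : X}
    (hG : MatHolAt (V := V) G x) (hx : (G x).det ≠ 0) : MatHolAt (V := V) (fun y => (G y)⁻¹) x :=
  fun a b => by
    have e : (fun y => (G y)⁻¹ a b) = fun y => (G y).det⁻¹ * (G y).adjugate a b := by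
      funext y
      rw [Matrix.inv_def, Ring.inverse_eq_inv', Matrix.smul_apply, smul_eq_mul]
    have hi : ContMDiffAt 𝓘(ℂ, ℂ) 𝓘(ℂ, ℂ) ω (fun z : ℂ => z⁻¹) (G x).det :=
      (contDiffAt_inv ℂ hx).contMDiffAt
    rw [e]
    exact (ContMDiffAt.comp x hi hG.det).mul (hG.adjugate a b)

end HolomorphicMatrices

/-! ### Products of holomorphic matrices with matrices of (1,0)-forms -/

section OneFormMatrices

open Filter Topology

variable {V : Type*} [NormedAddCommGroup V] [NormedSpace ℂ V]
  {X : Type*} [TopologicalSpace X] [ChartedSpace V X]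
  {l m n : Type*} [Fintype l] [Fintype m] [Fintype n]

/-- The product `T M` of a matrix of scalars and a matrix of forms. -/
def smulMat {k : ℕ} (T : Matrix l m ℂ) (M : Matrix m n (Alt V k)) : Matrix l n (Alt V k) :=
  Matrix.of fun i j => ∑ c, T i c • M c j

/-- The product `M T` of a matrix of forms and a matrix of scalars. -/
def matSmul {k : ℕ} (M : Matrix l m (Alt V k)) (T : Matrix m n ℂ) : Matrix l n (Alt V k) :=
  Matrix.of fun i j => ∑ c, T c j • M i c

/-- The matrix of differentials of the entries. -/
def diffMat (G : X → Matrix m n ℂ) (x : X) : Matrix m n (Alt V 1) :=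
  Matrix.of fun a b => (extD (ofFun fun y => G y a b) : Form V X 1) x

theorem evalMat_smulMat (T : Matrix l m ℂ) (M : Matrix m n (Alt V 1)) (v : V) :
    evalMat (smulMat T M) v = T * evalMat M v := by
  ext a b
  simp [evalMat_apply, smulMat, Matrix.mul_apply]

theorem evalMat_matSmul (M : Matrix l m (Alt V 1)) (T : Matrix m n ℂ) (v : V) :
    evalMat (matSmul M T) v = evalMat M v * T := by
  ext a b
  simp [evalMat_apply, matSmul, Matrix.mul_apply, mul_comm]

theorem evalMat_add (M N : Matrix l m (Alt V 1)) (v : V) :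
    evalMat (M + N) v = evalMat M v + evalMat N v := by
  ext a b
  simp [evalMat_apply]

theorem evalMat_sub (M N : Matrix l m (Alt V 1)) (v : V) :
    evalMat (M - N) v = evalMat M v - evalMat N v := by
  ext a b
  simp [evalMat_apply]

/-- The entries of the matrix `M` of `1`-forms are smooth and of bidegree `(1, 0)` at `x`. -/
def IsGoodAt (M : X → Matrix m n (Alt V 1)) (x : X) : Prop :=
  ∀ a b, SmoothAt (fun y => M y a b) x ∧ IsType 1 0 (M x a b)

theorem IsGoodAt.add {M N : X → Matrix m n (Alt V 1)} {x : X} (hM : IsGoodAt M x)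
    (hN : IsGoodAt N x) : IsGoodAt (fun y => M y + N y) x := fun a b =>
  ⟨(hM a b).1.add (hN a b).1, (hM a b).2.add (hN a b).2⟩

variable [IsManifold 𝓘(ℂ, V) ω X]

theorem IsGoodAt.sub {M N : X → Matrix m n (Alt V 1)} {x : X} (hM : IsGoodAt M x)
    (hN : IsGoodAt N x) : IsGoodAt (fun y => M y - N y) x := fun a b => by
  refine ⟨SmoothAt.congr ((hM a b).1.add ((hN a b).1.const_smul (-1))) (Eventually.of_forall
    fun y => ?_), ?_⟩
  · simp [sub_eq_add_neg]
  · have := (hM a b).2.add ((hN a b).2.const_smul (-1))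
    simpa [sub_eq_add_neg] using this

theorem IsGoodAt.smulMat {G : X → Matrix l m ℂ} {M : X → Matrix m n (Alt V 1)} {x : X}
    (hG : MatHolAt (V := V) G x) (hM : IsGoodAt M x) :
    IsGoodAt (fun y => smulMat (G y) (M y)) x := fun a b =>
  ⟨SmoothAt.sum _ fun c _ => SmoothAt.funSmul (funSmoothAt_of_holomorphic (hG a c)) (hM c b).1,
    IsType.sum _ fun c _ => (hM c b).2.const_smul _⟩

theorem IsGoodAt.matSmul {G : X → Matrix m n ℂ} {M : X → Matrix l m (Alt V 1)} {x : X}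
    (hM : IsGoodAt M x) (hG : MatHolAt (V := V) G x) :
    IsGoodAt (fun y => matSmul (M y) (G y)) x := fun a b =>
  ⟨SmoothAt.sum _ fun c _ => SmoothAt.funSmul (funSmoothAt_of_holomorphic (hG c b)) (hM a c).1,
    IsType.sum _ fun c _ => (hM a c).2.const_smul _⟩

theorem IsGoodAt.diffMat {G : X → Matrix m n ℂ} {x : X} (hG : MatHolAt (V := V) G x) :
    IsGoodAt (diffMat (V := V) G) x := fun a b =>
  ⟨SmoothAt.extD_ofFun (eventually_contMDiffAt (hG a b)), isType_extD_ofFun (hG a b)⟩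

end OneFormMatrices

/-! ### Algebra of parallel homomorphisms -/

section ParallelAlgebra

variable {n' n n'' : Type*} [Fintype n'] [Fintype n] [Fintype n''] [DecidableEq n']
  [DecidableEq n] [DecidableEq n'']

/-- A connection matrix for which `S` and `P` are parallel. -/
theorem exists_matrix_parallel {S dS : Matrix n n' ℂ} {P dP : Matrix n'' n ℂ} {r : Matrix n' n ℂ}
    {σ : Matrix n n'' ℂ} (A' : Matrix n' n' ℂ) (A'' : Matrix n'' n'' ℂ) (hr : r * S = 1)
    (hσ : P * σ = 1) (hPS : P * S = 0) (hd : dP * S + P * dS = 0) :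
    S * A' = ((S * A' - dS) * r + σ * (A'' * P + dP - P * (S * A' - dS) * r)) * S + dS ∧
      P * ((S * A' - dS) * r + σ * (A'' * P + dP - P * (S * A' - dS) * r)) = A'' * P + dP := by
  have hd' : dP * S = -(P * dS) := eq_neg_of_add_eq_zero_left hd
  constructor
  · have e : (A'' * P + dP - P * (S * A' - dS) * r) * S = 0 := by
      rw [Matrix.sub_mul, Matrix.add_mul, Matrix.mul_assoc A'', hPS, Matrix.mul_zero,
        Matrix.mul_assoc _ r S, hr, Matrix.mul_one, Matrix.mul_sub, ← Matrix.mul_assoc P S, hPS,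
        Matrix.zero_mul, hd']
      abel
    rw [Matrix.add_mul, Matrix.mul_assoc σ, e, Matrix.mul_zero, Matrix.mul_assoc _ r S, hr,
      Matrix.mul_one]
    abel
  · rw [Matrix.mul_add, ← Matrix.mul_assoc P σ, hσ, Matrix.one_mul, ← Matrix.mul_assoc P _ r]
    abel

/-- Being parallel is preserved by a change of frames of the source. -/
theorem matrix_parallel_source {S dS : Matrix n n' ℂ} {A B' h dh : Matrix n' n' ℂ}
    {C : Matrix n n ℂ} (hp : S * A = C * S + dS) (hg : A * h = h * B' - dh) :
    (S * h) * B' = C * (S * h) + (dS * h + S * dh) := by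
  have e : h * B' = A * h + dh := by rw [hg]; abel
  rw [Matrix.mul_assoc, e, Matrix.mul_add, ← Matrix.mul_assoc S A, hp, Matrix.add_mul,
    Matrix.mul_assoc C]
  abel

/-- Being parallel is preserved by a change of frames of the target. -/
theorem matrix_parallel_target {S dS : Matrix n n' ℂ} {A' : Matrix n' n' ℂ}
    {C D g dg : Matrix n n ℂ} (hp : S * A' = C * S + dS) (hg : D * g = g * C - dg) :
    (g * S) * A' = D * (g * S) + (dg * S + g * dS) := by
  rw [Matrix.mul_assoc, hp, ← Matrix.mul_assoc D, hg, Matrix.sub_mul, Matrix.mul_add,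
    Matrix.mul_assoc g C]
  abel

theorem exists_splitting {S : (n' → ℂ) →ₗ[ℂ] (n → ℂ)} {P : (n → ℂ) →ₗ[ℂ] (n'' → ℂ)}
    (hS : Function.Injective S) (hSP : LinearMap.range S = LinearMap.ker P)
    (hP : Function.Surjective P) :
    ∃ (r : Matrix n' n ℂ) (σ : Matrix n n'' ℂ), r * LinearMap.toMatrix' S = 1 ∧
      LinearMap.toMatrix' P * σ = 1 ∧
      LinearMap.toMatrix' S * r + σ * LinearMap.toMatrix' P = 1 := by
  obtain ⟨r₀, hr₀⟩ := LinearMap.exists_leftInverse_of_injective S (LinearMap.ker_eq_bot.2 hS)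
  obtain ⟨σ, hσ⟩ := LinearMap.exists_rightInverse_of_surjective P (LinearMap.range_eq_top.2 hP)
  have hPS : ∀ v, P (S v) = 0 := fun v => by
    have : S v ∈ LinearMap.ker P := hSP ▸ LinearMap.mem_range_self S v
    exact this
  have hr₀' : ∀ v, r₀ (S v) = v := fun v => congrArg (fun L => L v) hr₀
  have hσ' : ∀ v, P (σ v) = v := fun v => congrArg (fun L => L v) hσ
  -- An arbitrary left inverse `r₀` of `S` is precomposed with the projection `1 - σ P` onto the
  -- image of `S`, so that `S r + σ P = 1` holds as well.
  refine ⟨LinearMap.toMatrix' (r₀ ∘ₗ (LinearMap.id - σ ∘ₗ P)), LinearMap.toMatrix' σ, ?_, ?_, ?_⟩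
  · rw [← LinearMap.toMatrix'_comp, ← LinearMap.toMatrix'_id]
    congr 1
    refine LinearMap.ext fun v => ?_
    simp [hPS, hr₀']
  · rw [← LinearMap.toMatrix'_comp, hσ, LinearMap.toMatrix'_id]
  · rw [← LinearMap.toMatrix'_comp, ← LinearMap.toMatrix'_comp, ← map_add, ← LinearMap.toMatrix'_id]
    congr 1
    refine LinearMap.ext fun v => ?_
    obtain ⟨w, hw⟩ : v - σ (P v) ∈ LinearMap.range S := by
      rw [hSP, LinearMap.mem_ker, map_sub, hσ', sub_self]
    simp [← hw, hr₀', -map_sub]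
    rw [hw]
    abel

/-- Insert `1 = S r + σ P` after `M`. Intertwining and cyclicity for scalar matrices turn the two
terms into `tr(r S M') = tr M'` and `tr(M'' P σ) = tr M''`. -/
theorem trace_eq_add_of_exact {V : Type*} [NormedAddCommGroup V] [NormedSpace ℂ V]
    {S : Matrix n n' ℂ} {P : Matrix n'' n ℂ}
    {r : Matrix n' n ℂ} {σ : Matrix n n'' ℂ} (hr : r * S = 1) (hσ : P * σ = 1)
    (hS : S * r + σ * P = 1) {M' : Matrix n' n' (FormAlg V)} {M : Matrix n n (FormAlg V)}
    {M'' : Matrix n'' n'' (FormAlg V)} (h₁ : scalMat V S * M' = M * scalMat V S)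
    (h₂ : scalMat V P * M = M'' * scalMat V P) : M.trace = M'.trace + M''.trace := by
  have e₁ : (M * (scalMat V S * scalMat V r)).trace = M'.trace := by
    rw [← Matrix.mul_assoc, ← h₁, trace_mul_scalMat, ← Matrix.mul_assoc, ← scalMat_mul, hr,
      scalMat_one, Matrix.one_mul]
  have e₂ : (M * (scalMat V σ * scalMat V P)).trace = M''.trace := by
    rw [← Matrix.mul_assoc, trace_mul_scalMat, ← Matrix.mul_assoc, h₂, Matrix.mul_assoc,
      ← scalMat_mul, hσ, scalMat_one, Matrix.mul_one]
  have e : scalMat V S * scalMat V r + scalMat V σ * scalMat V P = 1 := by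
    rw [← scalMat_mul, ← scalMat_mul, ← scalMat_one, ← hS]
    ext1 i j
    exact (map_add (algebraMap ℂ (FormAlg V)) _ _).symm
  rw [← e₁, ← e₂, ← Matrix.trace_add, ← Matrix.mul_add, e, Matrix.mul_one]

end ParallelAlgebra

/-! ### Parallel homomorphisms -/

section Parallel

open Filter Topology

variable {V : Type*} [NormedAddCommGroup V] [NormedSpace ℂ V]
  {X : Type*} [TopologicalSpace X] [ChartedSpace V X]
  {E' : HolBundle.{_, _, u₁} V X} {E : HolBundle.{_, _, u₂} V X} {E'' : HolBundle.{_, _, u₃} V X}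

namespace HolHom

variable (S : HolHom E' E)

/-- The matrix of a bundle homomorphism in local frames. -/
def mat (i' : E'.ι) (i : E.ι) (x : X) : Matrix E.n E'.n ℂ :=
  E.trans (E.core.indexAt x) i x * LinearMap.toMatrix' (S.map x) *
    E'.trans i' (E'.core.indexAt x) x

theorem matHolAt_mat {i' : E'.ι} {i : E.ι} {x : X} (hi' : x ∈ E'.core.baseSet i')
    (hi : x ∈ E.core.baseSet i) : MatHolAt (V := V) (S.mat i' i) x := fun a b =>
  (S.holomorphic i' i a b).contMDiffAt
    (((E'.core.isOpen_baseSet i').inter (E.core.isOpen_baseSet i)).mem_nhds ⟨hi', hi⟩)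

theorem mat_trans {i' j' : E'.ι} {i j : E.ι} {x : X} (hi' : x ∈ E'.core.baseSet i')
    (hj' : x ∈ E'.core.baseSet j') (hi : x ∈ E.core.baseSet i) (hj : x ∈ E.core.baseSet j) :
    S.mat j' j x = E.trans i j x * (S.mat i' i x * E'.trans j' i' x) := by
  have hx := E.core.mem_baseSet_at x
  have hx' := E'.core.mem_baseSet_at x
  rw [mat, mat, ← E.trans_comp _ i j x ⟨⟨hx, hi⟩, hj⟩, ← E'.trans_comp j' i' _ x ⟨⟨hj', hi'⟩, hx'⟩]
  simp only [Matrix.mul_assoc]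

theorem mat_indexAt (x : X) :
    S.mat (E'.core.indexAt x) (E.core.indexAt x) x = LinearMap.toMatrix' (S.map x) := by
  rw [mat, E.trans_self _ x (E.core.mem_baseSet_at x), E'.trans_self _ x (E'.core.mem_baseSet_at x),
    Matrix.one_mul, Matrix.mul_one]

theorem mat_mul_mat {P : HolHom E E''} (h : IsShortExact S P) {i' : E'.ι} {i : E.ι} {i'' : E''.ι}
    {x : X} (hi : x ∈ E.core.baseSet i) : P.mat i i'' x * S.mat i' i x = 0 := by
  have e : LinearMap.toMatrix' (P.map x) * LinearMap.toMatrix' (S.map x) = 0 := by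
    rw [← LinearMap.toMatrix'_comp, LinearMap.range_le_ker_iff.1 (h x).2.1.le, map_zero]
  have e' := E.trans_mul_trans (E.core.mem_baseSet_at x) hi
  calc _ = E''.trans (E''.core.indexAt x) i'' x * (LinearMap.toMatrix' (P.map x) *
        ((E.trans i (E.core.indexAt x) x * E.trans (E.core.indexAt x) i x) *
          LinearMap.toMatrix' (S.map x))) * E'.trans i' (E'.core.indexAt x) x := by
        simp only [mat, Matrix.mul_assoc]
    _ = 0 := by rw [e', Matrix.one_mul, e, Matrix.mul_zero, Matrix.zero_mul]

end HolHom

variable [IsManifold 𝓘(ℂ, V) ω X]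

/-- The values at `v` of the forms of a connection near `x` in the frames at `x`. -/
def GaugeAt (E : HolBundle V X) (x : X) (v : V) (α : E.ι → Matrix E.n E.n ℂ) : Prop :=
  ∀ i j, x ∈ E.core.baseSet i → x ∈ E.core.baseSet j →
    α j * E.trans i j x = E.trans i j x * α i - matDeriv (E.trans i j) x v

/-- A homomorphism is parallel with respect to connection matrices at `x`, in the given frames. -/
def ParallelAt (S : HolHom E' E) (x : X) (v : V) (α' : E'.ι → Matrix E'.n E'.n ℂ)
    (α : E.ι → Matrix E.n E.n ℂ) (i' : E'.ι) (i : E.ι) : Prop :=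
  S.mat i' i x * α' i' = α i * S.mat i' i x + matDeriv (S.mat i' i) x v

/-- Being parallel does not depend on the frames, so it suffices to construct a connection in one
frame and check the condition there. -/
theorem ParallelAt.change_frame {S : HolHom E' E} {x : X} {v : V}
    {α' : E'.ι → Matrix E'.n E'.n ℂ} {α : E.ι → Matrix E.n E.n ℂ} {i' j' : E'.ι} {i j : E.ι}
    (h : ParallelAt S x v α' α i' i) (hα' : GaugeAt E' x v α') (hα : GaugeAt E x v α)
    (hi' : x ∈ E'.core.baseSet i') (hj' : x ∈ E'.core.baseSet j')
    (hi : x ∈ E.core.baseSet i) (hj : x ∈ E.core.baseSet j) : ParallelAt S x v α' α j' j := by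
  have e : S.mat j' j =ᶠ[𝓝 x] fun y => E.trans i j y * (S.mat i' i y * E'.trans j' i' y) := by
    filter_upwards [E'.eventually_mem_baseSet hi', E'.eventually_mem_baseSet hj',
      E.eventually_mem_baseSet hi, E.eventually_mem_baseSet hj] with y h₁ h₂ h₃ h₄
    exact S.mat_trans h₁ h₂ h₃ h₄
  rw [ParallelAt, matDeriv_congr e, matDeriv_mul (E.matHolAt_trans hi hj)
    ((S.matHolAt_mat hi' hi).mul (E'.matHolAt_trans hj' hi')),
    matDeriv_mul (S.matHolAt_mat hi' hi) (E'.matHolAt_trans hj' hi'), e.self_of_nhds]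
  exact matrix_parallel_target (matrix_parallel_source h (hα' j' i' hj' hi')) (hα i j hi hj)

theorem Connection.gaugeAt (D : Connection E) (x : X) (v : V) :
    GaugeAt E x v fun i => evalMat (D.mat i x) v :=
  fun _ _ hi hj => D.evalMat_gauge hi hj v

/-- The bundle homomorphism `S` is parallel for the connections. -/
def IsParallel (S : HolHom E' E) (D' : Connection E') (D : Connection E) : Prop :=
  ∀ (x : X) (v : V) (i' : E'.ι) (i : E.ι), x ∈ E'.core.baseSet i' → x ∈ E.core.baseSet i →
    ParallelAt S x v (fun i' => evalMat (D'.mat i' x) v) (fun i => evalMat (D.mat i x) v) i' i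

/-- The curvatures of two connections are intertwined by parallel homomorphisms. -/
theorem IsParallel.curvature11 {S : HolHom E' E} {D' : Connection E'} {D : Connection E}
    (h : IsParallel S D' D) (hD' : D'.IsCompatible) (hD : D.IsCompatible) (x : X) :
    scalMat V (LinearMap.toMatrix' (S.map x)) * algMat (D'.curvature11 x) =
      algMat (D.curvature11 x) * scalMat V (LinearMap.toMatrix' (S.map x)) := by
  have hx := E.core.mem_baseSet_at x
  have hx' := E'.core.mem_baseSet_at x
  obtain ⟨i, hi⟩ : ∃ i, i = E.core.indexAt x := ⟨_, rfl⟩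
  obtain ⟨i', hi'⟩ : ∃ i', i' = E'.core.indexAt x := ⟨_, rfl⟩
  have hm := S.mat_indexAt x
  have c := D.curvature11_apply hD x
  have c' := D'.curvature11_apply hD' x
  rw [← hi] at hx c
  rw [← hi'] at hx' c'
  rw [← hi, ← hi'] at hm
  have hS := S.matHolAt_mat hx' hx
  -- Parallelism reads `S A' = A S + dS` on a neighbourhood. Applying `∂̄` removes `dS` and passes
  -- through the holomorphic matrix `S`, leaving `S ∂̄A' = (∂̄A) S`.
  have key : ∀ a b, (fun y => ∑ c, S.mat i' i y a c • D'.form i' c b y) =ᶠ[𝓝 x]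
      (fun y => ∑ c, S.mat i' i y c b • D.form i a c y) +
        extD (ofFun fun y => S.mat i' i y a b) := fun a b => by
    filter_upwards [E.eventually_mem_baseSet hx, E'.eventually_mem_baseSet hx'] with y hy hy'
    have e : smulMat (S.mat i' i y) (D'.mat i' y) =
        matSmul (D.mat i y) (S.mat i' i y) + diffMat (S.mat i' i) y := evalMat_ext fun v => by
      rw [evalMat_smulMat, evalMat_add, evalMat_matSmul]
      refine (h y v i' i hy' hy).trans (congrArg
        (evalMat (D.mat i y) v * S.mat i' i y + ·) (evalMat_extD (S.matHolAt_mat hy' hy) v).symm)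
    exact congrFun (congrFun e a) b
  have hs₁ : ∀ a b c, SmoothAt (fun y => S.mat i' i y a c • D'.form i' c b y) x := fun a b c =>
    SmoothAt.funSmul (funSmoothAt_of_holomorphic (hS a c)) (D'.smooth i' c b x hx')
  have hs₂ : ∀ a b c, SmoothAt (fun y => S.mat i' i y c b • D.form i a c y) x := fun a b c =>
    SmoothAt.funSmul (funSmoothAt_of_holomorphic (hS c b)) (D.smooth i a c x hx)
  rw [← algMat_smul_left, ← algMat_smul_right, ← hm]
  congr 1
  ext1 a b
  have he : ∀ᶠ y in 𝓝 x, ContMDiffAt 𝓘(ℂ, V) 𝓘(ℂ, ℂ) ω (fun y => S.mat i' i y a b) y :=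
    eventually_contMDiffAt (hS a b)
  have hd := dbar_congr (key a b)
  rw [dbar_add (SmoothAt.sum _ fun c _ => hs₂ a b c) (SmoothAt.extD_ofFun he), dbar_extD_ofFun he,
    add_zero, dbar_sum _ fun c _ => hs₁ a b c, dbar_sum _ fun c _ => hs₂ a b c] at hd
  simp only [dbar_funSmul (hS _ _) (D'.smooth i' _ _ x hx'),
    dbar_funSmul (hS _ _) (D.smooth i _ _ x hx)] at hd
  simpa only [Matrix.of_apply, c, c'] using hd

theorem intertwine_pow_mul {m n : Type*} [Fintype m] [Fintype n] [DecidableEq m] [DecidableEq n]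
    {R : Type*} [Ring R] {S : Matrix m n R} {M' T' : Matrix n n R} {M T : Matrix m m R}
    (hM : S * M' = M * S) (hT : S * T' = T * S) (k : ℕ) :
    S * (M' ^ k * T') = (M ^ k * T) * S := by
  have h : S * M' ^ k = M ^ k * S := by
    induction k with
    | zero => rw [pow_zero, pow_zero, Matrix.mul_one, Matrix.one_mul]
    | succ k ih =>
      rw [pow_succ, pow_succ, ← Matrix.mul_assoc, ih, Matrix.mul_assoc, hM, Matrix.mul_assoc]
  rw [← Matrix.mul_assoc, h, Matrix.mul_assoc, hT, Matrix.mul_assoc]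

theorem IsHiggsHom.algMat {S : HolHom E' E} {θ' : EndForm E' (1 + 0)} {θ : EndForm E (1 + 0)}
    (h : IsHiggsHom S θ' θ) (x : X) :
    scalMat V (LinearMap.toMatrix' (S.map x)) * algMat (θ' x) =
      algMat (θ x) * scalMat V (LinearMap.toMatrix' (S.map x)) := by
  rw [← algMat_smul_left, ← algMat_smul_right]
  congr 1
  ext1 a b
  exact h x a b

/-- The connection forms, in the frame `j`, of the connection with matrix `L` in the frame `i`. -/
def transportForm (E : HolBundle V X) (i : E.ι) (L : X → Matrix E.n E.n (Alt V 1)) (j : E.ι)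
    (x : X) : Matrix E.n E.n (Alt V 1) :=
  smulMat (E.trans i j x) (matSmul (L x) (E.trans j i x)) +
    Matrix.of fun a b => frameForm E i j a b x

theorem isGoodAt_transportForm {i j : E.ι} {L : X → Matrix E.n E.n (Alt V 1)} {x : X}
    (hi : x ∈ E.core.baseSet i) (hj : x ∈ E.core.baseSet j) (hL : IsGoodAt L x) :
    IsGoodAt (transportForm E i L j) x :=
  ((hL.matSmul (E.matHolAt_trans hj hi)).smulMat (E.matHolAt_trans hi hj)).add fun a b =>
    ⟨smoothAt_frameForm hi hj a b, isType_frameForm hi hj a b⟩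

/-- The conjugate of `L` transforms homogeneously, and the flat connection of the frame `i` supplies
the inhomogeneous term. -/
theorem gaugeAt_transportForm {i : E.ι} (L : X → Matrix E.n E.n (Alt V 1)) {x : X}
    (hi : x ∈ E.core.baseSet i) (v : V) :
    GaugeAt E x v fun j => evalMat (transportForm E i L j x) v := fun j k hj hk => by
  simp only [transportForm, evalMat_add, evalMat_smulMat, evalMat_matSmul]
  rw [Matrix.add_mul, Matrix.mul_add, frameForm_gauge hi hj hk, ← add_sub_assoc]
  congr 2
  rw [Matrix.mul_assoc, Matrix.mul_assoc, E.trans_comp j k i x ⟨⟨hj, hk⟩, hi⟩,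
    ← E.trans_comp i j k x ⟨⟨hi, hj⟩, hk⟩, Matrix.mul_assoc]

theorem evalMat_transportForm_self {i : E.ι} (L : X → Matrix E.n E.n (Alt V 1)) {x : X}
    (hi : x ∈ E.core.baseSet i) (v : V) :
    evalMat (transportForm E i L i x) v = evalMat (L x) v := by
  have e : E.trans i i =ᶠ[𝓝 x] fun _ => 1 := by
    filter_upwards [E.eventually_mem_baseSet hi] with y hy
    exact E.trans_self i y hy
  rw [transportForm, evalMat_add, evalMat_smulMat, evalMat_matSmul, evalMat_frameForm hi hi,
    matDeriv_congr e, matDeriv_const, E.trans_self i x hi]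
  simp

end Parallel

/-! ### Short exact sequences -/

section ShortExact

open Filter Topology

variable {V : Type*} [NormedAddCommGroup V] [NormedSpace ℂ V]
  {X : Type*} [TopologicalSpace X] [ChartedSpace V X]
  {E' : HolBundle.{_, _, u₁} V X} {E : HolBundle.{_, _, u₂} V X} {E'' : HolBundle.{_, _, u₃} V X}
  [IsManifold 𝓘(ℂ, V) ω X]

/-- Near each point there is a connection on the middle term for which both maps of a short exact
sequence are parallel. -/
theorem exists_local_parallel {S : HolHom E' E} {P : HolHom E E''} (h : IsShortExact S P)
    {D' : Connection E'} {D'' : Connection E''} (hD' : D'.IsCompatible) (hD'' : D''.IsCompatible)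
    (x₀ : X) :
    ∃ N : Set X, IsOpen N ∧ x₀ ∈ N ∧ ∃ B : E.ι → X → Matrix E.n E.n (Alt V 1), ∀ y ∈ N,
      (∀ j, y ∈ E.core.baseSet j → IsGoodAt (B j) y) ∧ ∀ v : V,
      GaugeAt E y v (fun j => evalMat (B j y) v) ∧
      (∀ i' i, y ∈ E'.core.baseSet i' → y ∈ E.core.baseSet i →
        ParallelAt S y v (fun i' => evalMat (D'.mat i' y) v) (fun j => evalMat (B j y) v) i' i) ∧
      ∀ i i'', y ∈ E.core.baseSet i → y ∈ E''.core.baseSet i'' →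
        ParallelAt P y v (fun j => evalMat (B j y) v) (fun i'' => evalMat (D''.mat i'' y) v) i i'' := by
  obtain ⟨r₀, σ₀, hr₀, hσ₀, -⟩ := exists_splitting (h x₀).1 (h x₀).2.1 (h x₀).2.2
  have hx' := E'.core.mem_baseSet_at x₀
  have hx := E.core.mem_baseSet_at x₀
  have hx'' := E''.core.mem_baseSet_at x₀
  rw [← S.mat_indexAt] at hr₀
  rw [← P.mat_indexAt] at hσ₀
  generalize E'.core.indexAt x₀ = i' at *
  generalize E.core.indexAt x₀ = i at *
  generalize E''.core.indexAt x₀ = i'' at *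
  have hS := S.matHolAt_mat hx' hx
  have hP := P.matHolAt_mat hx hx''
  -- With constant matrices `r₀` and `σ₀`, the products `r₀ S` and `P σ₀` are the identity at `x₀`,
  -- hence invertible nearby.
  have dS : ∀ᶠ y in 𝓝 x₀, (r₀ * S.mat i' i y).det ≠ 0 :=
    ((MatHolAt.const (V := V) r₀ x₀).mul hS).det.continuousAt.eventually_ne (by rw [hr₀]; simp)
  have dP : ∀ᶠ y in 𝓝 x₀, (P.mat i i'' y * σ₀).det ≠ 0 :=
    (hP.mul (MatHolAt.const (V := V) σ₀ x₀)).det.continuousAt.eventually_ne (by rw [hσ₀]; simp)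
  obtain ⟨N, hN, hNo, hxN⟩ := eventually_nhds_iff.1 ((((E'.eventually_mem_baseSet hx').and
    (E.eventually_mem_baseSet hx)).and (E''.eventually_mem_baseSet hx'')).and (dS.and dP))
  -- Renormalising gives holomorphic one-sided inverses, `r S = 1` and `P σ = 1`, on all of `N`.
  let r : X → Matrix E'.n E.n ℂ := fun y => (r₀ * S.mat i' i y)⁻¹ * r₀
  let σ : X → Matrix E.n E''.n ℂ := fun y => σ₀ * (P.mat i i'' y * σ₀)⁻¹
  -- A connection matrix `L` in the frame `i` must satisfy `L S = S A' - dS = u` and `P L = A'' P +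
  -- dP = w`. The choice `L = u r + σ (w - P u r)` solves both equations, and is smooth of type
  -- (1,0) because `r` and `σ` are holomorphic.
  let u : X → Matrix E.n E'.n (Alt V 1) := fun y =>
    smulMat (S.mat i' i y) (D'.mat i' y) - diffMat (S.mat i' i) y
  let w : X → Matrix E''.n E.n (Alt V 1) := fun y =>
    matSmul (D''.mat i'' y) (P.mat i i'' y) + diffMat (P.mat i i'') y
  let L : X → Matrix E.n E.n (Alt V 1) := fun y => matSmul (u y) (r y) +
    smulMat (σ y) (w y - matSmul (smulMat (P.mat i i'' y) (u y)) (r y))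
  refine ⟨N, hNo, hxN, transportForm E i L, fun y hy => ?_⟩
  obtain ⟨⟨⟨hy', hyi⟩, hy''⟩, hdS, hdP⟩ := hN y hy
  have hSy := S.matHolAt_mat hy' hyi
  have hPy := P.matHolAt_mat hyi hy''
  have hry : MatHolAt (V := V) r y :=
    (((MatHolAt.const r₀ y).mul hSy).inv hdS).mul (MatHolAt.const r₀ y)
  have hσy : MatHolAt (V := V) σ y :=
    (MatHolAt.const σ₀ y).mul ((hPy.mul (MatHolAt.const σ₀ y)).inv hdP)
  have hu : IsGoodAt u y := IsGoodAt.sub (IsGoodAt.smulMat hSy fun a b =>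
    ⟨D'.smooth i' a b y hy', hD' i' y hy' a b⟩) (IsGoodAt.diffMat hSy)
  have hw : IsGoodAt w y := IsGoodAt.add (IsGoodAt.matSmul (fun a b =>
    ⟨D''.smooth i'' a b y hy'', hD'' i'' y hy'' a b⟩) hPy) (IsGoodAt.diffMat hPy)
  have hL : IsGoodAt L y :=
    (hu.matSmul hry).add ((hw.sub ((hu.smulMat hPy).matSmul hry)).smulMat hσy)
  refine ⟨fun j hj => isGoodAt_transportForm hyi hj hL, fun v => ?_⟩
  have hg := gaugeAt_transportForm L hyi v
  -- Differentiating `P S = 0` yields the relation that makes the two conditions on `L` compatible.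
  have hPS : (fun z => P.mat i i'' z * S.mat i' i z) =ᶠ[𝓝 y] fun _ => 0 :=
    (E.eventually_mem_baseSet hyi).mono fun z hz => S.mat_mul_mat h hz
  have hd := matDeriv_congr hPS v
  rw [matDeriv_mul hPy hSy, matDeriv_const] at hd
  have hr : r y * S.mat i' i y = 1 := by
    rw [Matrix.mul_assoc]
    exact Matrix.nonsing_inv_mul _ (isUnit_iff_ne_zero.2 hdS)
  have hσ : P.mat i i'' y * σ y = 1 := by
    rw [← Matrix.mul_assoc]
    exact Matrix.mul_nonsing_inv _ (isUnit_iff_ne_zero.2 hdP)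
  have key := exists_matrix_parallel (evalMat (D'.mat i' y) v) (evalMat (D''.mat i'' y) v) hr hσ
    hPS.self_of_nhds hd
  have eu : evalMat (u y) v =
      S.mat i' i y * evalMat (D'.mat i' y) v - matDeriv (S.mat i' i) y v := by
    rw [evalMat_sub, evalMat_smulMat]
    exact congrArg (_ - ·) (evalMat_extD hSy v)
  have ew : evalMat (w y) v =
      evalMat (D''.mat i'' y) v * P.mat i i'' y + matDeriv (P.mat i i'') y v := by
    rw [evalMat_add, evalMat_matSmul]
    exact congrArg (_ + ·) (evalMat_extD hPy v)
  have eL := evalMat_transportForm_self L hyi v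
  have eL' : evalMat (L y) v = evalMat (u y) v * r y +
      σ y * (evalMat (w y) v - P.mat i i'' y * evalMat (u y) v * r y) := by
    rw [← evalMat_smulMat (P.mat i i'' y), ← evalMat_matSmul (smulMat _ _), ← evalMat_sub,
      ← evalMat_smulMat (σ y), ← evalMat_matSmul (u y), ← evalMat_add]
  rw [eL', eu, ew] at eL
  rw [← eL] at key
  exact ⟨hg, fun j' j hj' hj => ParallelAt.change_frame (i' := i') (i := i) key.1
    (D'.gaugeAt y v) hg hy' hj' hyi hj, fun j j'' hj hj'' => ParallelAt.change_frame (i' := i)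
      (i := i'') key.2 hg (D''.gaugeAt y v) hyi hj hy'' hj''⟩

variable [FiniteDimensional ℂ V] [T2Space X] [SecondCountableTopology X]

/-- The middle term of a short exact sequence has a compatible connection for which both maps are
parallel. -/
theorem exists_parallel {S : HolHom E' E} {P : HolHom E E''} (h : IsShortExact S P)
    {D' : Connection E'} {D'' : Connection E''} (hD' : D'.IsCompatible) (hD'' : D''.IsCompatible) :
    ∃ D : Connection E, D.IsCompatible ∧ IsParallel S D' D ∧ IsParallel P D D'' := by
  choose N hNo hxN B hB using exists_local_parallel h hD' hD''
  obtain ⟨ρ, hρ⟩ := exists_partitionOfUnity (V := V) N hNo fun x => ⟨x, hxN x⟩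
  let A : E.ι → E.n → E.n → Form V X 1 := fun j a b => glueForm ρ fun x₀ y => B x₀ j y a b
  have hA : ∀ j x v, evalMat (Matrix.of fun a b => A j a b x) v =
      ∑ x₀ ∈ ρ.finsupport x, (ρ x₀ x : ℂ) • evalMat (B x₀ j x) v :=
    fun j x v => evalMat_glueForm ρ (fun x₀ a b y => B x₀ j y a b) x v
  have hs : ∀ j a b, ∀ x ∈ E.core.baseSet j, SmoothAt (A j a b) x := fun j a b x hx =>
    smoothAt_glueForm ρ hρ fun x₀ hx₀ => ((hB x₀ x hx₀).1 j hx a b).1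
  have ht : ∀ j, ∀ x ∈ E.core.baseSet j, ∀ a b, IsType 1 0 (A j a b x) := fun j x hx a b =>
    isType_glueForm ρ hρ fun x₀ hx₀ => ((hB x₀ x hx₀).1 j hx a b).2
  -- Spreads the terms without connection forms over the partition of unity. The gauge law and both
  -- parallelism conditions are affine in the connection on the middle bundle, so they hold for the
  -- weighted sum as soon as they hold for each local solution.
  have hone : ∀ {m n : Type} [Fintype m] [Fintype n] (M : Matrix m n ℂ) (x : X),
      M = ∑ x₀ ∈ ρ.finsupport x, (ρ x₀ x : ℂ) • M := fun M x => by
    rw [← Finset.sum_smul, sum_partition, one_smul]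
  have hmem : ∀ {x x₀ : X}, x₀ ∈ ρ.finsupport x → x ∈ N x₀ := fun hx₀ =>
    mem_of_mem_finsupport hρ hx₀
  have gauge : ∀ i j, ∀ x ∈ E.core.baseSet i ∩ E.core.baseSet j, ∀ a b,
      ∑ c, E.trans i j x c b • A j a c x =
        ∑ c, E.trans i j x a c • A i c b x - extD (ofFun fun y => E.trans i j y a b) x := by
    refine fun i j x hx => (gauge_iff_evalMat A hx.1 hx.2).2 fun v => ?_
    rw [hA, hA, Matrix.sum_mul, Matrix.mul_sum, hone (matDeriv _ x v) x, ← Finset.sum_sub_distrib]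
    refine Finset.sum_congr rfl fun x₀ hx₀ => ?_
    rw [Matrix.smul_mul, Matrix.mul_smul, ← smul_sub,
      ← ((hB x₀ x (hmem hx₀)).2 v).1 i j hx.1 hx.2]
  refine ⟨⟨A, hs, gauge⟩, ht, fun x v i' i hi' hi => ?_, fun x v i i'' hi hi'' => ?_⟩
  · change S.mat i' i x * evalMat (D'.mat i' x) v =
      evalMat (Matrix.of fun a b => A i a b x) v * S.mat i' i x + matDeriv (S.mat i' i) x v
    rw [hA, Matrix.sum_mul, hone (matDeriv _ x v) x, ← Finset.sum_add_distrib,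
      hone (S.mat i' i x * _) x]
    refine Finset.sum_congr rfl fun x₀ hx₀ => ?_
    rw [Matrix.smul_mul, ← smul_add]
    exact congrArg _ (((hB x₀ x (hmem hx₀)).2 v).2.1 i' i hi' hi)
  · change P.mat i i'' x * evalMat (Matrix.of fun a b => A i a b x) v =
      evalMat (D''.mat i'' x) v * P.mat i i'' x + matDeriv (P.mat i i'') x v
    rw [hA, Matrix.mul_sum, hone (_ + _) x]
    refine Finset.sum_congr rfl fun x₀ hx₀ => ?_
    rw [Matrix.mul_smul]
    exact congrArg _ (((hB x₀ x (hmem hx₀)).2 v).2.2 i i'' hi hi'')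

/-- For a connection with both maps parallel the representing forms are already additive, without
any coboundary. The splitting in the proof is chosen independently in each fibre, as it only serves
to compare traces. -/
theorem ahClass_shortExact {θ' : EndForm E' (1 + 0)} {θ : EndForm E (1 + 0)}
    {θ'' : EndForm E'' (1 + 0)} {S : HolHom E' E} {P : HolHom E E''} (hθ' : IsHiggsField E' θ')
    (hθ : IsHiggsField E θ) (hθ'' : IsHiggsField E'' θ'') (hS : IsHiggsHom S θ' θ)
    (hP : IsHiggsHom P θ θ'') (h : IsShortExact S P) (k : ℕ) :
    ahClass k E θ = ahClass k E' θ' + ahClass k E'' θ'' := by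
  obtain ⟨D', hD'⟩ := exists_isCompatible E'
  obtain ⟨D'', hD''⟩ := exists_isCompatible E''
  obtain ⟨D, hD, hDS, hDP⟩ := exists_parallel h hD' hD''
  refine (Connection.represents_ahClass hD k (by omega) hθ).unique (Eq.subst
    (motive := fun φ : Form V X (k + 1 + k) => Represents φ _) ?_
    ((Connection.represents_ahClass hD' k (by omega) hθ').add
      (Connection.represents_ahClass hD'' k (by omega) hθ'')))
  rw [← smul_add]
  congr 1
  funext x
  apply toAlg_injective
  obtain ⟨r, σ, hr, hσ, hrσ⟩ := exists_splitting (h x).1 (h x).2.1 (h x).2.2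
  rw [Pi.add_apply, map_add]
  simp only [toAlg_endTr, algMat_endMul, algMat_curvaturePow]
  exact (trace_eq_add_of_exact hr hσ hrσ
    (intertwine_pow_mul (hDS.curvature11 hD' hD x) (hS.algMat x) k)
    (intertwine_pow_mul (hDP.curvature11 hD hD'' x) (hP.algMat x) k)).symm

end ShortExact

end

end HiggsClasses

theorem mainTheorem4
    {V : Type*} [NormedAddCommGroup V] [NormedSpace ℂ V] [FiniteDimensional ℂ V]
    {X : Type*} [TopologicalSpace X] [T2Space X] [SecondCountableTopology X]
    [ChartedSpace V X] [IsManifold 𝓘(ℂ, V) ω X]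
    {W : Type*} [NormedAddCommGroup W] [NormedSpace ℂ W] [FiniteDimensional ℂ W]
    {Y : Type*} [TopologicalSpace Y] [T2Space Y] [SecondCountableTopology Y]
    [ChartedSpace W Y] [IsManifold 𝓘(ℂ, W) ω Y] :
    -- the classes are well defined
    (∀ (E : HolBundle.{_, _, u₁} V X),
      (∃ D : Connection E, D.IsCompatible) ∧
      ∀ D : Connection E, D.IsCompatible →
        EndRepresents D.curvature11 (atiyah E) ∧
        ∀ k : ℕ,
          Represents (coeff k • endTr (D.curvaturePow k)) (atClass k E) ∧
          ∀ θ : EndForm E (1 + 0), IsHiggsField E θ →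
            Represents (p := k + 1) (q := k)
              (coeff k • endTr (endMul (by omega) (D.curvaturePow k) θ)) (ahClass k E θ)) ∧
    -- the product and the pullback in Dolbeault cohomology are well defined
    (∀ (p q p' q' P Q : ℕ) (hP : p + p' = P) (hQ : q + q' = Q)
        (a : Dolbeault V X p q) (b : Dolbeault V X p' q')
        (α : Form V X (p + q)) (β : Form V X (p' + q')), Represents α a → Represents β b →
      Represents (p := P) (q := Q) (fun x => wedge (by omega) (α x) (β x)) (cup hP hQ a b)) ∧
    (∀ f : X → Y, ContMDiff 𝓘(ℂ, V) 𝓘(ℂ, W) ω f →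
      ∀ (p q : ℕ) (c : Dolbeault W Y p q) (α : Form W Y (p + q)), Represents α c →
        Represents (pullbackForm f α) (pullbackClass f c : Dolbeault V X p q)) ∧
    -- (1) naturality
    (∀ (f : X → Y) (hf : ContMDiff 𝓘(ℂ, V) 𝓘(ℂ, W) ω f)
        (E : HolBundle.{_, _, u₁} W Y) (θ : EndForm E (1 + 0)), IsHiggsField E θ →
      IsHiggsField (E.pullback f hf) (pullbackEnd f hf θ) ∧
      ∀ k : ℕ, ahClass k (E.pullback f hf) (pullbackEnd f hf θ) =
        pullbackClass f (ahClass k E θ)) ∧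
    -- (2) additivity on short exact sequences of Higgs bundles
    (∀ (E' : HolBundle.{_, _, u₁} V X) (E : HolBundle.{_, _, u₂} V X)
        (E'' : HolBundle.{_, _, u₃} V X)
        (θ' : EndForm E' (1 + 0)) (θ : EndForm E (1 + 0)) (θ'' : EndForm E'' (1 + 0))
        (S : HolHom E' E) (P : HolHom E E''),
      IsHiggsField E' θ' → IsHiggsField E θ → IsHiggsField E'' θ'' →
      IsHiggsHom S θ' θ → IsHiggsHom P θ θ'' → IsShortExact S P →
      ∀ k : ℕ, ahClass k E θ = ahClass k E' θ' + ahClass k E'' θ'') ∧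
    -- (3) tensor products
    (∀ (E' : HolBundle.{_, _, u₁} V X) (E'' : HolBundle.{_, _, u₂} V X)
        (θ' : EndForm E' (1 + 0)) (θ'' : EndForm E'' (1 + 0)),
      IsHiggsField E' θ' → IsHiggsField E'' θ'' →
      IsHiggsField (E'.tensor E'') (tensorHiggs θ' θ'') ∧
      ∀ k : ℕ, ahClass k (E'.tensor E'') (tensorHiggs θ' θ'') =
        ∑ j : Fin (k + 1),
          (cup (by omega) (by omega) (ahClass j E' θ') (atClass (k - j) E'') +
            cup (by omega) (by omega) (atClass j E') (ahClass (k - j) E'' θ''))) := by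
  refine ⟨fun E => ⟨exists_isCompatible E, fun D hD => ⟨Connection.endRepresents_atiyah hD,
    fun k => ⟨Connection.represents_atClass hD k, fun θ hθ =>
      Connection.represents_ahClass hD k (by omega) hθ⟩⟩⟩, ?_, ?_, ?_, ?_, ?_⟩
  · exact fun p q p' q' P Q hP hQ a b α β hα hβ => Represents.cup hP hQ (by omega) hα hβ
  · exact fun f hf p q c α hα => Represents.pullbackClass hf hα
  · exact fun f hf E θ hθ => ⟨hθ.pullback hf, ahClass_pullback hf hθ⟩
  · exact fun E' E E'' θ' θ θ'' S P h' h h'' hS hP hSP k =>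
      ahClass_shortExact h' h h'' hS hP hSP k
  · exact fun E' E'' θ' θ'' h' h'' => ⟨h'.tensor h'', fun k =>
      ahClass_tensor h' h'' k (fun j => by omega) (fun j => by omega) fun j => by omega⟩
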